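/- Let $\mathcal H$ be a Hardy field, that is, a subfield, closed under differentiation, of the ring of germs at $+\infty$ of real-valued functions on $[1,\infty)$. Let $k\ge 1$ and let $f_1,\dots,f_k:[1,\infty)\to\mathbb R$ be functions whose germs at $+\infty$ belong to $\mathcal H$. Write $f(t)=(f_1(t),\dots,f_k(t))$, $E(t)=\min\{|f_1(t)|,\dots,|f_k(t)|\}$, $\log_2 t=\log\log t$, $e(x)=e^{2\pi i x}$, and $g\prec h$ (or $h\succ g$) if $h(t)/g(t)\to+\infty$ as $t\to\infty$. Suppose that (i) for every $i\in\{1,\dots,k\}$ there is an integer $j\ge 1$ with $t^{j-1}\prec f_i(t)\prec t^{j}$; (ii) $\log_2 t\prec\log f_i(t)$ for every $i\in\{1,\dots,k\}$; (iii) after reordering $f_1,\dots,f_k$ if necessary, $\dfrac{f_{i+1}(t)}{f_i(t)}\succ(\log_2 t)^4$ for $i=1,\dots,k-1$. Then there is a constant $C>0$ (depending only on $f_1,\dots,f_k$) such that for all integers $N\ge 2$, all real numbers $r,s\in\left[1,\min\left\{N,\frac{E(N)}{(\log N)^5}\right\}\right]$ with $r\ge s$, and all nonzero $\tau\in\mathbb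 Z^k\cap[-(\log_2 N)^2,(\log_2 N)^2]^k$, $$\left|\sum_{n=1}^{N} e\left(\frac1r\langle f(sn),\tau\rangle\right)\right|\le\frac{CN}{\log N}.$$ -/

import Mathlib

open Filter

/-- A Hardy field: a subfield of the ring of germs at `+∞` of real functions that is closed under
differentiation, so every germ in it is eventually differentiable and the germ of its derivative
belongs to it again. (Germs at `+∞` of functions on `[1, ∞)` are the same as germs along
`Filter.atTop` of functions on `ℝ`.) -/
structure IsHardyField (H : Subring (Germ (atTop : Filter ℝ) ℝ)) : Prop where
  isField : IsField H
  eventually_differentiableAt : ∀ f : ℝ → ℝ, (f : Germ (atTop : Filter ℝ) ℝ) ∈ H →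
    ∀ᶠ t in atTop, DifferentiableAt ℝ f t
  deriv_mem : ∀ f : ℝ → ℝ, (f : Germ (atTop : Filter ℝ) ℝ) ∈ H →
    ((deriv f : ℝ → ℝ) : Germ (atTop : Filter ℝ) ℝ) ∈ H

/-- `f ≺ g`: the quotient `g(t) / f(t)` tends to `+∞` as `t → ∞`. -/
def Prec (f g : ℝ → ℝ) : Prop :=
  Tendsto (fun t => g t / f t) atTop atTop

/-- The iterated logarithm `log₂ t = log (log t)`. -/
noncomputable def logTwo (t : ℝ) : ℝ := Real.log (Real.log t)

/-- There is a positive integer `j` with `t ^ (j - 1) ≺ f(t) ≺ t ^ j`. -/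
def ConditionB (f : ℝ → ℝ) : Prop :=
  ∃ j : ℕ, 1 ≤ j ∧ Prec (fun t => t ^ (j - 1)) f ∧ Prec f (fun t => t ^ j)

/-- After a reordering of the indices, `f_{i+1} / f_i ≻ (log₂ t)^4` for consecutive indices. -/
def ConditionC {k : ℕ} (f : Fin k → ℝ → ℝ) : Prop :=
  ∃ σ : Equiv.Perm (Fin k), ∀ i j : Fin k, (i : ℕ) + 1 = (j : ℕ) →
    Prec (fun t => logTwo t ^ 4) (fun t => f (σ j) t / f (σ i) t)

/-- `E(t) = min {|f_1(t)|, …, |f_k(t)|}`; an infimum over a finite set, a minimum if `1 ≤ k`. -/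
noncomputable def minAbs {k : ℕ} (f : Fin k → ℝ → ℝ) (t : ℝ) : ℝ := ⨅ i, |f i t|

/-- `e(x) = exp(2πix)`. -/
noncomputable def expChar (x : ℝ) : ℂ := Complex.exp (2 * Real.pi * Complex.I * x)

/-! Let `i₀` be the last index, in the order of growth, whose coefficient in `τ` is nonzero. Every
other function that occurs is smaller than `f i₀` by a factor `(log₂ t)^4`, while the coefficients
are at most `(log₂ N)^2`. So the phase `⟨f(st), τ⟩ / r` behaves like the single term `τ_{i₀}
f_{i₀}(st) / r`, provided that this domination survives differentiation.

Put `F = f_{i₀}(sN) / r`. The hypotheses give `(log N)^5 ≤ F ≤ N^(2j)`, and on `[N / log N, N]` the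
`m`-th derivative of the phase has size `F / N^m` up to powers of `log N`. If `F ≤ N^(1/2)`, the
first derivative is below `1/2` but at least `(log N)^2 / (8N)`, and Kuzmin–Landau
(`norm_sum_expChar_le_of_variation`) applies. If `F > N^(1/2)`, choose `m ≥ 2` with `N^(m-3/2) < F ≤
N^(m-1/2)`; the `m`-th derivative then lies between `N^(-7/4)` and `N^(-1/4)` up to logarithms, and
Weyl–van der Corput (`norm_sum_expChar_le_of_iterate_fwdDiff`) saves a power of `N`, which absorbs
the logarithms. The terms with `n < N / log N` are counted trivially.

The derivative bounds come from Hardy field theory. After adjoining `t`, `log t`, `log₂ t`, `log₃ t`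
(`IsHardySet.exists_extension_logs`), any two functions in play are eventually comparable, so an
inequality that fails is eventually reversed, and integrating the reverse gives a contradiction. If
`|u'/u|` is below the derivative of `-1 / log₃`, then `log |u|` is bounded; for a derivative `u` of
`f` this would make `f` of the exact order of some `t^m`, which the growth condition `t^(j-1) ≺ f ≺
t^j` excludes. Hence differentiating costs a factor between `t` and `t (log t)^2`, up to constants
(`eventually_iterate_deriv_bounds`). The same kind of argument shows that the ratio of two
derivatives loses only a factor `(log₃ t)^3` per differentiation, so `(log₂ t)^4` can be replaced by
`(log₂ t)^3` at every order (`iterate_deriv_mul_logTwo_le`). -/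

/-! ### Exponential sums: the Kuzmin–Landau and second difference tests. -/

lemma expChar_eq (x : ℝ) : expChar x = Complex.exp (Complex.I * ((2 * Real.pi * x : ℝ) : ℂ)) := by
  unfold expChar; congr 1; push_cast; ring

lemma expChar_add (x y : ℝ) : expChar (x + y) = expChar x * expChar y := by
  unfold expChar; rw [← Complex.exp_add]; congr 1; push_cast; ring

@[simp] lemma norm_expChar (x : ℝ) : ‖expChar x‖ = 1 := by
  rw [expChar_eq, mul_comm]; exact Complex.norm_exp_ofReal_mul_I _

@[simp] lemma expChar_zero : expChar 0 = 1 := by simp [expChar]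

lemma expChar_int (k : ℤ) : expChar k = 1 := by
  unfold expChar
  rw [Complex.exp_eq_one_iff]; exact ⟨k, by push_cast; ring⟩

lemma conj_expChar (x : ℝ) : (starRingEnd ℂ) (expChar x) = expChar (-x) := by
  rw [expChar_eq, expChar_eq, ← Complex.exp_conj]; simp [Complex.conj_ofNat]

lemma norm_expChar_sub_one (x : ℝ) : ‖expChar x - 1‖ = 2 * |Real.sin (Real.pi * x)| := by
  rw [expChar_eq, Complex.norm_exp_I_mul_ofReal_sub_one, Real.norm_eq_abs, abs_mul, abs_two]
  congr 3; ring

lemma four_mul_le_norm_expChar_sub_one {x : ℝ} (h0 : 0 ≤ x) (h1 : x ≤ 1 / 2) :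
    4 * x ≤ ‖expChar x - 1‖ := by
  have hpi := Real.pi_pos
  have h := Real.mul_le_sin (x := Real.pi * x) (by positivity) (by nlinarith)
  have e : 2 / Real.pi * (Real.pi * x) = 2 * x := by field_simp
  rw [e] at h
  rw [norm_expChar_sub_one]
  linarith [le_abs_self (Real.sin (Real.pi * x))]

lemma norm_expChar_sub_expChar_le (x y : ℝ) :
    ‖expChar x - expChar y‖ ≤ 2 * Real.pi * |x - y| := by
  have e : expChar x - expChar y = expChar y * (expChar (x - y) - 1) := by
    rw [mul_sub, ← expChar_add]; simp
  have h := Real.abs_sin_le_abs (x := Real.pi * (x - y))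
  rw [abs_mul, abs_of_pos Real.pi_pos] at h
  rw [e, norm_mul, norm_expChar, norm_expChar_sub_one]
  linarith

lemma norm_sum_expChar_le_card (s : Finset ℕ) (x : ℕ → ℝ) :
    ‖∑ n ∈ s, expChar (x n)‖ ≤ s.card := by
  simpa using norm_sum_le s (fun n => expChar (x n))

lemma norm_sum_expChar_neg (s : Finset ℕ) (x : ℕ → ℝ) :
    ‖∑ n ∈ s, expChar (-x n)‖ = ‖∑ n ∈ s, expChar (x n)‖ := by
  rw [← Complex.norm_conj, map_sum]
  simp [conj_expChar]

lemma sum_range_succ_mul_sub (c E : ℕ → ℂ) (N : ℕ) :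
    ∑ n ∈ Finset.range (N + 1), c n * (E (n + 1) - E n) =
      c N * E (N + 1) - c 0 * E 0 - ∑ n ∈ Finset.range N, (c (n + 1) - c n) * E (n + 1) := by
  induction N with
  | zero => simp; ring
  | succ N ih => rw [Finset.sum_range_succ, ih, Finset.sum_range_succ]; ring

lemma norm_inv_expChar_sub_one_sub_le {x y : ℝ} (hx : 0 < x) (hx' : x ≤ 1 / 2) (hy : 0 < y)
    (hy' : y ≤ 1 / 2) :
    ‖(expChar x - 1)⁻¹ - (expChar y - 1)⁻¹‖ ≤ |1 / x - 1 / y| := by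
  have h1 := four_mul_le_norm_expChar_sub_one hx.le hx'
  have h2 := four_mul_le_norm_expChar_sub_one hy.le hy'
  have n1 : expChar x - 1 ≠ 0 := norm_pos_iff.1 (by linarith)
  have n2 : expChar y - 1 ≠ 0 := norm_pos_iff.1 (by linarith)
  have e : (expChar x - 1)⁻¹ - (expChar y - 1)⁻¹ =
      (expChar y - expChar x) / ((expChar x - 1) * (expChar y - 1)) := by
    field_simp; ring
  have e2 : |1 / x - 1 / y| = |y - x| / (x * y) := by
    rw [show 1 / x - 1 / y = (y - x) / (x * y) by field_simp, abs_div, abs_of_pos (mul_pos hx hy)]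
  rw [e, e2, norm_div, norm_mul]
  have h3 := norm_expChar_sub_expChar_le y x
  have hpi := Real.pi_lt_four
  calc _ ≤ (2 * Real.pi * |y - x|) / ((4 * x) * (4 * y)) := by gcongr
    _ ≤ (16 * |y - x|) / ((4 * x) * (4 * y)) := by
        gcongr; linarith
    _ = _ := by field_simp; ring

/-- Kuzmin–Landau with a bound on the variation of the reciprocal differences. -/
lemma norm_sum_expChar_le_of_variation (x : ℕ → ℝ) (N : ℕ) {δ : ℝ} (hδ : 0 < δ)
    (hl : ∀ n ≤ N, δ ≤ x (n + 1) - x n) (hu : ∀ n ≤ N, x (n + 1) - x n ≤ 1 / 2)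
    (hv : ∑ n ∈ Finset.range N,
      |1 / (x (n + 2) - x (n + 1)) - 1 / (x (n + 1) - x n)| ≤ 1 / δ) :
    ‖∑ n ∈ Finset.range (N + 1), expChar (x n)‖ ≤ 2 / δ := by
  -- Each term is `c n` times the increment of `expChar ∘ x`, so partial summation leaves two
  -- boundary terms, at most `1 / (4δ)` each, and the variation of `c`, at most `1 / δ`.
  set c : ℕ → ℂ := fun n => (expChar (x (n + 1) - x n) - 1)⁻¹ with hc
  have hcn : ∀ n ≤ N, ‖c n‖ ≤ 1 / (4 * δ) := by
    intro n hn
    have h := four_mul_le_norm_expChar_sub_one (hδ.le.trans (hl n hn)) (hu n hn)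
    have h5 : 4 * δ ≤ ‖expChar (x (n + 1) - x n) - 1‖ := by linarith [hl n hn]
    rw [hc, norm_inv, ← one_div]
    exact one_div_le_one_div_of_le (by positivity) h5
  have hE : ∀ n ∈ Finset.range (N + 1),
      expChar (x n) = c n * (expChar (x (n + 1)) - expChar (x n)) := by
    intro n hn
    have hn : n ≤ N := by simpa [Nat.lt_succ_iff] using hn
    have h := four_mul_le_norm_expChar_sub_one (hδ.le.trans (hl n hn)) (hu n hn)
    have n1 : expChar (x (n + 1) - x n) - 1 ≠ 0 := norm_pos_iff.1 (by linarith [hl n hn])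
    have e : expChar (x (n + 1)) = expChar (x n) * expChar (x (n + 1) - x n) := by
      rw [← expChar_add]; congr 1; ring
    rw [e, hc]; field_simp
  rw [Finset.sum_congr rfl hE, sum_range_succ_mul_sub c (fun n => expChar (x n))]
  have h1 : ‖∑ n ∈ Finset.range N, (c (n + 1) - c n) * expChar (x (n + 1))‖ ≤ 1 / δ := by
    refine (norm_sum_le _ _).trans ((Finset.sum_le_sum fun n hn => ?_).trans hv)
    have hn := Finset.mem_range.1 hn
    rw [norm_mul, norm_expChar, mul_one]
    exact norm_inv_expChar_sub_one_sub_le (hδ.trans_le (hl (n + 1) hn)) (hu (n + 1) hn)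
      (hδ.trans_le (hl n hn.le)) (hu n hn.le)
  have h2 := hcn N le_rfl
  have h3 := hcn 0 (Nat.zero_le _)
  have e1 : 2 / δ = 2 * (1 / δ) := by ring
  have e2 : 1 / (4 * δ) = (1 / 4) * (1 / δ) := by field_simp
  have hp : 0 < 1 / δ := by positivity
  calc _ ≤ ‖c N * expChar (x (N + 1))‖ + ‖c 0 * expChar (x 0)‖ + 1 / δ :=
        (norm_sub_le _ _).trans (add_le_add (norm_sub_le _ _) h1)
    _ ≤ _ := by
        rw [norm_mul, norm_mul, norm_expChar, norm_expChar, e1]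
        rw [e2] at h2 h3; linarith

/-- The reciprocals of the differences are monotone, so their total variation telescopes. -/
lemma norm_sum_expChar_le_of_monotone (x : ℕ → ℝ) (N : ℕ) {δ : ℝ} (hδ : 0 < δ)
    (hl : ∀ n < N, δ ≤ x (n + 1) - x n) (hu : ∀ n < N, x (n + 1) - x n ≤ 1 / 2)
    (hm : ∀ n, n + 1 < N → x (n + 1) - x n ≤ x (n + 2) - x (n + 1)) :
    ‖∑ n ∈ Finset.range N, expChar (x n)‖ ≤ 2 / δ := by
  rcases N with _ | N
  · simp; positivity
  refine norm_sum_expChar_le_of_variation x N hδ (fun n hn => hl n (by omega))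
    (fun n hn => hu n (by omega)) ?_
  have : ∀ n ∈ Finset.range N, |1 / (x (n + 2) - x (n + 1)) - 1 / (x (n + 1) - x n)| =
      1 / (x (n + 1) - x n) - 1 / (x (n + 1 + 1) - x (n + 1)) := by
    intro n hn
    have hn := Finset.mem_range.1 hn
    have := one_div_le_one_div_of_le (hδ.trans_le (hl n (by omega))) (hm n (by omega))
    rw [abs_of_nonpos (by linarith)]; ring
  rw [Finset.sum_congr rfl this, Finset.sum_range_sub' (fun n => 1 / (x (n + 1) - x n))]
  have h0 := one_div_le_one_div_of_le hδ (hl 0 (by omega))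
  have h1 : 0 ≤ 1 / (x (N + 1) - x N) := one_div_nonneg.2 (hδ.le.trans (hl N (by omega)))
  linarith

lemma norm_sum_expChar_le_of_antitone (x : ℕ → ℝ) (N : ℕ) {δ : ℝ} (hδ : 0 < δ)
    (hl : ∀ n < N, δ ≤ x (n + 1) - x n) (hu : ∀ n < N, x (n + 1) - x n ≤ 1 / 2)
    (hm : ∀ n, n + 1 < N → x (n + 2) - x (n + 1) ≤ x (n + 1) - x n) :
    ‖∑ n ∈ Finset.range N, expChar (x n)‖ ≤ 2 / δ := by
  rcases N with _ | N
  · simp; positivity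
  refine norm_sum_expChar_le_of_variation x N hδ (fun n hn => hl n (by omega))
    (fun n hn => hu n (by omega)) ?_
  have : ∀ n ∈ Finset.range N, |1 / (x (n + 2) - x (n + 1)) - 1 / (x (n + 1) - x n)| =
      1 / (x (n + 1 + 1) - x (n + 1)) - 1 / (x (n + 1) - x n) := by
    intro n hn
    have hn := Finset.mem_range.1 hn
    have := one_div_le_one_div_of_le (hδ.trans_le (hl (n + 1) (by omega))) (hm n (by omega))
    rw [abs_of_nonneg (by linarith)]
  rw [Finset.sum_congr rfl this, Finset.sum_range_sub (fun n => 1 / (x (n + 1) - x n))]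
  have h0 := one_div_le_one_div_of_le hδ (hl N (by omega))
  have h1 : 0 ≤ 1 / (x (0 + 1) - x 0) := one_div_nonneg.2 (hδ.le.trans (hl 0 (by omega)))
  linarith

lemma exists_eq_Ico_of_ordConnected (s : Finset ℕ)
    (hs : ∀ a ∈ s, ∀ b ∈ s, ∀ n, a ≤ n → n ≤ b → n ∈ s) : ∃ a b, a ≤ b ∧ s = Finset.Ico a b := by
  rcases s.eq_empty_or_nonempty with h | h
  · exact ⟨0, 0, le_rfl, by simp [h]⟩
  · refine ⟨s.min' h, s.max' h + 1, (s.min'_le _ (s.max'_mem h)).trans (Nat.le_succ _), ?_⟩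
    ext n
    simp only [Finset.mem_Ico, Nat.lt_succ_iff]
    exact ⟨fun hn => ⟨s.min'_le _ hn, s.le_max' _ hn⟩,
      fun hn => hs _ (s.min'_mem h) _ (s.max'_mem h) n hn.1 hn.2⟩

/-- Removing the integer-valued sequence `k n` shifts all differences by `k`, which brings them near
`0`, where Kuzmin–Landau applies. -/
lemma norm_sum_Ico_expChar_sub_int (x : ℕ → ℝ) (k : ℤ) (a b : ℕ) :
    ‖∑ n ∈ Finset.Ico a b, expChar (x n)‖ =
      ‖∑ n ∈ Finset.range (b - a), expChar (x (a + n) - k * (n : ℝ))‖ := by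
  rw [Finset.sum_Ico_eq_sum_range]
  congr 1
  refine Finset.sum_congr rfl fun n _ => ?_
  have : expChar (x (a + n)) = expChar (x (a + n) - k * n) * expChar ((k * n : ℤ) : ℝ) := by
    rw [← expChar_add]; congr 1; push_cast; ring
  rw [this, expChar_int, mul_one]

/-- Second difference test. -/
lemma norm_sum_expChar_le_of_second_diff (x : ℕ → ℝ) (M : ℕ) {lam K : ℝ} (hlam : 0 < lam)
    (hlam1 : lam ≤ 1)
    (hl : ∀ n, n + 2 < M → lam ≤ (x (n + 2) - x (n + 1)) - (x (n + 1) - x n))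
    (hu : ∀ n, n + 2 < M → (x (n + 2) - x (n + 1)) - (x (n + 1) - x n) ≤ K * lam) (hK : 0 ≤ K) :
    ‖∑ n ∈ Finset.range M, expChar (x n)‖ ≤ 8 * (K * lam * M + 2) / √lam := by
  have hsq : 0 < √lam := Real.sqrt_pos.2 hlam
  have hsq1 : √lam ≤ 1 := Real.sqrt_le_one.2 hlam1
  rcases M with _ | M
  · simp; positivity
  set d : ℕ → ℝ := fun n => x (n + 1) - x n with hd
  have hstep : ∀ m n, m ≤ n → n < M → lam * ((n : ℝ) - m) ≤ d n - d m ∧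
      d n - d m ≤ K * lam * ((n : ℝ) - m) := by
    intro m n hmn
    induction n, hmn using Nat.le_induction with
    | base => intro _; simp
    | succ n hmn ih =>
      intro hn
      obtain ⟨h1, h2⟩ := ih (by omega)
      have h3 := hl n (by omega)
      have h4 := hu n (by omega)
      simp only [hd] at *
      push_cast
      constructor <;> linarith
  have hmono : ∀ m n, m ≤ n → n < M → d m ≤ d n := by
    intro m n hmn hn
    have h := (hstep m n hmn hn).1
    have : (0 : ℝ) ≤ (n : ℝ) - m := sub_nonneg.2 (by exact_mod_cast hmn)
    nlinarith
  -- The threshold balances the two estimates near an integer: Kuzmin–Landau gives `2 / δ` where the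
  -- difference is farther than `δ` from it, and at most `2δ / lam + 1` terms are closer.
  set δ : ℝ := √lam with hδ
  have hδ2 : δ / lam = 1 / √lam := by
    rw [hδ]; field_simp; exact Real.sq_sqrt hlam.le
  -- Nearest integer to the difference. As `d` is monotone, the fibres of `κ` are intervals, and
  -- there are at most `K * lam * M + 2` of them.
  set κ : ℕ → ℤ := fun n => ⌊d n + 1 / 2⌋ with hκ
  have hκmono : ∀ m n, m ≤ n → n < M → κ m ≤ κ n := fun m n hmn hn =>
    Int.floor_le_floor (by linarith [hmono m n hmn hn])
  have hκl : ∀ n, (κ n : ℝ) - 1 / 2 ≤ d n := fun n => by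
    linarith [Int.floor_le (d n + 1 / 2)]
  have hκu : ∀ n, d n ≤ (κ n : ℝ) + 1 / 2 := fun n => by
    linarith [Int.lt_floor_add_one (d n + 1 / 2)]
  have hfib : ∀ k : ℤ, ‖∑ n ∈ Finset.range M with κ n = k, expChar (x n)‖ ≤ 7 / √lam := by
    intro k
    have hconn : ∀ (P : ℝ → Prop) [DecidablePred P], (∀ a b c, P a → P c → a ≤ b → b ≤ c → P b) →
        ∃ a b, a ≤ b ∧ (Finset.range M).filter (fun n => κ n = k ∧ P (d n)) = Finset.Ico a b := by
      intro P _ hP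
      refine exists_eq_Ico_of_ordConnected _ fun a ha b hb n h1 h2 => ?_
      simp only [Finset.mem_filter, Finset.mem_range] at ha hb ⊢
      have hn : n < M := by omega
      refine ⟨hn, le_antisymm ?_ ?_, hP _ _ _ ha.2.2 hb.2.2 (hmono _ _ h1 hn) (hmono _ _ h2 hb.1)⟩
      · rw [← hb.2.1]; exact hκmono _ _ h2 hb.1
      · rw [← ha.2.1]; exact hκmono _ _ h1 hn
    have hA : ‖∑ n ∈ Finset.range M with (κ n = k ∧ k + δ < d n), expChar (x n)‖ ≤ 2 / δ := by
      obtain ⟨a, b, hab, he⟩ := hconn (fun t => k + δ < t) (fun a b c h1 _ h3 _ => h1.trans_le h3)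
      have hmem : ∀ n, n < b - a → a + n < M ∧ κ (a + n) = k ∧ k + δ < d (a + n) := by
        intro n hn
        have : a + n ∈ Finset.Ico a b := by simp; omega
        rw [← he] at this
        simpa using this
      rw [he, norm_sum_Ico_expChar_sub_int x k]
      refine norm_sum_expChar_le_of_monotone _ _ hsq ?_ ?_ ?_
      · intro n hn
        have := (hmem n hn).2.2
        simp only [hd] at this
        push_cast; rw [← add_assoc]; linarith
      · intro n hn
        have h1 := hκu (a + n)
        rw [(hmem n hn).2.1] at h1
        simp only [hd] at h1
        push_cast; rw [← add_assoc]; linarith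
      · intro n hn
        have h1 := hmono (a + n) (a + n + 1) (by omega) (by have := (hmem (n + 1) hn).1; omega)
        simp only [hd] at h1
        push_cast; rw [← add_assoc, ← add_assoc]; linarith
    have hB : ‖∑ n ∈ Finset.range M with (κ n = k ∧ d n < k - δ), expChar (x n)‖ ≤ 2 / δ := by
      obtain ⟨a, b, hab, he⟩ := hconn (fun t => t < k - δ) (fun a b c _ h2 _ h3 => h3.trans_lt h2)
      have hmem : ∀ n, n < b - a → a + n < M ∧ κ (a + n) = k ∧ d (a + n) < k - δ := by
        intro n hn
        have : a + n ∈ Finset.Ico a b := by simp; omega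
        rw [← he] at this
        simpa using this
      rw [he, norm_sum_Ico_expChar_sub_int x k, ← norm_sum_expChar_neg]
      refine norm_sum_expChar_le_of_antitone _ _ hsq ?_ ?_ ?_
      · intro n hn
        have := (hmem n hn).2.2
        simp only [hd] at this
        push_cast; rw [← add_assoc]; linarith
      · intro n hn
        have h1 := hκl (a + n)
        rw [(hmem n hn).2.1] at h1
        simp only [hd] at h1
        push_cast; rw [← add_assoc]; linarith
      · intro n hn
        have h1 := hmono (a + n) (a + n + 1) (by omega) (by have := (hmem (n + 1) hn).1; omega)
        simp only [hd] at h1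
        push_cast; rw [← add_assoc, ← add_assoc]; linarith
    have hC : ‖∑ n ∈ Finset.range M with (κ n = k ∧ (k - δ ≤ d n ∧ d n ≤ k + δ)),
        expChar (x n)‖ ≤ 2 / δ + 1 := by
      obtain ⟨a, b, hab, he⟩ := hconn (fun t => k - δ ≤ t ∧ t ≤ k + δ)
        (fun a b c h1 h2 h3 h4 => ⟨h1.1.trans h3, h4.trans h2.2⟩)
      refine (norm_sum_expChar_le_card _ _).trans ?_
      rw [he, Nat.card_Ico]
      rcases hab.eq_or_lt with h | h
      · simp [h]; positivity
      · have h1 : a ∈ Finset.Ico a b := by simp [h]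
        have h2 : b - 1 ∈ Finset.Ico a b := by simp; omega
        rw [← he] at h1 h2
        simp only [Finset.mem_filter, Finset.mem_range] at h1 h2
        have h3 := (hstep a (b - 1) (by omega) h2.1).1
        have h4 : lam * (((b - 1 : ℕ) : ℝ) - a) ≤ 2 * δ := by linarith [h1.2.2.1, h2.2.2.2]
        rw [Nat.cast_sub hab, Nat.cast_sub (by omega)] at *
        have h5 : ((b : ℝ) - 1 - a) ≤ 2 * δ / lam := by
          rw [le_div_iff₀ hlam]; push_cast at h4; linarith
        rw [mul_div_assoc, hδ2] at h5
        rw [hδ]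
        have : 2 * (1 / √lam) = 2 / √lam := by ring
        linarith
    have hsplit : ∑ n ∈ Finset.range M with κ n = k, expChar (x n) =
        ∑ n ∈ Finset.range M with (κ n = k ∧ k + δ < d n), expChar (x n) +
        ∑ n ∈ Finset.range M with (κ n = k ∧ d n < k - δ), expChar (x n) +
        ∑ n ∈ Finset.range M with (κ n = k ∧ (k - δ ≤ d n ∧ d n ≤ k + δ)), expChar (x n) := by
      simp only [Finset.sum_filter, ← Finset.sum_add_distrib]
      refine Finset.sum_congr rfl fun n _ => ?_
      by_cases h1 : κ n = k
      · by_cases h2 : k + δ < d n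
        · have h3 : ¬ d n < k - δ := by linarith
          have h4 : ¬ d n ≤ k + δ := by linarith
          simp [h1, h2, h3, h4]
        · by_cases h3 : d n < k - δ
          · have h4 : ¬ k - δ ≤ d n := by linarith
            simp [h1, h2, h3, h4]
          · have h4 : k - δ ≤ d n := by linarith
            have h5 : d n ≤ k + δ := by linarith
            simp [h1, h2, h3, h4, h5]
      · simp [h1]
    rw [hsplit]
    refine (norm_add₃_le).trans ?_
    have : 1 ≤ 1 / √lam := by rw [le_div_iff₀ hsq]; linarith
    have e : 7 / √lam = 2 / √lam + 2 / √lam + 2 / √lam + 1 / √lam := by ring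
    rw [e]; linarith
  -- The differences `d n` are controlled only for `n < M`; the last term is bounded by `1`.
  rw [Finset.sum_range_succ]
  have hmain : ‖∑ n ∈ Finset.range M, expChar (x n)‖ ≤ (K * lam * M + 2) * (7 / √lam) := by
    rcases M with _ | M
    · simp; positivity
    have hmaps : ∀ n ∈ Finset.range (M + 1), κ n ∈ Finset.Icc (κ 0) (κ M) := by
      intro n hn
      have hn := Finset.mem_range.1 hn
      exact Finset.mem_Icc.2 ⟨hκmono 0 n (by omega) hn, hκmono n M (by omega) (by omega)⟩
    rw [← Finset.sum_fiberwise_of_maps_to hmaps]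
    refine (norm_sum_le _ _).trans ((Finset.sum_le_card_nsmul _ _ _ fun k _ => hfib k).trans ?_)
    rw [nsmul_eq_mul]
    refine mul_le_mul_of_nonneg_right ?_ (by positivity)
    have h0 := hκmono 0 M (by omega) (by omega)
    rw [Int.card_Icc, ← Int.cast_natCast, Int.toNat_of_nonneg (by omega)]
    have h1 := (hstep 0 M (by omega) (by omega)).2
    have h2 := hκl M
    have h3 := hκu 0
    have h4 : 0 ≤ K * lam := by positivity
    push_cast at h1 ⊢
    nlinarith
  refine (norm_add_le _ _).trans ?_
  rw [norm_expChar]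
  have h1 : 1 ≤ 1 / √lam := by rw [le_div_iff₀ hsq]; linarith
  have h4 : 0 ≤ K * lam := by positivity
  have e : 8 * (K * lam * ((M + 1 : ℕ) : ℝ) + 2) / √lam =
    (K * lam * M + 2) * (7 / √lam) + (K * lam * M + 2 + 8 * (K * lam)) * (1 / √lam) := by
    push_cast; ring
  rw [e]
  have h5 : 1 ≤ (K * lam * M + 2 + 8 * (K * lam)) * (1 / √lam) := by
    refine one_le_mul_of_one_le_of_one_le ?_ h1
    have : 0 ≤ K * lam * M := by positivity
    linarith
  linarith

/-! ### Weyl differencing and higher order differences. -/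

lemma norm_sum_range_sub_sum_shift_le (z : ℕ → ℂ) (hz : ∀ n, ‖z n‖ ≤ 1) (M H h : ℕ) (hh : h < H) :
    ‖∑ n ∈ Finset.range M, z n - ∑ n ∈ Finset.range (M - H), z (n + h)‖ ≤ H := by
  have key : ∀ s : Finset ℕ, ‖∑ n ∈ s, z n‖ ≤ s.card := fun s =>
    (norm_sum_le _ _).trans ((Finset.sum_le_sum fun n _ => hz n).trans (by simp))
  rcases le_or_gt M H with h1 | h1
  · rw [Nat.sub_eq_zero_of_le h1]
    simp only [Finset.range_zero, Finset.sum_empty, sub_zero]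
    exact (key _).trans (by simpa using h1)
  · have e : ∑ n ∈ Finset.range (M - H), z (n + h) = ∑ n ∈ Finset.Ico h (M - H + h), z n := by
      rw [Finset.sum_Ico_eq_sum_range]
      simp [add_comm]
    have hsub : Finset.Ico h (M - H + h) ⊆ Finset.range M := by
      intro n hn
      simp only [Finset.mem_Ico, Finset.mem_range] at *
      omega
    rw [e, ← Finset.sum_sdiff hsub, add_sub_cancel_right]
    refine (key _).trans ?_
    rw [Finset.card_sdiff_of_subset hsub]
    simp only [Finset.card_range, Nat.card_Ico]
    exact_mod_cast (by omega)

/-- Weyl–van der Corput differencing. -/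
lemma sq_norm_sum_le_of_differences (z : ℕ → ℂ) (hz : ∀ n, ‖z n‖ ≤ 1) (M H : ℕ) (hH : 1 ≤ H)
    {B : ℝ} (hB0 : 0 ≤ B)
    (hB : ∀ h' h, h' < h → h < H →
      ‖∑ n ∈ Finset.range (M - H), z (n + h) * (starRingEnd ℂ) (z (n + h'))‖ ≤ B) :
    ‖∑ n ∈ Finset.range M, z n‖ ^ 2 ≤ 2 * (H : ℝ) ^ 2 + 2 * (M : ℝ) ^ 2 / H + 2 * M * B := by
  have hHpos : (0 : ℝ) < H := by exact_mod_cast hH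
  set S := ∑ n ∈ Finset.range M, z n with hS
  -- Averaging over `H` shifts replaces `H * S` by the sum of `w`, up to boundary terms of total
  -- size `H ^ 2`. Cauchy–Schwarz and expansion of `‖w n‖ ^ 2` then leave `H` diagonal terms, at
  -- most `M` each, and correlations bounded by `B`.
  set w : ℕ → ℂ := fun n => ∑ h ∈ Finset.range H, z (n + h) with hw
  have h1 : (H : ℝ) * ‖S‖ ≤ ‖∑ n ∈ Finset.range (M - H), w n‖ + (H : ℝ) ^ 2 := by
    have e : (H : ℂ) * S - ∑ n ∈ Finset.range (M - H), w n =
        ∑ h ∈ Finset.range H, (S - ∑ n ∈ Finset.range (M - H), z (n + h)) := by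
      rw [hw, Finset.sum_comm, Finset.sum_sub_distrib]
      simp
    have h2 : ‖(H : ℂ) * S - ∑ n ∈ Finset.range (M - H), w n‖ ≤ (H : ℝ) ^ 2 := by
      rw [e]
      refine (norm_sum_le _ _).trans ((Finset.sum_le_sum fun h hh =>
        norm_sum_range_sub_sum_shift_le z hz M H h (Finset.mem_range.1 hh)).trans ?_)
      simp [sq]
    have h3 := norm_sub_norm_le ((H : ℂ) * S) (∑ n ∈ Finset.range (M - H), w n)
    rw [norm_mul, Complex.norm_natCast] at h3
    linarith
  have hMH : ((M - H : ℕ) : ℝ) ≤ M := by exact_mod_cast Nat.sub_le _ _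
  have h2 : ‖∑ n ∈ Finset.range (M - H), w n‖ ^ 2 ≤
      M * ∑ n ∈ Finset.range (M - H), ‖w n‖ ^ 2 := by
    calc _ ≤ (∑ n ∈ Finset.range (M - H), ‖w n‖) ^ 2 := by
          gcongr; exact norm_sum_le _ _
      _ ≤ ((M - H : ℕ) : ℝ) * ∑ n ∈ Finset.range (M - H), ‖w n‖ ^ 2 := by
          simpa using sq_sum_le_card_mul_sum_sq (s := Finset.range (M - H)) (f := fun n => ‖w n‖)
      _ ≤ _ := by
          refine mul_le_mul_of_nonneg_right hMH (Finset.sum_nonneg fun n _ => by positivity)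
  have h3 : ∑ n ∈ Finset.range (M - H), ‖w n‖ ^ 2 ≤ H * M + (H : ℝ) ^ 2 * B := by
    have e : ((∑ n ∈ Finset.range (M - H), ‖w n‖ ^ 2 : ℝ) : ℂ) =
        ∑ h ∈ Finset.range H, ∑ h' ∈ Finset.range H, ∑ n ∈ Finset.range (M - H),
          z (n + h) * (starRingEnd ℂ) (z (n + h')) := by
      push_cast
      have : ∀ n, ((‖w n‖ : ℂ)) ^ 2 = ∑ h ∈ Finset.range H, ∑ h' ∈ Finset.range H,
          z (n + h) * (starRingEnd ℂ) (z (n + h')) := by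
        intro n
        rw [← Complex.mul_conj', hw, map_sum, Finset.sum_mul_sum]
      rw [Finset.sum_congr rfl fun n _ => this n, Finset.sum_comm]
      refine Finset.sum_congr rfl fun h _ => ?_
      rw [Finset.sum_comm]
    have hterm : ∀ h ∈ Finset.range H, ∀ h' ∈ Finset.range H,
        ‖∑ n ∈ Finset.range (M - H), z (n + h) * (starRingEnd ℂ) (z (n + h'))‖ ≤
          (if h = h' then (M : ℝ) else 0) + B := by
      intro h hh h' hh'
      have hh := Finset.mem_range.1 hh
      have hh' := Finset.mem_range.1 hh'
      rcases lt_trichotomy h' h with hlt | heq | hgt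
      · rw [if_neg hlt.ne']; simpa using hB h' h hlt hh
      · subst heq
        rw [if_pos rfl]
        have : ‖∑ n ∈ Finset.range (M - H), z (n + h') * (starRingEnd ℂ) (z (n + h'))‖ ≤ M := by
          refine (norm_sum_le _ _).trans (le_trans (Finset.sum_le_sum (g := fun _ => 1)
            fun n _ => ?_) ?_)
          · rw [norm_mul, Complex.norm_conj]
            exact mul_le_one₀ (hz _) (norm_nonneg _) (hz _)
          · simp
        linarith
      · rw [if_neg hgt.ne, ← Complex.norm_conj, map_sum]
        have := hB h h' hgt hh'
        simpa [mul_comm] using this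
    have hn : (∑ n ∈ Finset.range (M - H), ‖w n‖ ^ 2) =
        ‖((∑ n ∈ Finset.range (M - H), ‖w n‖ ^ 2 : ℝ) : ℂ)‖ := by
      rw [Complex.norm_real, Real.norm_of_nonneg (Finset.sum_nonneg fun n _ => by positivity)]
    rw [hn, e]
    refine (norm_sum_le _ _).trans ((Finset.sum_le_sum fun h hh =>
      (norm_sum_le _ _).trans (Finset.sum_le_sum fun h' hh' => hterm h hh h' hh')).trans ?_)
    have : ∀ h ∈ Finset.range H, ∑ h' ∈ Finset.range H, ((if h = h' then (M : ℝ) else 0) + B) =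
        M + H * B := by
      intro h hh
      rw [Finset.sum_add_distrib, Finset.sum_ite_eq, if_pos hh]
      simp
    rw [Finset.sum_congr rfl this]
    simp only [Finset.sum_const, Finset.card_range, nsmul_eq_mul]
    apply le_of_eq; ring
  have hM0 : (0 : ℝ) ≤ M := Nat.cast_nonneg _
  have h4 : ((H : ℝ) * ‖S‖) ^ 2 ≤ 2 * (M * (H * M + (H : ℝ) ^ 2 * B)) + 2 * ((H : ℝ) ^ 2) ^ 2 := by
    have h5 : ‖∑ n ∈ Finset.range (M - H), w n‖ ^ 2 ≤ M * (H * M + (H : ℝ) ^ 2 * B) :=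
      h2.trans (mul_le_mul_of_nonneg_left h3 hM0)
    have h6 : ((H : ℝ) * ‖S‖) ^ 2 ≤ (‖∑ n ∈ Finset.range (M - H), w n‖ + (H : ℝ) ^ 2) ^ 2 := by
      gcongr
    nlinarith [sq_nonneg (‖∑ n ∈ Finset.range (M - H), w n‖ - (H : ℝ) ^ 2)]
  have e : 2 * (H : ℝ) ^ 2 + 2 * (M : ℝ) ^ 2 / H + 2 * M * B =
      (2 * (M * (H * M + (H : ℝ) ^ 2 * B)) + 2 * ((H : ℝ) ^ 2) ^ 2) / (H : ℝ) ^ 2 := by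
    field_simp; ring
  rw [e, le_div_iff₀ (by positivity)]
  linarith [h4, mul_pow (H : ℝ) ‖S‖ 2]

/-- After Weyl differencing the `k`-th difference is a sum of `h - h'` values of the `(k+1)`-th
difference of `x`. Two-sided bounds `lam`, `K * lam` thus become bounds with `(h - h') * lam` and
the same `K`, which drives the induction on the order. -/
lemma fwdDiff_iterate_sub_shift (x : ℕ → ℝ) (k h' h n : ℕ) (hh : h' ≤ h) :
    (fwdDiff 1)^[k] (fun n => x (n + h) - x (n + h')) n =
      ∑ l ∈ Finset.Ico h' h, (fwdDiff 1)^[k + 1] x (n + l) := by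
  have e : (fun n => x (n + h) - x (n + h')) =
      ∑ l ∈ Finset.Ico h' h, fun n => fwdDiff 1 x (n + l) := by
    funext n
    rw [Finset.sum_apply]
    simp only [fwdDiff, add_assoc]
    exact (Finset.sum_Ico_sub (fun l => x (n + l)) hh).symm
  rw [e, fwdDiff_iter_finsetSum, Finset.sum_apply]
  refine Finset.sum_congr rfl fun l _ => ?_
  rw [fwdDiff_iter_comp_add, Function.iterate_succ_apply]

/-- Weyl–van der Corput estimate for sequences with a small nonvanishing iterated difference. -/
theorem norm_sum_expChar_le_of_iterate_fwdDiff (m : ℕ) : ∀ β : ℝ, 0 < β → β ≤ 1 →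
    ∃ c : ℝ, 0 < c ∧ ∃ C : ℝ, 0 < C ∧ ∀ N : ℝ, 1 ≤ N → ∀ M : ℕ, (M : ℝ) ≤ N →
      ∀ K lam : ℝ, 1 ≤ K → N ^ (-(7 / 4) : ℝ) ≤ lam → lam ≤ N ^ (-β) →
      ∀ x : ℕ → ℝ, (∀ n, n + (m + 2) < M → lam ≤ (fwdDiff 1)^[m + 2] x n ∧
        (fwdDiff 1)^[m + 2] x n ≤ K * lam) →
      ‖∑ n ∈ Finset.range M, expChar (x n)‖ ≤ C * K * N ^ (1 - c) := by
  induction m with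
  | zero =>
    intro β hβ hβ1
    -- The second difference test produces two terms: `N √lam ≤ N ^ (1 - β / 2)` and `1 / √lam ≤ N ^
    -- (7 / 8)`.
    refine ⟨min (β / 2) (1 / 8), by positivity, 24, by norm_num, ?_⟩
    intro N hN M hM K lam hK hl hu x hx
    have hN0 : 0 < N := by linarith
    have hlam : 0 < lam := (Real.rpow_pos_of_pos hN0 _).trans_le hl
    have hlam1 : lam ≤ 1 := hu.trans (Real.rpow_le_one_of_one_le_of_nonpos hN (by linarith))
    have hx' : ∀ n, n + 2 < M → lam ≤ (x (n + 2) - x (n + 1)) - (x (n + 1) - x n) ∧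
        (x (n + 2) - x (n + 1)) - (x (n + 1) - x n) ≤ K * lam := by
      intro n hn
      simpa [fwdDiff, add_assoc] using hx n hn
    refine (norm_sum_expChar_le_of_second_diff x M hlam hlam1 (fun n hn => (hx' n hn).1)
      (fun n hn => (hx' n hn).2) (by linarith)).trans ?_
    set c := min (β / 2) (1 / 8) with hc
    have hsq : 0 < √lam := Real.sqrt_pos.2 hlam
    have e : 8 * (K * lam * M + 2) / √lam = 8 * K * M * √lam + 16 * (1 / √lam) := by
      field_simp
      rw [Real.sq_sqrt hlam.le]; ring
    have h1 : √lam ≤ N ^ (-(β / 2)) := by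
      rw [Real.sqrt_le_iff]
      refine ⟨by positivity, hu.trans (le_of_eq ?_)⟩
      rw [← Real.rpow_natCast, ← Real.rpow_mul hN0.le]; congr 1; push_cast; ring
    have h2 : 1 / √lam ≤ N ^ (7 / 8 : ℝ) := by
      rw [div_le_iff₀ hsq, ← div_le_iff₀' (by positivity), one_div, ← Real.rpow_neg hN0.le]
      apply Real.le_sqrt_of_sq_le
      refine le_trans (le_of_eq ?_) hl
      rw [← Real.rpow_natCast, ← Real.rpow_mul hN0.le]; congr 1; norm_num
    have h3 : N * N ^ (-(β / 2)) ≤ N ^ (1 - c) := by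
      nth_rewrite 1 [← Real.rpow_one N]
      rw [← Real.rpow_add hN0]
      apply Real.rpow_le_rpow_of_exponent_le hN
      linarith [min_le_left (β / 2) (1 / 8 : ℝ)]
    have h4 : N ^ (7 / 8 : ℝ) ≤ N ^ (1 - c) := by
      apply Real.rpow_le_rpow_of_exponent_le hN
      linarith [min_le_right (β / 2) (1 / 8 : ℝ)]
    have h5 : (M : ℝ) * √lam ≤ N * N ^ (-(β / 2)) := by gcongr
    have hp : 0 < N ^ (1 - c) := by positivity
    rw [e]
    nlinarith [mul_le_mul_of_nonneg_left (h5.trans h3) (by linarith : 0 ≤ 8 * K),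
      mul_le_mul_of_nonneg_right hK hp.le]
  | succ m ih =>
    intro β hβ hβ1
    obtain ⟨c₀, hc₀, C₀, hC₀, ih⟩ := ih (β / 2) (by linarith) (by linarith)
    -- This `c` keeps each of `N ^ β`, `N ^ (2 - β / 2)` and `N ^ (2 - c₀)`, which arise from the
    -- three terms of Weyl differencing, below `N ^ (2 - 2 * c)`.
    set c := min (β / 4) (c₀ / 2) with hc
    refine ⟨c, by positivity, 6 + 2 * C₀, by positivity, ?_⟩
    intro N hN M hM K lam hK hl hu x hx
    have hN0 : 0 < N := by linarith
    have hlam : 0 < lam := (Real.rpow_pos_of_pos hN0 _).trans_le hl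
    -- With at most `N ^ (β / 2)` shifts, `(h - h') * lam ≤ N ^ (-(β / 2))`, so the induction
    -- hypothesis applies with `β / 2`; the lower bound on `lam` persists since `h - h' ≥ 1`.
    set H := ⌊N ^ (β / 2)⌋₊ with hH
    have hH1r : 1 ≤ N ^ (β / 2) := Real.one_le_rpow hN (by linarith)
    have hH1 : 1 ≤ H := (Nat.one_le_floor_iff _).2 hH1r
    have hHle : (H : ℝ) ≤ N ^ (β / 2) := Nat.floor_le (by positivity)
    have hHge : N ^ (β / 2) ≤ 2 * H := by
      have h1 := Nat.lt_floor_add_one (N ^ (β / 2))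
      have : (1 : ℝ) ≤ H := by exact_mod_cast hH1
      rw [← hH] at h1; linarith
    have hHpos : (0 : ℝ) < H := by exact_mod_cast hH1
    have key := sq_norm_sum_le_of_differences (fun n => expChar (x n)) (fun n => by simp) M H hH1
      (B := C₀ * K * N ^ (1 - c₀)) (by positivity) ?_
    · have h1 : (H : ℝ) ^ 2 ≤ N ^ (2 - 2 * c) := by
        calc (H : ℝ) ^ 2 ≤ (N ^ (β / 2)) ^ 2 := by gcongr
          _ = N ^ β := by
            rw [← Real.rpow_natCast, ← Real.rpow_mul hN0.le]; congr 1; push_cast; ring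
          _ ≤ _ := by
            apply Real.rpow_le_rpow_of_exponent_le hN
            linarith [min_le_left (β / 4) (c₀ / 2)]
      have h2 : (M : ℝ) ^ 2 / H ≤ 2 * N ^ (2 - 2 * c) := by
        rw [div_le_iff₀ hHpos]
        calc (M : ℝ) ^ 2 ≤ N ^ 2 := by gcongr
          _ = N ^ (2 - β / 2) * N ^ (β / 2) := by
            rw [← Real.rpow_add hN0, ← Real.rpow_natCast]; congr 1; push_cast; ring
          _ ≤ N ^ (2 - 2 * c) * (2 * H) := by
            gcongr
            linarith [min_le_left (β / 4) (c₀ / 2)]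
          _ = _ := by ring
      have h3 : (M : ℝ) * (C₀ * K * N ^ (1 - c₀)) ≤ C₀ * K * N ^ (2 - 2 * c) := by
        calc (M : ℝ) * (C₀ * K * N ^ (1 - c₀)) ≤ N * (C₀ * K * N ^ (1 - c₀)) := by gcongr
          _ = C₀ * K * (N ^ (1 : ℝ) * N ^ (1 - c₀)) := by rw [Real.rpow_one]; ring
          _ = C₀ * K * N ^ (2 - c₀) := by rw [← Real.rpow_add hN0]; congr 2; ring
          _ ≤ _ := by
            gcongr
            linarith [min_le_right (β / 4) (c₀ / 2)]
      have hp : 0 < N ^ (2 - 2 * c) := by positivity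
      have h4 : ‖∑ n ∈ Finset.range M, expChar (x n)‖ ^ 2 ≤
          (6 + 2 * C₀) * K * N ^ (2 - 2 * c) := by
        rw [mul_div_assoc] at key
        nlinarith [mul_le_mul_of_nonneg_right hK hp.le]
      have h5 : (6 + 2 * C₀) * K * N ^ (2 - 2 * c) ≤ ((6 + 2 * C₀) * K * N ^ (1 - c)) ^ 2 := by
        have e : N ^ (2 - 2 * c) = (N ^ (1 - c)) ^ 2 := by
          rw [← Real.rpow_natCast, ← Real.rpow_mul hN0.le]; congr 1; push_cast; ring
        rw [e, mul_pow]
        refine mul_le_mul_of_nonneg_right ?_ (by positivity)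
        have : 1 ≤ (6 + 2 * C₀) * K := one_le_mul_of_one_le_of_one_le (by linarith) hK
        nlinarith
      exact (sq_le_sq₀ (norm_nonneg _) (by positivity)).1 (h4.trans h5)
    · intro h' h hlt hlH
      have e : ∀ n, expChar (x (n + h)) * (starRingEnd ℂ) (expChar (x (n + h'))) =
          expChar (x (n + h) - x (n + h')) := by
        intro n
        rw [conj_expChar, ← expChar_add, sub_eq_add_neg]
      simp only [e]
      have hd1 : (1 : ℝ) ≤ ((h - h' : ℕ) : ℝ) := by exact_mod_cast (by omega)
      have hd2 : ((h - h' : ℕ) : ℝ) ≤ H := by exact_mod_cast (by omega)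
      refine ih N hN (M - H) ?_ K (((h - h' : ℕ) : ℝ) * lam) hK ?_ ?_ _ ?_
      · exact le_trans (by exact_mod_cast Nat.sub_le _ _) hM
      · nlinarith
      · calc ((h - h' : ℕ) : ℝ) * lam ≤ N ^ (β / 2) * N ^ (-β) := by
              gcongr; exact hd2.trans hHle
          _ = _ := by rw [← Real.rpow_add hN0]; congr 1; ring
      · intro n hn
        rw [fwdDiff_iterate_sub_shift x (m + 2) h' h n hlt.le]
        have hb : ∀ l ∈ Finset.Ico h' h, lam ≤ (fwdDiff 1)^[m + 2 + 1] x (n + l) ∧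
            (fwdDiff 1)^[m + 2 + 1] x (n + l) ≤ K * lam := by
          intro l hl
          have hl := Finset.mem_Ico.1 hl
          exact hx (n + l) (by omega)
        constructor
        · have := Finset.card_nsmul_le_sum _ _ _ fun l hl => (hb l hl).1
          simpa using this
        · have := Finset.sum_le_card_nsmul _ _ _ fun l hl => (hb l hl).2
          have e2 : K * (((h - h' : ℕ) : ℝ) * lam) = ((h - h' : ℕ) : ℝ) * (K * lam) := by ring
          rw [e2]
          simpa using this

lemma eventually_mul_log_pow_mul_rpow_le (A : ℕ) (C : ℝ) {c : ℝ} (hc : 0 < c) :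
    ∀ᶠ N : ℝ in atTop, C * Real.log N ^ A * N ^ (1 - c) ≤ N / Real.log N := by
  have h := (isLittleO_log_rpow_rpow_atTop ((A + 1 : ℕ) : ℝ) hc).bound
    (show (0 : ℝ) < 1 / (|C| + 1) by positivity)
  filter_upwards [h, eventually_gt_atTop 1] with N h1 h2
  have hN0 : 0 < N := by linarith
  have hl : 0 < Real.log N := Real.log_pos h2
  rw [Real.rpow_natCast, Real.norm_of_nonneg (by positivity), Real.norm_of_nonneg (by positivity)]
    at h1
  rw [le_div_iff₀ hl]
  have e : N ^ (1 - c) * N ^ c = N := by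
    rw [← Real.rpow_add hN0]; simp
  calc C * Real.log N ^ A * N ^ (1 - c) * Real.log N
      = C * (Real.log N ^ (A + 1)) * N ^ (1 - c) := by ring
    _ ≤ (|C| + 1) * (Real.log N ^ (A + 1)) * N ^ (1 - c) := by
        gcongr; linarith [le_abs_self C]
    _ ≤ (|C| + 1) * (1 / (|C| + 1) * N ^ c) * N ^ (1 - c) := by gcongr
    _ = N ^ (1 - c) * N ^ c := by field_simp
    _ = N := e

lemma eventually_norm_sum_expChar_le (m A : ℕ) : ∀ᶠ N : ℝ in atTop, ∀ M : ℕ, (M : ℝ) ≤ N →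
    ∀ lam : ℝ, N ^ (-(7 / 4) : ℝ) ≤ lam → lam ≤ N ^ (-(1 / 4) : ℝ) →
      ∀ x : ℕ → ℝ, (∀ n, n + (m + 2) < M → lam ≤ (fwdDiff 1)^[m + 2] x n ∧
        (fwdDiff 1)^[m + 2] x n ≤ Real.log N ^ A * lam) →
      ‖∑ n ∈ Finset.range M, expChar (x n)‖ ≤ N / Real.log N := by
  obtain ⟨c, hc, C, hC, h⟩ := norm_sum_expChar_le_of_iterate_fwdDiff m (1 / 4) (by norm_num)
    (by norm_num)
  filter_upwards [eventually_mul_log_pow_mul_rpow_le A C hc, eventually_ge_atTop 1,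
    Real.tendsto_log_atTop.eventually_ge_atTop 1] with N h1 h2 h3 M hM lam hl hu x hx
  exact (h N h2 M hM (Real.log N ^ A) lam (one_le_pow₀ h3) hl hu x hx).trans h1

/-- Discrete mean value inequality. -/
lemma fwdDiff_iterate_mem_Icc (m : ℕ) : ∀ (G : ℕ → ℝ → ℝ) (a b A B : ℝ),
    (∀ k < m, ∀ t ∈ Set.Icc a b, HasDerivAt (G k) (G (k + 1) t) t) →
    (∀ t ∈ Set.Icc a b, A ≤ G m t ∧ G m t ≤ B) →
    ∀ n₀ n : ℕ, a ≤ n₀ + n → (n₀ : ℝ) + n + m ≤ b →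
      A ≤ (fwdDiff 1)^[m] (fun n : ℕ => G 0 (n₀ + n)) n ∧
        (fwdDiff 1)^[m] (fun n : ℕ => G 0 (n₀ + n)) n ≤ B := by
  induction m with
  | zero =>
    intro G a b A B _ hAB n₀ n h1 h2
    exact hAB _ ⟨h1, by simpa using h2⟩
  | succ m ih =>
    intro G a b A B hG hAB n₀ n h1 h2
    rw [Function.iterate_succ_apply]
    have e : (fwdDiff 1 fun n : ℕ => G 0 (n₀ + n)) =
        fun n : ℕ => (fun k t => G k (t + 1) - G k t) 0 ((n₀ : ℝ) + n) := by
      funext n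
      simp [fwdDiff, add_assoc]
    rw [e]
    -- The unit difference of the whole derivative tower is again a tower, on an interval shorter by
    -- one; its top entry is a value of `G (m + 1)` by the mean value theorem.
    refine ih (fun k t => G k (t + 1) - G k t) a (b - 1) A B ?_ ?_ n₀ n h1
      (by push_cast at h2; linarith)
    · intro k hk t ht
      have h3 := hG k (by omega) (t + 1) ⟨by linarith [ht.1], by linarith [ht.2]⟩
      have h4 := hG k (by omega) t ⟨ht.1, by linarith [ht.2]⟩
      exact (h3.comp_add_const t 1).sub h4
    · intro t ht
      obtain ⟨ξ, hξ, he⟩ := exists_hasDerivAt_eq_slope (G m) (G (m + 1)) (by linarith : t < t + 1)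
        (fun s hs => (hG m (by omega) s ⟨by linarith [ht.1, hs.1],
          by linarith [ht.2, hs.2]⟩).continuousAt.continuousWithinAt)
        (fun s hs => hG m (by omega) s ⟨by linarith [ht.1, hs.1], by linarith [ht.2, hs.2]⟩)
      have e2 : G m (t + 1) - G m t = G (m + 1) ξ := by rw [he]; simp
      simp only [e2]
      exact hAB ξ ⟨by linarith [ht.1, hξ.1], by linarith [ht.2, hξ.2]⟩

/-! ### Hardy fields as sets of functions, and their fractions. -/

lemma Filter.Eventually.eventually_nhds_of_atTop {P : ℝ → Prop} (h : ∀ᶠ t in atTop, P t) :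
    ∀ᶠ t in atTop, ∀ᶠ s in nhds t, P s := by
  obtain ⟨X, hX⟩ := eventually_atTop.1 h
  filter_upwards [eventually_gt_atTop X] with t ht
  filter_upwards [Ioi_mem_nhds ht] with s hs using hX s (le_of_lt hs)

lemma Filter.EventuallyEq.deriv_atTop {f g : ℝ → ℝ} (h : f =ᶠ[atTop] g) :
    deriv f =ᶠ[atTop] deriv g := by
  filter_upwards [Eventually.eventually_nhds_of_atTop h] with t ht
  exact EventuallyEq.deriv_eq ht

/-- A set of functions, closed under eventual equality, whose germs at `+∞` form a differential
ring of eventually zero or eventually nonvanishing functions. -/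
structure IsHardyRing (R : Set (ℝ → ℝ)) : Prop where
  congr : ∀ f ∈ R, ∀ g, f =ᶠ[atTop] g → g ∈ R
  one_mem : 1 ∈ R
  add_mem : ∀ f ∈ R, ∀ g ∈ R, f + g ∈ R
  neg_mem : ∀ f ∈ R, -f ∈ R
  mul_mem : ∀ f ∈ R, ∀ g ∈ R, f * g ∈ R
  deriv_mem : ∀ f ∈ R, deriv f ∈ R
  differentiable : ∀ f ∈ R, ∀ᶠ t in atTop, DifferentiableAt ℝ f t
  zero_or_ne : ∀ f ∈ R, f =ᶠ[atTop] 0 ∨ ∀ᶠ t in atTop, f t ≠ 0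

/-- A Hardy ring closed under inversion. -/
structure IsHardySet (S : Set (ℝ → ℝ)) : Prop extends IsHardyRing S where
  inv_mem : ∀ f ∈ S, f⁻¹ ∈ S

lemma IsHardyField.isHardySet {H : Subring (Germ (atTop : Filter ℝ) ℝ)} (hH : IsHardyField H) :
    IsHardySet {f : ℝ → ℝ | (f : Germ (atTop : Filter ℝ) ℝ) ∈ H} := by
  have hinv : ∀ f : ℝ → ℝ, (f : Germ (atTop : Filter ℝ) ℝ) ∈ H →
      f =ᶠ[atTop] 0 ∨ ∃ g : ℝ → ℝ, (g : Germ (atTop : Filter ℝ) ℝ) ∈ H ∧ f * g =ᶠ[atTop] 1 := by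
    intro f hf
    by_cases h0 : f =ᶠ[atTop] 0
    · exact Or.inl h0
    · right
      obtain ⟨⟨b, hb⟩, he⟩ := hH.isField.mul_inv_cancel (a := ⟨f, hf⟩) (fun h => h0 (by
        have := congrArg Subtype.val h
        exact Germ.coe_eq.1 this))
      induction b using Germ.inductionOn with
      | h g =>
        refine ⟨g, hb, ?_⟩
        have := congrArg Subtype.val he
        exact Germ.coe_eq.1 this
  exact
  { congr := fun f hf g hg => by
      have : (g : Germ (atTop : Filter ℝ) ℝ) = f := (Germ.coe_eq.2 hg).symm
      simpa [this] using hf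
    one_mem := H.one_mem
    add_mem := fun f hf g hg => H.add_mem hf hg
    neg_mem := fun f hf => H.neg_mem hf
    mul_mem := fun f hf g hg => H.mul_mem hf hg
    deriv_mem := hH.deriv_mem
    differentiable := hH.eventually_differentiableAt
    zero_or_ne := fun f hf => by
      rcases hinv f hf with h | ⟨g, _, hg⟩
      · exact Or.inl h
      · right
        filter_upwards [hg] with t ht h0
        simp [h0] at ht
    inv_mem := fun f hf => by
      rcases hinv f hf with h | ⟨g, hgH, hg⟩
      -- Since `0⁻¹ = 0`, the zero germ needs no exception in the closure under inversion.
      · have e : f⁻¹ =ᶠ[atTop] 0 := by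
          filter_upwards [h] with t ht
          simp [ht]
        show ((f⁻¹ : ℝ → ℝ) : Germ (atTop : Filter ℝ) ℝ) ∈ H
        rw [Germ.coe_eq.2 e]
        exact H.zero_mem
      · have e : f⁻¹ =ᶠ[atTop] g := by
          filter_upwards [hg] with t ht
          exact inv_eq_of_mul_eq_one_right ht
        show ((f⁻¹ : ℝ → ℝ) : Germ (atTop : Filter ℝ) ℝ) ∈ H
        rw [Germ.coe_eq.2 e]
        exact hgH }

namespace IsHardyRing

variable {R : Set (ℝ → ℝ)}

lemma zero_mem (hR : IsHardyRing R) : 0 ∈ R := by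
  have := hR.add_mem 1 hR.one_mem (-1) (hR.neg_mem 1 hR.one_mem)
  simpa using this

lemma sub_mem (hR : IsHardyRing R) {f g : ℝ → ℝ} (hf : f ∈ R) (hg : g ∈ R) : f - g ∈ R := by
  rw [sub_eq_add_neg]; exact hR.add_mem f hf _ (hR.neg_mem g hg)

lemma natCast_mem (hR : IsHardyRing R) (n : ℕ) : (fun _ => (n : ℝ)) ∈ R := by
  induction n with
  | zero => exact hR.congr _ hR.zero_mem _ (by simp; rfl)
  | succ n ih =>
    refine hR.congr _ (hR.add_mem _ ih _ hR.one_mem) _ (Eventually.of_forall fun t => ?_)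
    simp

lemma pow_mem (hR : IsHardyRing R) {f : ℝ → ℝ} (hf : f ∈ R) (n : ℕ) : f ^ n ∈ R := by
  induction n with
  | zero => simpa using hR.one_mem
  | succ n ih => rw [pow_succ]; exact hR.mul_mem _ ih _ hf

lemma iterate_deriv_mem (hR : IsHardyRing R) {f : ℝ → ℝ} (hf : f ∈ R) (n : ℕ) :
    deriv^[n] f ∈ R := by
  induction n with
  | zero => exact hf
  | succ n ih => rw [Function.iterate_succ_apply']; exact hR.deriv_mem _ ih

end IsHardyRing

/-- Fractions of elements of a set of functions, up to eventual equality. -/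
def fractionsOver (R : Set (ℝ → ℝ)) : Set (ℝ → ℝ) :=
  {f | ∃ p ∈ R, ∃ q ∈ R, (∀ᶠ t in atTop, q t ≠ 0) ∧ f =ᶠ[atTop] p / q}

lemma subset_fractionsOver {R : Set (ℝ → ℝ)} (hR : IsHardyRing R) : R ⊆ fractionsOver R :=
  fun f hf => ⟨f, hf, 1, hR.one_mem, by simp, by simp⟩

lemma IsHardyRing.isHardySet_fractionsOver {R : Set (ℝ → ℝ)} (hR : IsHardyRing R) :
    IsHardySet (fractionsOver R) where
  congr := by
    rintro f ⟨p, hp, q, hq, hq0, he⟩ g hg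
    exact ⟨p, hp, q, hq, hq0, hg.symm.trans he⟩
  one_mem := subset_fractionsOver hR hR.one_mem
  add_mem := by
    rintro f ⟨p, hp, q, hq, hq0, he⟩ f' ⟨p', hp', q', hq', hq0', he'⟩
    refine ⟨p * q' + p' * q, hR.add_mem _ (hR.mul_mem _ hp _ hq') _ (hR.mul_mem _ hp' _ hq),
      q * q', hR.mul_mem _ hq _ hq', ?_, ?_⟩
    · filter_upwards [hq0, hq0'] with t h1 h2 using mul_ne_zero h1 h2
    · filter_upwards [hq0, hq0', he, he'] with t h1 h2 h3 h4
      simp only [Pi.add_apply, Pi.mul_apply, Pi.div_apply, h3, h4]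
      field_simp
  neg_mem := by
    rintro f ⟨p, hp, q, hq, hq0, he⟩
    refine ⟨-p, hR.neg_mem _ hp, q, hq, hq0, ?_⟩
    filter_upwards [he] with t h
    simp [h, neg_div]
  mul_mem := by
    rintro f ⟨p, hp, q, hq, hq0, he⟩ f' ⟨p', hp', q', hq', hq0', he'⟩
    refine ⟨p * p', hR.mul_mem _ hp _ hp', q * q', hR.mul_mem _ hq _ hq', ?_, ?_⟩
    · filter_upwards [hq0, hq0'] with t h1 h2 using mul_ne_zero h1 h2
    · filter_upwards [hq0, hq0', he, he'] with t h1 h2 h3 h4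
      simp only [Pi.mul_apply, Pi.div_apply, h3, h4]
      field_simp
  deriv_mem := by
    rintro f ⟨p, hp, q, hq, hq0, he⟩
    refine ⟨deriv p * q - p * deriv q, hR.sub_mem (hR.mul_mem _ (hR.deriv_mem _ hp) _ hq)
      (hR.mul_mem _ hp _ (hR.deriv_mem _ hq)), q * q, hR.mul_mem _ hq _ hq, ?_, ?_⟩
    · filter_upwards [hq0] with t h1 using mul_ne_zero h1 h1
    · filter_upwards [he.deriv_atTop, hq0, hR.differentiable _ hp, hR.differentiable _ hq]
        with t h1 h2 h3 h4
      rw [h1, deriv_div h3 h4 h2]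
      simp [sq]
  differentiable := by
    rintro f ⟨p, hp, q, hq, hq0, he⟩
    filter_upwards [Eventually.eventually_nhds_of_atTop he, hq0, hR.differentiable _ hp,
      hR.differentiable _ hq] with t h1 h2 h3 h4
    exact (h3.div h4 h2).congr_of_eventuallyEq h1
  zero_or_ne := by
    rintro f ⟨p, hp, q, hq, hq0, he⟩
    rcases hR.zero_or_ne _ hp with h | h
    · left
      filter_upwards [he, h] with t h1 h2
      simp [h1, h2]
    · right
      filter_upwards [he, h, hq0] with t h1 h2 h3
      rw [h1]; exact div_ne_zero h2 h3
  inv_mem := by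
    rintro f ⟨p, hp, q, hq, hq0, he⟩
    rcases hR.zero_or_ne _ hp with h | h
    · refine ⟨0, hR.zero_mem, 1, hR.one_mem, by simp, ?_⟩
      filter_upwards [he, h] with t h1 h2
      simp [h1, h2]
    · refine ⟨q, hq, p, hp, h, ?_⟩
      filter_upwards [he] with t h1
      simp [h1]

/-! ### Adjoining an antiderivative to a Hardy field. -/

/-- Functions that eventually agree with a polynomial in `y` of degree at most `n` with
coefficients in `S`. -/
def polynomialsOver (S : Set (ℝ → ℝ)) (y : ℝ → ℝ) : ℕ → Set (ℝ → ℝ)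
  | 0 => S
  | n + 1 => {f | ∃ a ∈ S, ∃ g ∈ polynomialsOver S y n, f =ᶠ[atTop] a * y ^ (n + 1) + g}

/-- If the derivative eventually vanishes, `h` is eventually constant; if it is eventually nonzero,
Rolle's theorem allows at most one zero far out. -/
lemma zero_or_ne_of_deriv {h : ℝ → ℝ} (hd : ∀ᶠ t in atTop, DifferentiableAt ℝ h t)
    (h' : deriv h =ᶠ[atTop] 0 ∨ ∀ᶠ t in atTop, deriv h t ≠ 0) :
    h =ᶠ[atTop] 0 ∨ ∀ᶠ t in atTop, h t ≠ 0 := by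
  rcases h' with h0 | h0
  · obtain ⟨X, hX⟩ := eventually_atTop.1 (hd.and h0)
    have hc : ∀ t, X ≤ t → h t = h X := by
      intro t ht
      refine constant_of_has_deriv_right_zero (f := h) (a := X) (b := t)
        (fun s hs => (hX s hs.1).1.continuousAt.continuousWithinAt) (fun s hs => ?_) t ⟨ht, le_rfl⟩
      have := (hX s hs.1).1.hasDerivAt
      rw [(hX s hs.1).2] at this
      exact this.hasDerivWithinAt
    by_cases hz : h X = 0
    · left
      filter_upwards [eventually_ge_atTop X] with t ht
      simp [hc t ht, hz]
    · right
      filter_upwards [eventually_ge_atTop X] with t ht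
      rw [hc t ht]; exact hz
  · right
    obtain ⟨X, hX⟩ := eventually_atTop.1 (hd.and h0)
    by_cases hz : ∃ c, X ≤ c ∧ h c = 0
    · obtain ⟨c, hc, hc0⟩ := hz
      filter_upwards [eventually_gt_atTop c] with t ht ht0
      obtain ⟨s, hs, hs0⟩ := exists_deriv_eq_zero ht
        (fun s hs => (hX s (hc.trans hs.1)).1.continuousAt.continuousWithinAt) (hc0.trans ht0.symm)
      exact (hX s (hc.trans hs.1.le)).2 hs0
    · push Not at hz
      filter_upwards [eventually_ge_atTop X] with t ht using hz t ht

section Polynomials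

variable {S : Set (ℝ → ℝ)} {y : ℝ → ℝ}

lemma polynomialsOver_congr (hS : IsHardySet S) {n : ℕ} {f g : ℝ → ℝ}
    (hf : f ∈ polynomialsOver S y n) (h : f =ᶠ[atTop] g) : g ∈ polynomialsOver S y n := by
  cases n with
  | zero => exact hS.congr f hf g h
  | succ n =>
    obtain ⟨a, ha, p, hp, he⟩ := hf
    exact ⟨a, ha, p, hp, h.symm.trans he⟩

lemma polynomialsOver_mono_succ (hS : IsHardySet S) {n : ℕ} {f : ℝ → ℝ}
    (hf : f ∈ polynomialsOver S y n) : f ∈ polynomialsOver S y (n + 1) :=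
  ⟨0, hS.zero_mem, f, hf, by simp⟩

lemma polynomialsOver_mono (hS : IsHardySet S) {n m : ℕ} (hnm : n ≤ m) {f : ℝ → ℝ}
    (hf : f ∈ polynomialsOver S y n) : f ∈ polynomialsOver S y m := by
  induction m, hnm using Nat.le_induction with
  | base => exact hf
  | succ m _ ih => exact polynomialsOver_mono_succ hS ih

lemma polynomialsOver_add (hS : IsHardySet S) {n : ℕ} : ∀ {f g : ℝ → ℝ},
    f ∈ polynomialsOver S y n → g ∈ polynomialsOver S y n → f + g ∈ polynomialsOver S y n := by
  induction n with
  | zero => intro f g hf hg; exact hS.add_mem f hf g hg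
  | succ n ih =>
    rintro f g ⟨a, ha, p, hp, he⟩ ⟨b, hb, q, hq, he'⟩
    refine ⟨a + b, hS.add_mem a ha b hb, p + q, ih hp hq, ?_⟩
    filter_upwards [he, he'] with t h1 h2
    simp only [Pi.add_apply, Pi.mul_apply, Pi.pow_apply] at *
    rw [h1, h2]; ring

lemma polynomialsOver_smul (hS : IsHardySet S) {n : ℕ} {c : ℝ → ℝ} (hc : c ∈ S) :
    ∀ {f : ℝ → ℝ}, f ∈ polynomialsOver S y n → c * f ∈ polynomialsOver S y n := by
  induction n with
  | zero => intro f hf; exact hS.mul_mem c hc f hf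
  | succ n ih =>
    rintro f ⟨a, ha, p, hp, he⟩
    refine ⟨c * a, hS.mul_mem c hc a ha, c * p, ih hp, ?_⟩
    filter_upwards [he] with t h1
    simp only [Pi.add_apply, Pi.mul_apply, Pi.pow_apply] at *
    rw [h1]; ring

lemma monomial_mem_polynomialsOver (hS : IsHardySet S) {a : ℝ → ℝ} (ha : a ∈ S) (n : ℕ) :
    a * y ^ n ∈ polynomialsOver S y n := by
  cases n with
  | zero => simpa [polynomialsOver] using ha
  | succ n => exact ⟨a, ha, 0, polynomialsOver_mono hS (Nat.zero_le n) hS.zero_mem, by simp⟩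

lemma polynomialsOver_mul_pow (hS : IsHardySet S) {n : ℕ} (k : ℕ) :
    ∀ {f : ℝ → ℝ}, f ∈ polynomialsOver S y n → f * y ^ k ∈ polynomialsOver S y (n + k) := by
  induction n with
  | zero => intro f hf; rw [Nat.zero_add]; exact monomial_mem_polynomialsOver hS hf k
  | succ n ih =>
    rintro f ⟨a, ha, p, hp, he⟩
    rw [Nat.add_right_comm]
    refine ⟨a, ha, p * y ^ k, ih hp, ?_⟩
    filter_upwards [he] with t h1
    simp only [Pi.add_apply, Pi.mul_apply, Pi.pow_apply] at *
    rw [h1]; ring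

lemma polynomialsOver_mul (hS : IsHardySet S) {n m : ℕ} {g : ℝ → ℝ}
    (hg : g ∈ polynomialsOver S y m) :
    ∀ {f : ℝ → ℝ}, f ∈ polynomialsOver S y n → f * g ∈ polynomialsOver S y (n + m) := by
  induction n with
  | zero => intro f hf; rw [Nat.zero_add]; exact polynomialsOver_smul hS hf hg
  | succ n ih =>
    rintro f ⟨a, ha, p, hp, he⟩
    have h1 : (a * g) * y ^ (n + 1) ∈ polynomialsOver S y (n + 1 + m) := by
      rw [Nat.add_comm (n + 1) m]
      exact polynomialsOver_mul_pow hS (n + 1) (polynomialsOver_smul hS ha hg)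
    have h2 : p * g ∈ polynomialsOver S y (n + 1 + m) :=
      polynomialsOver_mono hS (by omega) (ih hp)
    refine polynomialsOver_congr hS (polynomialsOver_add hS h1 h2) ?_
    filter_upwards [he] with t h1
    simp only [Pi.add_apply, Pi.mul_apply, Pi.pow_apply] at *
    rw [h1]; ring

lemma differentiable_of_mem_polynomialsOver (hS : IsHardySet S)
    (hy : ∀ᶠ t in atTop, DifferentiableAt ℝ y t) {n : ℕ} :
    ∀ {f : ℝ → ℝ}, f ∈ polynomialsOver S y n → ∀ᶠ t in atTop, DifferentiableAt ℝ f t := by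
  induction n with
  | zero => intro f hf; exact hS.differentiable f hf
  | succ n ih =>
    rintro f ⟨a, ha, p, hp, he⟩
    filter_upwards [Eventually.eventually_nhds_of_atTop he, hS.differentiable a ha, ih hp, hy]
      with t h1 h2 h3 h4
    exact ((h2.mul (h4.pow (n + 1))).add h3).congr_of_eventuallyEq h1

lemma deriv_mem_polynomialsOver (hS : IsHardySet S)
    (hy : ∀ᶠ t in atTop, DifferentiableAt ℝ y t) (hy' : deriv y ∈ S) {n : ℕ} :
    ∀ {f : ℝ → ℝ}, f ∈ polynomialsOver S y n → deriv f ∈ polynomialsOver S y n := by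
  induction n with
  | zero => intro f hf; exact hS.deriv_mem f hf
  | succ n ih =>
    rintro f ⟨a, ha, p, hp, he⟩
    have h1 : deriv a * y ^ (n + 1) ∈ polynomialsOver S y (n + 1) :=
      monomial_mem_polynomialsOver hS (hS.deriv_mem a ha) _
    have h2 : (a * (fun _ => ((n + 1 : ℕ) : ℝ)) * deriv y) * y ^ n ∈ polynomialsOver S y (n + 1) :=
      polynomialsOver_mono_succ hS (monomial_mem_polynomialsOver hS
        (hS.mul_mem _ (hS.mul_mem _ ha _ (hS.natCast_mem (n + 1))) _ hy') n)
    have h3 : deriv p ∈ polynomialsOver S y (n + 1) := polynomialsOver_mono_succ hS (ih hp)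
    refine polynomialsOver_congr hS (polynomialsOver_add hS (polynomialsOver_add hS h1 h2) h3) ?_
    filter_upwards [he.deriv_atTop, hS.differentiable a ha,
      differentiable_of_mem_polynomialsOver hS hy hp, hy] with t h4 h5 h6 h7
    have h8 := ((h5.hasDerivAt.mul (h7.hasDerivAt.pow (n + 1))).add h6.hasDerivAt).deriv
    rw [h4, h8]
    simp only [Pi.add_apply, Pi.mul_apply, Pi.pow_apply, Nat.add_sub_cancel]
    ring

/-- Induction on the degree: after division by the leading coefficient, differentiation lowers the
degree because `deriv y` lies in `S`, and `zero_or_ne_of_deriv` transfers the alternative from the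
derivative to the function. -/
lemma zero_or_ne_of_mem_polynomialsOver (hS : IsHardySet S)
    (hy : ∀ᶠ t in atTop, DifferentiableAt ℝ y t) (hy' : deriv y ∈ S) {n : ℕ} :
    ∀ {f : ℝ → ℝ}, f ∈ polynomialsOver S y n →
      f =ᶠ[atTop] 0 ∨ ∀ᶠ t in atTop, f t ≠ 0 := by
  induction n with
  | zero => intro f hf; exact hS.zero_or_ne f hf
  | succ n ih =>
    rintro f ⟨a, ha, p, hp, he⟩
    rcases hS.zero_or_ne a ha with h0 | h0
    · refine ih (polynomialsOver_congr hS hp ?_)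
      filter_upwards [he, h0] with t h1 h2
      simp [h1, h2]
    · have hq : a⁻¹ * p ∈ polynomialsOver S y n :=
        polynomialsOver_smul hS (hS.inv_mem a ha) hp
      have hqd := differentiable_of_mem_polynomialsOver hS hy hq
      set h : ℝ → ℝ := y ^ (n + 1) + a⁻¹ * p with hh
      have hd : ∀ᶠ t in atTop, DifferentiableAt ℝ h t := by
        filter_upwards [hy, hqd] with t h1 h2 using (h1.pow (n + 1)).add h2
      have hmem : deriv h ∈ polynomialsOver S y n := by
        have h2 : ((fun _ => ((n + 1 : ℕ) : ℝ)) * deriv y) * y ^ n ∈ polynomialsOver S y n :=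
          monomial_mem_polynomialsOver hS (hS.mul_mem _ (hS.natCast_mem (n + 1)) _ hy') n
        refine polynomialsOver_congr hS
          (polynomialsOver_add hS h2 (deriv_mem_polynomialsOver hS hy hy' hq)) ?_
        filter_upwards [hqd, hy] with t h6 h7
        have h8 := ((h7.hasDerivAt.pow (n + 1)).add h6.hasDerivAt).deriv
        rw [h8]
        simp only [Pi.add_apply, Pi.mul_apply, Pi.pow_apply, Nat.add_sub_cancel]
        ring
      have hfh : ∀ᶠ t in atTop, f t = a t * h t := by
        filter_upwards [he, h0] with t h1 h2
        rw [h1, hh]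
        simp only [Pi.add_apply, Pi.mul_apply, Pi.pow_apply, Pi.inv_apply]
        field_simp
      rcases zero_or_ne_of_deriv hd (ih hmem) with h1 | h1
      · left
        filter_upwards [hfh, h1] with t h2 h3
        simp [h2, h3]
      · right
        filter_upwards [hfh, h1, h0] with t h2 h3 h4
        rw [h2]; exact mul_ne_zero h4 h3

/-- Adjoining an antiderivative to a Hardy field. -/
theorem IsHardySet.exists_extension (hS : IsHardySet S)
    (hy : ∀ᶠ t in atTop, DifferentiableAt ℝ y t) (hy' : deriv y ∈ S) :
    ∃ S', IsHardySet S' ∧ S ⊆ S' ∧ y ∈ S' := by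
  have hR : IsHardyRing {f | ∃ n, f ∈ polynomialsOver S y n} :=
    { congr := fun f ⟨n, hf⟩ g hg => ⟨n, polynomialsOver_congr hS hf hg⟩
      one_mem := ⟨0, hS.one_mem⟩
      add_mem := fun f ⟨n, hf⟩ g ⟨m, hg⟩ => ⟨max n m, polynomialsOver_add hS
        (polynomialsOver_mono hS (le_max_left _ _) hf)
        (polynomialsOver_mono hS (le_max_right _ _) hg)⟩
      neg_mem := fun f ⟨n, hf⟩ => ⟨n, by
        have := polynomialsOver_smul hS (hS.neg_mem _ hS.one_mem) hf
        simpa using this⟩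
      mul_mem := fun f ⟨n, hf⟩ g ⟨m, hg⟩ => ⟨n + m, polynomialsOver_mul hS hg hf⟩
      deriv_mem := fun f ⟨n, hf⟩ => ⟨n, deriv_mem_polynomialsOver hS hy hy' hf⟩
      differentiable := fun f ⟨n, hf⟩ => differentiable_of_mem_polynomialsOver hS hy hf
      zero_or_ne := fun f ⟨n, hf⟩ => zero_or_ne_of_mem_polynomialsOver hS hy hy' hf }
  refine ⟨_, hR.isHardySet_fractionsOver, fun f hf => subset_fractionsOver hR ⟨0, hf⟩,
    subset_fractionsOver hR ⟨1, ?_⟩⟩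
  have := monomial_mem_polynomialsOver (y := y) hS hS.one_mem 1
  simpa using this

end Polynomials

/-! ### Iterated logarithms and eventual comparison. -/

/-- The triply iterated logarithm. -/
noncomputable def logThree (t : ℝ) : ℝ := Real.log (logTwo t)

lemma tendsto_logTwo : Tendsto logTwo atTop atTop :=
  Real.tendsto_log_atTop.comp Real.tendsto_log_atTop

lemma tendsto_logThree : Tendsto logThree atTop atTop :=
  Real.tendsto_log_atTop.comp tendsto_logTwo

lemma hasDerivAt_logTwo {t : ℝ} (h0 : t ≠ 0) (h1 : Real.log t ≠ 0) :
    HasDerivAt logTwo (t⁻¹ / Real.log t) t := (Real.hasDerivAt_log h0).log h1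

lemma hasDerivAt_logThree {t : ℝ} (h0 : t ≠ 0) (h1 : Real.log t ≠ 0) (h2 : logTwo t ≠ 0) :
    HasDerivAt logThree (t⁻¹ / Real.log t / logTwo t) t := (hasDerivAt_logTwo h0 h1).log h2

/-- Each of the four functions has its derivative in the Hardy field obtained by adjoining the
preceding ones. -/
theorem IsHardySet.exists_extension_logs {S : Set (ℝ → ℝ)} (hS : IsHardySet S) :
    ∃ S', IsHardySet S' ∧ S ⊆ S' ∧ id ∈ S' ∧ Real.log ∈ S' ∧ logTwo ∈ S' ∧ logThree ∈ S' := by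
  obtain ⟨S₁, h₁, s₁, m₁⟩ := hS.exists_extension (y := id)
    (Eventually.of_forall fun t => differentiableAt_id) (hS.congr 1 hS.one_mem _
      (Eventually.of_forall fun t => by simp))
  have l1 : ∀ᶠ t : ℝ in atTop, t ≠ 0 := eventually_ne_atTop 0
  have l2 : ∀ᶠ t : ℝ in atTop, Real.log t ≠ 0 :=
    Real.tendsto_log_atTop.eventually (eventually_ne_atTop 0)
  have l3 : ∀ᶠ t : ℝ in atTop, logTwo t ≠ 0 := tendsto_logTwo.eventually (eventually_ne_atTop 0)
  obtain ⟨S₂, h₂, s₂, m₂⟩ := h₁.exists_extension (y := Real.log)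
    (by filter_upwards [l1] with t ht using Real.differentiableAt_log ht)
    (h₁.congr _ (h₁.inv_mem _ m₁) _ (Eventually.of_forall fun t => by simp))
  obtain ⟨S₃, h₃, s₃, m₃⟩ := h₂.exists_extension (y := logTwo)
    (by filter_upwards [l1, l2] with t h1 h2 using (hasDerivAt_logTwo h1 h2).differentiableAt)
    (h₂.congr _ (h₂.mul_mem _ (h₂.inv_mem _ (s₂ m₁)) _ (h₂.inv_mem _ m₂)) _ (by
      filter_upwards [l1, l2] with t h1 h2
      rw [(hasDerivAt_logTwo h1 h2).deriv]; simp [div_eq_mul_inv]))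
  obtain ⟨S₄, h₄, s₄, m₄⟩ := h₃.exists_extension (y := logThree)
    (by filter_upwards [l1, l2, l3] with t h1 h2 h3
          using (hasDerivAt_logThree h1 h2 h3).differentiableAt)
    (h₃.congr _ (h₃.mul_mem _ (h₃.mul_mem _ (h₃.inv_mem _ (s₃ (s₂ m₁))) _
      (h₃.inv_mem _ (s₃ m₂))) _ (h₃.inv_mem _ m₃)) _ (by
      filter_upwards [l1, l2, l3] with t h1 h2 h3
      rw [(hasDerivAt_logThree h1 h2 h3).deriv]; simp [div_eq_mul_inv]))
  exact ⟨S₄, h₄, s₁.trans (s₂.trans (s₃.trans s₄)), s₄ (s₃ (s₂ m₁)), s₄ (s₃ m₂), s₄ m₃, m₄⟩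

lemma exists_monotoneOn_of_deriv {h h' : ℝ → ℝ}
    (hd : ∀ᶠ t in atTop, HasDerivAt h (h' t) t ∧ 0 ≤ h' t) :
    ∃ X, MonotoneOn h (Set.Ici X) := by
  obtain ⟨X, hX⟩ := eventually_atTop.1 hd
  refine ⟨X, monotoneOn_of_deriv_nonneg (convex_Ici X)
    (fun t ht => (hX t ht).1.continuousAt.continuousWithinAt)
    (fun t ht => ?_) (fun t ht => ?_)⟩
  · rw [interior_Ici] at ht
    exact (hX t (le_of_lt ht)).1.differentiableAt.differentiableWithinAt
  · rw [interior_Ici] at ht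
    rw [(hX t (le_of_lt ht)).1.deriv]; exact (hX t (le_of_lt ht)).2

/-- Stands in for integration: an inequality between derivatives gives one between the functions, up
to an additive constant. -/
lemma exists_eventually_ge_of_deriv {h h' : ℝ → ℝ}
    (hd : ∀ᶠ t in atTop, HasDerivAt h (h' t) t ∧ 0 ≤ h' t) :
    ∃ c, ∀ᶠ t in atTop, c ≤ h t := by
  obtain ⟨X, hX⟩ := exists_monotoneOn_of_deriv hd
  exact ⟨h X, (eventually_ge_atTop X).mono fun t ht => hX Set.self_mem_Ici ht ht⟩

lemma exists_eventually_le_of_deriv {h h' : ℝ → ℝ}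
    (hd : ∀ᶠ t in atTop, HasDerivAt h (h' t) t ∧ h' t ≤ 0) :
    ∃ c, ∀ᶠ t in atTop, h t ≤ c := by
  obtain ⟨c, hc⟩ := exists_eventually_ge_of_deriv (h := -h) (h' := -h')
    (hd.mono fun t ht => ⟨ht.1.neg, by simpa using ht.2⟩)
  exact ⟨-c, hc.mono fun t ht => by simpa using neg_le_neg ht⟩

namespace IsHardySet

variable {S : Set (ℝ → ℝ)}

/-- A function that is eventually continuous and nonvanishing has eventually constant sign, by the
intermediate value theorem. -/
lemma trichotomy (hS : IsHardySet S) {f : ℝ → ℝ} (hf : f ∈ S) :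
    f =ᶠ[atTop] 0 ∨ (∀ᶠ t in atTop, 0 < f t) ∨ ∀ᶠ t in atTop, f t < 0 := by
  rcases hS.zero_or_ne f hf with h | h
  · exact Or.inl h
  · right
    obtain ⟨X, hX⟩ := eventually_atTop.1 (h.and (hS.differentiable f hf))
    have hcont : ContinuousOn f (Set.Ici X) := fun t ht =>
      (hX t ht).2.continuousAt.continuousWithinAt
    have key : ∀ t, X ≤ t → ∀ s, X ≤ s → f t < 0 → 0 < f s → False := by
      intro t ht s hs h1 h2
      obtain ⟨r, hr, h0⟩ := isPreconnected_Ici.intermediate_value (a := t) (b := s) ht hs hcont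
        (show (0 : ℝ) ∈ Set.Icc (f t) (f s) from ⟨h1.le, h2.le⟩)
      exact (hX r hr).1 h0
    rcases lt_or_gt_of_ne (hX X le_rfl).1 with h0 | h0
    · right
      filter_upwards [eventually_ge_atTop X] with t ht
      by_contra hc
      exact key X le_rfl t ht h0 (lt_of_le_of_ne (not_lt.1 hc) (hX t ht).1.symm)
    · left
      filter_upwards [eventually_ge_atTop X] with t ht
      by_contra hc
      exact key t ht X le_rfl (lt_of_le_of_ne (not_lt.1 hc) (hX t ht).1) h0

lemma abs_mem (hS : IsHardySet S) {f : ℝ → ℝ} (hf : f ∈ S) : (fun t => |f t|) ∈ S := by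
  rcases hS.trichotomy hf with h | h | h
  · exact hS.congr _ hS.zero_mem _ (h.mono fun t ht => by simp [ht])
  · exact hS.congr _ hf _ (h.mono fun t ht => (abs_of_pos ht).symm)
  · exact hS.congr _ (hS.neg_mem f hf) _ (h.mono fun t ht => (abs_of_neg ht).symm)

/-- The device behind the arguments by contradiction below: an inequality that does not hold
eventually is reversed at all large points, hence can be integrated. -/
lemma lt_or_le (hS : IsHardySet S) {f g : ℝ → ℝ} (hf : f ∈ S) (hg : g ∈ S) :
    (∀ᶠ t in atTop, f t < g t) ∨ ∀ᶠ t in atTop, g t ≤ f t := by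
  rcases hS.trichotomy (hS.sub_mem hg hf) with h | h | h
  · right; filter_upwards [h] with t ht
    simp only [Pi.sub_apply, Pi.zero_apply] at ht; linarith
  · left; filter_upwards [h] with t ht using sub_pos.1 ht
  · right; filter_upwards [h] with t ht using (sub_neg.1 ht).le

lemma monotoneOn_or_antitoneOn (hS : IsHardySet S) {f : ℝ → ℝ} (hf : f ∈ S) :
    (∃ X, MonotoneOn f (Set.Ici X)) ∨ ∃ X, AntitoneOn f (Set.Ici X) := by
  have hd := hS.differentiable f hf
  rcases hS.lt_or_le (hS.deriv_mem f hf) hS.zero_mem with h | h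
  · right
    obtain ⟨X, hX⟩ := exists_monotoneOn_of_deriv (h := -f) (h' := -deriv f) (by
      filter_upwards [hd, h] with t h1 h2
      exact ⟨h1.hasDerivAt.neg, by simpa using h2.le⟩)
    exact ⟨X, fun a ha b hb hab => neg_le_neg_iff.1 (hX ha hb hab)⟩
  · left
    exact exists_monotoneOn_of_deriv (by
      filter_upwards [hd, h] with t h1 h2 using ⟨h1.hasDerivAt, h2⟩)

end IsHardySet

/-! ### Size of the derivatives of a function of non-polynomial growth. -/

/-- `|u(t)|` eventually lies between two positive multiples of `t ^ k`. -/
def IsOrderPow (u : ℝ → ℝ) (k : ℕ) : Prop :=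
  ∃ a b : ℝ, 0 < a ∧ ∀ᶠ t in atTop, a * t ^ k ≤ |u t| ∧ |u t| ≤ b * t ^ k

/-- `Real.log` of a nonzero number is the logarithm of its absolute value, so the sign of `u` plays
no role. -/
lemma isOrderPow_zero_of_log_bounded {u : ℝ → ℝ} {a b : ℝ}
    (h : ∀ᶠ t in atTop, u t ≠ 0 ∧ a ≤ Real.log (u t) ∧ Real.log (u t) ≤ b) :
    IsOrderPow u 0 := by
  refine ⟨Real.exp a, Real.exp b, Real.exp_pos a, ?_⟩
  filter_upwards [h] with t ht
  have e : |u t| = Real.exp (Real.log (u t)) := (Real.exp_log_eq_abs ht.1).symm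
  rw [e, pow_zero, mul_one, mul_one, Real.exp_le_exp, Real.exp_le_exp]
  exact ht.2

lemma isOrderPow_of_deriv_pos {u : ℝ → ℝ} {k : ℕ}
    (hd : ∀ᶠ t in atTop, DifferentiableAt ℝ u t) (hpos : ∀ᶠ t in atTop, 0 < deriv u t)
    (h : IsOrderPow (deriv u) k) : IsOrderPow u (k + 1) := by
  obtain ⟨a, b, ha, hab⟩ := h
  have hk : (0 : ℝ) < k + 1 := by positivity
  have hpow : ∀ (c t : ℝ), HasDerivAt (fun t => c / (k + 1) * t ^ (k + 1)) (c * t ^ k) t := by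
    intro c t
    have := (hasDerivAt_pow (k + 1) t).const_mul (c / ((k : ℝ) + 1))
    refine this.congr_deriv ?_
    rw [Nat.add_sub_cancel]; push_cast; field_simp
  obtain ⟨c₁, hc₁⟩ := exists_eventually_ge_of_deriv
    (h := fun t => u t - a / (k + 1) * t ^ (k + 1)) (h' := fun t => deriv u t - a * t ^ k) (by
      filter_upwards [hd, hpos, hab] with t h1 h2 h3
      rw [abs_of_pos h2] at h3
      exact ⟨h1.hasDerivAt.sub (hpow a t), by linarith [h3.1]⟩)
  obtain ⟨c₂, hc₂⟩ := exists_eventually_le_of_deriv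
    (h := fun t => u t - b / (k + 1) * t ^ (k + 1)) (h' := fun t => deriv u t - b * t ^ k) (by
      filter_upwards [hd, hpos, hab] with t h1 h2 h3
      rw [abs_of_pos h2] at h3
      exact ⟨h1.hasDerivAt.sub (hpow b t), by linarith [h3.2]⟩)
  have ht := (tendsto_pow_atTop (α := ℝ) (Nat.succ_ne_zero k)).const_mul_atTop
    (show 0 < a / (2 * (k + 1)) by positivity)
  -- Halving the lower constant absorbs the constant of integration `c₁`; the other one, `c₂`, is
  -- absorbed by `t ^ (k + 1) ≥ 1`.
  refine ⟨a / (2 * (k + 1)), b / (k + 1) + |c₂|, by positivity, ?_⟩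
  filter_upwards [hc₁, hc₂, ht.eventually_ge_atTop |c₁|, eventually_ge_atTop 1] with t h1 h2 h3 h4
  have h5 : (1 : ℝ) ≤ t ^ (k + 1) := one_le_pow₀ h4
  have e : a / (k + 1) * t ^ (k + 1) = 2 * (a / (2 * (k + 1)) * t ^ (k + 1)) := by field_simp
  have h6 : a / (2 * (k + 1)) * t ^ (k + 1) ≤ u t := by
    simp only [Nat.succ_eq_add_one] at h3
    linarith [neg_abs_le c₁]
  have h7 : 0 ≤ u t := le_trans (by positivity) h6
  rw [abs_of_nonneg h7]
  refine ⟨h6, ?_⟩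
  nlinarith [le_abs_self c₂, abs_nonneg c₂]

namespace IsHardySet

variable {S : Set (ℝ → ℝ)}

lemma isOrderPow_of_deriv (hS : IsHardySet S) {u : ℝ → ℝ} (hu : u ∈ S) {k : ℕ}
    (h : IsOrderPow (deriv u) k) : IsOrderPow u (k + 1) := by
  rcases hS.trichotomy (hS.deriv_mem u hu) with h0 | h0 | h0
  · exfalso
    obtain ⟨a, b, ha, hab⟩ := h
    obtain ⟨t, h1, h2, h3⟩ := (h0.and (hab.and (eventually_gt_atTop 0))).exists
    have : 0 < a * t ^ k := by positivity
    simp only [h1, Pi.zero_apply, abs_zero] at h2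
    linarith [h2.1]
  · exact isOrderPow_of_deriv_pos (hS.differentiable u hu) h0 h
  · have hn : IsOrderPow (-u) (k + 1) := by
      refine isOrderPow_of_deriv_pos (hS.differentiable _ (hS.neg_mem u hu)) ?_ ?_
      · filter_upwards [h0] with t ht
        rw [deriv.neg]; linarith
      · obtain ⟨a, b, ha, hab⟩ := h
        exact ⟨a, b, ha, hab.mono fun t ht => by rwa [deriv.neg, abs_neg]⟩
    obtain ⟨a, b, ha, hab⟩ := hn
    exact ⟨a, b, ha, hab.mono fun t ht => by simpa using ht⟩

lemma isOrderPow_of_iterate_deriv (hS : IsHardySet S) {f : ℝ → ℝ} (hf : f ∈ S) (m : ℕ) :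
    ∀ k, IsOrderPow (deriv^[m] f) k → IsOrderPow f (k + m) := by
  induction m with
  | zero => intro k h; exact h
  | succ m ih =>
    intro k h
    rw [Function.iterate_succ_apply'] at h
    have := ih (k + 1) (hS.isOrderPow_of_deriv (hS.iterate_deriv_mem hf m) h)
    rwa [Nat.add_right_comm] at this

end IsHardySet

/-- Beyond `1`, the power `t ^ m` is either at most `t ^ (j - 1)` or at least `t ^ j`, and `f` is of
larger order than the former and of smaller order than the latter. -/
lemma ConditionB.not_isOrderPow {f : ℝ → ℝ} (hB : ConditionB f) (m : ℕ) : ¬ IsOrderPow f m := by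
  rintro ⟨a, b, ha, hab⟩
  obtain ⟨j, hj, h1, h2⟩ := hB
  rcases Nat.lt_or_ge m j with hm | hm
  · obtain ⟨t, h3, h4, h5⟩ := (hab.and ((h1.eventually_gt_atTop |b|).and
      (eventually_ge_atTop 1))).exists
    have hp : 0 < t ^ (j - 1) := by positivity
    rw [lt_div_iff₀ hp] at h4
    have h6 : t ^ m ≤ t ^ (j - 1) := pow_le_pow_right₀ h5 (by omega)
    have h7 : b * t ^ m ≤ |b| * t ^ (j - 1) := by
      gcongr; exact le_abs_self b
    linarith [le_abs_self (f t), h3.2]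
  · obtain ⟨t, h3, h4, h5⟩ := (hab.and ((h2.eventually_gt_atTop (1 / a)).and
      (eventually_ge_atTop 1))).exists
    have hp : 0 < t ^ j := by positivity
    have hf : 0 < f t := by
      by_contra hc
      have : t ^ j / f t ≤ 0 := div_nonpos_of_nonneg_of_nonpos hp.le (not_lt.1 hc)
      have : 0 < 1 / a := by positivity
      linarith
    rw [abs_of_pos hf] at h3
    rw [div_lt_div_iff₀ ha hf] at h4
    have h6 : t ^ j ≤ t ^ m := pow_le_pow_right₀ h5 hm
    nlinarith [h3.1]

/-- A Hardy set containing the identity and the first three iterated logarithms. -/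
structure IsLogHardySet (S : Set (ℝ → ℝ)) : Prop extends IsHardySet S where
  id_mem : id ∈ S
  log_mem : Real.log ∈ S
  logTwo_mem : logTwo ∈ S
  logThree_mem : logThree ∈ S

/-- The derivative of `logThree`. -/
noncomputable def logThreeDeriv (t : ℝ) : ℝ := t⁻¹ / Real.log t / logTwo t

lemma eventually_logs_ge (c : ℝ) : ∀ᶠ t : ℝ in atTop,
    c ≤ t ∧ c ≤ Real.log t ∧ c ≤ logTwo t ∧ c ≤ logThree t := by
  filter_upwards [eventually_ge_atTop c, Real.tendsto_log_atTop.eventually_ge_atTop c,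
    tendsto_logTwo.eventually_ge_atTop c, tendsto_logThree.eventually_ge_atTop c]
    with t h1 h2 h3 h4 using ⟨h1, h2, h3, h4⟩

lemma eventually_logs : ∀ᶠ t : ℝ in atTop, HasDerivAt logTwo (t⁻¹ / Real.log t) t ∧
    HasDerivAt logThree (logThreeDeriv t) t ∧ 0 < logThreeDeriv t := by
  filter_upwards [eventually_logs_ge 1] with t ⟨h1, h2, h3, h4⟩
  refine ⟨hasDerivAt_logTwo (by linarith) (by linarith),
    hasDerivAt_logThree (by linarith) (by linarith) (by linarith), ?_⟩
  unfold logThreeDeriv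
  have : 0 < Real.log t := by linarith
  have : 0 < logTwo t := by linarith
  positivity

namespace IsLogHardySet

variable {S : Set (ℝ → ℝ)}

lemma logThreeDeriv_mem (hS : IsLogHardySet S) : logThreeDeriv ∈ S :=
  hS.congr _ (hS.deriv_mem _ hS.logThree_mem) _ (eventually_logs.mono fun _ ht => ht.2.1.deriv)

/-- A function in a Hardy field with unbounded logarithm has a logarithmic derivative that is not
integrable. -/
lemma abs_mul_le_abs_deriv (hS : IsLogHardySet S) {u : ℝ → ℝ} (hu : u ∈ S)
    (hne : ∀ᶠ t in atTop, u t ≠ 0) (h : ¬ IsOrderPow u 0) :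
    ∀ᶠ t in atTop, |u t| * (logThreeDeriv t / logThree t ^ 2) ≤ |deriv u t| := by
  have hm : (fun t => |u t|) * (logThreeDeriv * (logThree ^ 2)⁻¹) ∈ S :=
    hS.mul_mem _ (hS.abs_mem hu) _ (hS.mul_mem _ hS.logThreeDeriv_mem _
      (hS.inv_mem _ (hS.pow_mem hS.logThree_mem 2)))
  rcases hS.lt_or_le (hS.abs_mem (hS.deriv_mem u hu)) hm with hlt | hle
  · exfalso
    apply h
    -- The comparison function is the derivative of the bounded function `-1 / logThree`. If it
    -- dominates `|u'/u|`, then `log |u|` is bounded, contrary to `h`.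
    have hφ : ∀ᶠ t in atTop, HasDerivAt (fun t => (logThree t)⁻¹)
        (-(logThreeDeriv t / logThree t ^ 2)) t := by
      filter_upwards [eventually_logs, eventually_logs_ge 1] with t h1 h2
      rw [← neg_div]
      exact h1.2.1.inv (by linarith [h2.2.2.2])
    have hlog : ∀ᶠ t in atTop, HasDerivAt (fun t => Real.log (u t)) (deriv u t / u t) t ∧
        |deriv u t / u t| ≤ logThreeDeriv t / logThree t ^ 2 := by
      filter_upwards [hS.differentiable u hu, hne, hlt] with t h1 h2 h3
      refine ⟨h1.hasDerivAt.log h2, ?_⟩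
      rw [abs_div, div_le_iff₀ (abs_pos.2 h2), mul_comm]
      simp only [Pi.mul_apply, Pi.inv_apply, Pi.pow_apply] at h3
      rw [div_eq_mul_inv]
      exact h3.le
    obtain ⟨c₁, hc₁⟩ := exists_eventually_le_of_deriv
      (h := fun t => Real.log (u t) + (logThree t)⁻¹)
      (h' := fun t => deriv u t / u t + -(logThreeDeriv t / logThree t ^ 2)) (by
        filter_upwards [hφ, hlog] with t h1 h2
        exact ⟨h2.1.add h1, by linarith [(abs_le.1 h2.2).2]⟩)
    obtain ⟨c₂, hc₂⟩ := exists_eventually_ge_of_deriv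
      (h := fun t => Real.log (u t) - (logThree t)⁻¹)
      (h' := fun t => deriv u t / u t - -(logThreeDeriv t / logThree t ^ 2)) (by
        filter_upwards [hφ, hlog] with t h1 h2
        exact ⟨h2.1.sub h1, by linarith [(abs_le.1 h2.2).1]⟩)
    refine isOrderPow_zero_of_log_bounded (a := c₂) (b := c₁) ?_
    filter_upwards [hne, hc₁, hc₂, eventually_logs_ge 1] with t h1 h2 h3 h4
    have : 0 < (logThree t)⁻¹ := inv_pos.2 (by linarith [h4.2.2.2])
    exact ⟨h1, by linarith, by linarith⟩
  · filter_upwards [hle] with t ht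
    simpa [div_eq_mul_inv] using ht

/-- Otherwise `u'/u` has constant sign and exceeds `(B + 1) / t` in absolute value, so `|log |u||`
would outgrow `B log t`. -/
lemma mul_abs_deriv_le (hS : IsLogHardySet S) {u : ℝ → ℝ} (hu : u ∈ S) (B : ℕ)
    (hB : ∀ᶠ t in atTop, 1 ≤ |u t| * t ^ B ∧ |u t| ≤ t ^ B) :
    ∀ᶠ t in atTop, t * |deriv u t| ≤ (B + 1) * |u t| := by
  have hne : ∀ᶠ t in atTop, u t ≠ 0 := by
    filter_upwards [hB] with t ht h0
    simp only [h0, abs_zero, zero_mul] at ht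
    linarith [ht.1]
  have hl : ∀ᶠ t in atTop, -(B * Real.log t) ≤ Real.log (u t) ∧
      Real.log (u t) ≤ B * Real.log t := by
    filter_upwards [hB, hne, eventually_gt_atTop 0] with t h1 h2 h3
    have h4 : 0 < |u t| := abs_pos.2 h2
    have h5 := Real.log_le_log one_pos h1.1
    rw [Real.log_one, Real.log_mul h4.ne' (by positivity), Real.log_pow, Real.log_abs] at h5
    have h6 := Real.log_le_log h4 h1.2
    rw [Real.log_pow, Real.log_abs] at h6
    exact ⟨by linarith, h6⟩
  have hd := hS.differentiable u hu
  have hm1 : id * (fun t => |deriv u t|) ∈ S :=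
    hS.mul_mem _ hS.id_mem _ (hS.abs_mem (hS.deriv_mem u hu))
  have hm2 : (fun _ => ((B + 1 : ℕ) : ℝ)) * (fun t => |u t|) ∈ S :=
    hS.mul_mem _ (hS.natCast_mem (B + 1)) _ (hS.abs_mem hu)
  rcases hS.lt_or_le hm2 hm1 with hlt | hle
  · exfalso
    have hlt' : ∀ᶠ t in atTop, ((B : ℝ) + 1) / t ≤ |deriv u t / u t| := by
      filter_upwards [hlt, hne, eventually_gt_atTop 0] with t h1 h2 h3
      simp only [Pi.mul_apply, id, Nat.cast_add, Nat.cast_one] at h1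
      rw [abs_div, div_le_div_iff₀ h3 (abs_pos.2 h2)]
      linarith
    have hq : deriv u * u⁻¹ ∈ S := hS.mul_mem _ (hS.deriv_mem u hu) _ (hS.inv_mem u hu)
    rcases hS.lt_or_le hS.zero_mem hq with hpos | hneg
    · obtain ⟨c, hc⟩ := exists_eventually_ge_of_deriv
        (h := fun t => Real.log (u t) - (B + 1) * Real.log t)
        (h' := fun t => deriv u t / u t - (B + 1) * t⁻¹) (by
          filter_upwards [hlt', hd, hne, eventually_gt_atTop 0, hpos] with t h1 h2 h3 h4 h5
          refine ⟨(h2.hasDerivAt.log h3).sub ((Real.hasDerivAt_log h4.ne').const_mul _), ?_⟩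
          simp only [Pi.mul_apply, Pi.inv_apply, ← div_eq_mul_inv, Pi.zero_apply] at h5
          rw [abs_of_pos h5] at h1
          rw [← div_eq_mul_inv]; linarith)
      obtain ⟨t, h1, h2, h3⟩ := (hc.and (hl.and
        (Real.tendsto_log_atTop.eventually_gt_atTop (-c)))).exists
      linarith [h2.2]
    · obtain ⟨c, hc⟩ := exists_eventually_le_of_deriv
        (h := fun t => Real.log (u t) + (B + 1) * Real.log t)
        (h' := fun t => deriv u t / u t + (B + 1) * t⁻¹) (by
          filter_upwards [hlt', hd, hne, eventually_gt_atTop 0, hneg] with t h1 h2 h3 h4 h5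
          refine ⟨(h2.hasDerivAt.log h3).add ((Real.hasDerivAt_log h4.ne').const_mul _), ?_⟩
          simp only [Pi.mul_apply, Pi.inv_apply, ← div_eq_mul_inv, Pi.zero_apply] at h5
          rw [abs_of_nonpos h5] at h1
          rw [← div_eq_mul_inv]; linarith)
      obtain ⟨t, h1, h2, h3⟩ := (hc.and (hl.and
        (Real.tendsto_log_atTop.eventually_gt_atTop c))).exists
      linarith [h2.1]
  · filter_upwards [hle] with t ht
    simpa using ht

end IsLogHardySet

/-- The product equals `log t / (log₂ t (log₃ t)^2)`; this lets the cost `t log t log₂ t (log₃ t)^2`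
of a differentiation be replaced by the simpler `t (log t)^2`. -/
lemma eventually_mul_log_sq_mul_logThreeDeriv_ge : ∀ᶠ t : ℝ in atTop,
    1 ≤ (t * Real.log t ^ 2) * (logThreeDeriv t / logThree t ^ 2) := by
  have h1 : ∀ᶠ y : ℝ in atTop, Real.log y ^ (3 : ℕ) ≤ y := by
    have := (Real.isLittleO_pow_log_id_atTop (n := 3)).bound one_pos
    filter_upwards [this, eventually_ge_atTop 0] with y hy h0
    simp only [Real.norm_eq_abs, id, one_mul] at hy
    rw [abs_of_nonneg h0] at hy
    exact (le_abs_self _).trans hy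
  filter_upwards [Real.tendsto_log_atTop.eventually h1, eventually_logs_ge 1]
    with t h2 ⟨h3, h4, h5, h6⟩
  have h7 : logThree t ≤ logTwo t := Real.log_le_self (by linarith)
  have h8 : logTwo t * logThree t ^ 2 ≤ Real.log t := by
    refine le_trans ?_ h2
    have e : Real.log (Real.log t) = logTwo t := rfl
    have h9 : logThree t ^ 2 ≤ logTwo t ^ 2 := by gcongr
    rw [e, show logTwo t ^ 3 = logTwo t * logTwo t ^ 2 by ring]
    exact mul_le_mul_of_nonneg_left h9 (by linarith)
  have p1 : 0 < t := by linarith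
  have p2 : 0 < Real.log t := by linarith
  have p3 : 0 < logTwo t := by linarith
  have p4 : 0 < logThree t := by linarith
  have e : (t * Real.log t ^ 2) * (logThreeDeriv t / logThree t ^ 2) =
      Real.log t / (logTwo t * logThree t ^ 2) := by
    unfold logThreeDeriv; field_simp
  rw [e, one_le_div (by positivity)]
  exact h8

namespace IsLogHardySet

variable {S : Set (ℝ → ℝ)}

lemma eventually_abs_deriv_ge (hS : IsLogHardySet S) {u : ℝ → ℝ} (hu : u ∈ S)
    (hne : ∀ᶠ t in atTop, u t ≠ 0) (h : ¬ IsOrderPow u 0) :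
    ∀ᶠ t in atTop, |u t| ≤ |deriv u t| * (t * Real.log t ^ 2) := by
  filter_upwards [hS.abs_mul_le_abs_deriv hu hne h, eventually_mul_log_sq_mul_logThreeDeriv_ge,
    eventually_logs_ge 1] with t h1 h2 h3
  have h4 : 0 ≤ t * Real.log t ^ 2 := by have := h3.1; positivity
  nlinarith [mul_le_mul_of_nonneg_right h1 h4, abs_nonneg (u t)]

end IsLogHardySet

lemma ConditionB.tendsto_atTop {f : ℝ → ℝ} (hB : ConditionB f) : Tendsto f atTop atTop := by
  obtain ⟨j, hj, h1, h2⟩ := hB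
  refine tendsto_atTop_mono' _ ?_ h1
  filter_upwards [h1.eventually_ge_atTop 0, eventually_ge_atTop 1] with t h3 h4
  have hp : 1 ≤ t ^ (j - 1) := one_le_pow₀ h4
  have e : f t = f t / t ^ (j - 1) * t ^ (j - 1) := by field_simp
  nth_rewrite 2 [e]
  exact le_mul_of_one_le_right h3 hp

namespace IsLogHardySet

variable {S : Set (ℝ → ℝ)} {f : ℝ → ℝ}

/-- Otherwise `m` integrations would give `f` the exact order `t ^ m`. -/
lemma not_isOrderPow_iterate_deriv (hS : IsLogHardySet S) (hf : f ∈ S) (hB : ConditionB f)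
    (m : ℕ) : ¬ IsOrderPow (deriv^[m] f) 0 := fun h =>
  hB.not_isOrderPow _ (hS.isOrderPow_of_iterate_deriv hf m 0 h)

lemma iterate_deriv_ne_zero (hS : IsLogHardySet S) (hf : f ∈ S) (hB : ConditionB f) (m : ℕ) :
    ∀ᶠ t in atTop, deriv^[m] f t ≠ 0 := by
  induction m with
  | zero => exact hB.tendsto_atTop.eventually_ne_atTop 0
  | succ m ih =>
    filter_upwards [hS.eventually_abs_deriv_ge (hS.iterate_deriv_mem hf m) ih
      (hS.not_isOrderPow_iterate_deriv hf hB m), ih] with t h1 h2 h3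
    rw [Function.iterate_succ_apply'] at h3
    rw [h3, abs_zero, zero_mul] at h1
    exact h2 (abs_nonpos_iff.1 h1)

/-- Crude polynomial bounds, needed as input for `mul_abs_deriv_le`. A differentiation loses at most
`t (log t)^2 ≤ t ^ 3`, and in fact the exponent grows by `2` because `(log t)^2 ≤ t`. -/
lemma exists_iterate_deriv_le_pow (hS : IsLogHardySet S) (hf : f ∈ S) (hB : ConditionB f)
    (m : ℕ) : ∃ B : ℕ, ∀ᶠ t in atTop,
      1 ≤ |deriv^[m] f t| * t ^ B ∧ |deriv^[m] f t| ≤ t ^ B := by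
  induction m with
  | zero =>
    obtain ⟨j, hj, h1, h2⟩ := id hB
    refine ⟨j, ?_⟩
    filter_upwards [h2.eventually_ge_atTop 1, hB.tendsto_atTop.eventually_ge_atTop 1,
      eventually_ge_atTop 1] with t h3 h4 h5
    simp only [Function.iterate_zero, id]
    rw [one_le_div (by linarith)] at h3
    rw [abs_of_pos (by linarith)]
    exact ⟨one_le_mul_of_one_le_of_one_le h4 (one_le_pow₀ h5), h3⟩
  | succ m ih =>
    obtain ⟨B, hBm⟩ := ih
    have hu := hS.iterate_deriv_mem hf m
    have hlog : ∀ᶠ t : ℝ in atTop, Real.log t ^ 2 ≤ t := by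
      have := (Real.isLittleO_pow_log_id_atTop (n := 2)).bound one_pos
      filter_upwards [this, eventually_ge_atTop 0] with y hy h0
      simp only [Real.norm_eq_abs, id, one_mul] at hy
      rw [abs_of_nonneg h0] at hy
      exact (le_abs_self _).trans hy
    refine ⟨B + 2, ?_⟩
    filter_upwards [hBm, hS.eventually_abs_deriv_ge hu (hS.iterate_deriv_ne_zero hf hB m)
      (hS.not_isOrderPow_iterate_deriv hf hB m), hS.mul_abs_deriv_le hu B hBm, hlog,
      eventually_ge_atTop ((B : ℝ) + 1)] with t h1 h2 h3 h4 h5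
    rw [Function.iterate_succ_apply']
    set v := |deriv (deriv^[m] f) t| with hv
    have hv0 : 0 ≤ v := abs_nonneg _
    have ht1 : 1 ≤ t := by
      have : (0 : ℝ) ≤ B := Nat.cast_nonneg B
      linarith
    have ht0 : 0 < t := by linarith
    constructor
    · calc 1 ≤ |deriv^[m] f t| * t ^ B := h1.1
        _ ≤ (v * (t * Real.log t ^ 2)) * t ^ B := by gcongr
        _ ≤ (v * (t * t)) * t ^ B := by gcongr
        _ = v * t ^ (B + 2) := by ring
    · have h6 : t * v ≤ t * t ^ B := by
        calc t * v ≤ (B + 1) * |deriv^[m] f t| := h3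
          _ ≤ t * t ^ B := by
            refine mul_le_mul h5 h1.2 (abs_nonneg _) ht0.le
      have h7 : v ≤ t ^ B := le_of_mul_le_mul_left h6 ht0
      exact h7.trans (pow_le_pow_right₀ ht1 (by omega))

/-- Up to powers of the logarithm, the derivatives of `f` have the size of `f(t) / t ^ m`. -/
lemma eventually_iterate_deriv_bounds (hS : IsLogHardySet S) (hf : f ∈ S) (hB : ConditionB f)
    (m : ℕ) : ∀ᶠ t in atTop, f t ≤ |deriv^[m] f t| * (t * Real.log t ^ 2) ^ m ∧
      |deriv^[m] f t| * t ^ m ≤ f t * Real.log t ^ m := by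
  induction m with
  | zero =>
    filter_upwards [hB.tendsto_atTop.eventually_ge_atTop 0] with t h1
    simp [abs_of_nonneg h1]
  | succ m ih =>
    obtain ⟨B, hBm⟩ := hS.exists_iterate_deriv_le_pow hf hB m
    have hu := hS.iterate_deriv_mem hf m
    filter_upwards [ih, hS.eventually_abs_deriv_ge hu (hS.iterate_deriv_ne_zero hf hB m)
      (hS.not_isOrderPow_iterate_deriv hf hB m), hS.mul_abs_deriv_le hu B hBm,
      eventually_logs_ge ((B : ℝ) + 1)] with t h1 h2 h3 h4
    rw [Function.iterate_succ_apply']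
    have hB0 : (0 : ℝ) ≤ B := Nat.cast_nonneg B
    have ht0 : 0 < t := by linarith [h4.1]
    have hl0 : 0 < Real.log t := by linarith [h4.2.1]
    constructor
    · calc f t ≤ |deriv^[m] f t| * (t * Real.log t ^ 2) ^ m := h1.1
        _ ≤ (|deriv (deriv^[m] f) t| * (t * Real.log t ^ 2)) * (t * Real.log t ^ 2) ^ m := by
          gcongr
        _ = _ := by ring
    · calc |deriv (deriv^[m] f) t| * t ^ (m + 1) = (t * |deriv (deriv^[m] f) t|) * t ^ m := by ring
        _ ≤ ((B + 1) * |deriv^[m] f t|) * t ^ m := by gcongr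
        _ ≤ (Real.log t * |deriv^[m] f t|) * t ^ m := by gcongr; exact h4.2.1
        _ = Real.log t * (|deriv^[m] f t| * t ^ m) := by ring
        _ ≤ Real.log t * (f t * Real.log t ^ m) := mul_le_mul_of_nonneg_left h1.2 hl0.le
        _ = _ := by ring

/-! ### Domination between functions passes to their derivatives. -/

/-- If `p` decreases, then `2v - p` increases from a positive value, so `v` stays above some `c > 0`
and `p' ≤ -c (log₃)'` forces `p → -∞`. If `p` increases, then `v ≥ p ≥ c > 0` forces `p → ∞`, while
`p - 2v` is bounded below although it is at most `-p`. -/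
lemma false_of_abs_le_of_deriv_le (hS : IsLogHardySet S) {p v : ℝ → ℝ} (hp : p ∈ S) (hv : v ∈ S)
    (hp0 : ∀ᶠ t in atTop, 0 < p t) (hpv : ∀ᶠ t in atTop, p t ≤ v t)
    (h1 : ∀ᶠ t in atTop, 2 * |deriv v t| ≤ |deriv p t|)
    (h2 : ∀ᶠ t in atTop, v t * logThreeDeriv t ≤ |deriv p t|) : False := by
  have hpd := hS.differentiable p hp
  have hvd := hS.differentiable v hv
  rcases hS.lt_or_le (hS.deriv_mem p hp) hS.zero_mem with hs | hs
  · obtain ⟨X, hX⟩ := exists_monotoneOn_of_deriv (h := fun t => 2 * v t - p t)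
      (h' := fun t => 2 * deriv v t - deriv p t) (by
        filter_upwards [hpd, hvd, hs, h1] with t a1 a2 a3 a4
        simp only [Pi.zero_apply] at a3
        rw [abs_of_neg a3] at a4
        exact ⟨(a2.hasDerivAt.const_mul 2).sub a1.hasDerivAt,
          by linarith [neg_abs_le (deriv v t)]⟩)
    obtain ⟨Y, hY⟩ := eventually_atTop.1 ((hp0.and hpv).and (eventually_ge_atTop X))
    have hc : 0 < (2 * v Y - p Y) / 2 := by
      have := hY Y le_rfl
      linarith [this.1.1, this.1.2]
    set c := (2 * v Y - p Y) / 2 with hcdef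
    have hvc : ∀ᶠ t in atTop, c ≤ v t := by
      filter_upwards [eventually_ge_atTop Y] with t ht
      have a1 := hX (show Y ∈ Set.Ici X from (hY Y le_rfl).2) (show t ∈ Set.Ici X from (hY t ht).2) ht
      simp only at a1
      linarith [(hY t ht).1.1]
    obtain ⟨b, hb⟩ := exists_eventually_le_of_deriv (h := fun t => p t + c * logThree t)
      (h' := fun t => deriv p t + c * logThreeDeriv t) (by
        filter_upwards [hpd, hs, h2, hvc, eventually_logs] with t a1 a2 a3 a4 a5
        simp only [Pi.zero_apply] at a2
        rw [abs_of_neg a2] at a3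
        exact ⟨a1.hasDerivAt.add (a5.2.1.const_mul c), by nlinarith [a5.2.2]⟩)
    obtain ⟨t, a1, a2, a3⟩ := (hb.and (hp0.and
      ((tendsto_logThree.const_mul_atTop hc).eventually_gt_atTop b))).exists
    linarith
  · obtain ⟨X, hX⟩ := exists_monotoneOn_of_deriv (h := p) (h' := deriv p) (by
      filter_upwards [hpd, hs] with t a1 a2 using ⟨a1.hasDerivAt, a2⟩)
    obtain ⟨Y, hY⟩ := eventually_atTop.1 ((hp0.and hpv).and (eventually_ge_atTop X))
    have hc : 0 < p Y := (hY Y le_rfl).1.1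
    set c := p Y with hcdef
    have hvc : ∀ᶠ t in atTop, c ≤ v t := by
      filter_upwards [eventually_ge_atTop Y] with t ht
      have a1 := hX (show Y ∈ Set.Ici X from (hY Y le_rfl).2) (show t ∈ Set.Ici X from (hY t ht).2) ht
      linarith [(hY t ht).1.2]
    obtain ⟨b, hb⟩ := exists_eventually_ge_of_deriv (h := fun t => p t - c * logThree t)
      (h' := fun t => deriv p t - c * logThreeDeriv t) (by
        filter_upwards [hpd, hs, h2, hvc, eventually_logs] with t a1 a2 a3 a4 a5
        simp only [Pi.zero_apply] at a2
        rw [abs_of_nonneg a2] at a3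
        exact ⟨a1.hasDerivAt.sub (a5.2.1.const_mul c), by nlinarith [a5.2.2]⟩)
    obtain ⟨d, hd⟩ := exists_eventually_ge_of_deriv (h := fun t => p t - 2 * v t)
      (h' := fun t => deriv p t - 2 * deriv v t) (by
        filter_upwards [hpd, hvd, hs, h1] with t a1 a2 a3 a4
        simp only [Pi.zero_apply] at a3
        rw [abs_of_nonneg a3] at a4
        exact ⟨a1.hasDerivAt.sub (a2.hasDerivAt.const_mul 2), by linarith [le_abs_self (deriv v t)]⟩)
    obtain ⟨t, a1, a2, a3, a4⟩ := (hb.and (hd.and (hpv.and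
      ((tendsto_logThree.const_mul_atTop hc).eventually_gt_atTop (-d - b))))).exists
    linarith

/-- The weight `(log₃ t)^{3m} / (log₂ t)^4`. -/
noncomputable def _root_.domWeight (m : ℕ) (t : ℝ) : ℝ := logThree t ^ (3 * m) / logTwo t ^ 4

lemma domWeight_mem (hS : IsLogHardySet S) (m : ℕ) : domWeight m ∈ S :=
  hS.congr _ (hS.mul_mem _ (hS.pow_mem hS.logThree_mem (3 * m)) _
    (hS.inv_mem _ (hS.pow_mem hS.logTwo_mem 4))) _
    (Eventually.of_forall fun t => by simp [domWeight, div_eq_mul_inv])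

/-- The logarithmic derivative of the weight is `(3m / log₃ - 4)` times that of `log₂`, which is
`(log₃)'`. -/
lemma _root_.eventually_hasDerivAt_domWeight (m : ℕ) : ∀ᶠ t in atTop, ∃ d,
    HasDerivAt (domWeight m) d t ∧ |d| ≤ (3 * m + 4) * domWeight m t * logThreeDeriv t := by
  filter_upwards [eventually_logs, eventually_logs_ge 1] with t ⟨h1, h2, h3⟩ ⟨a1, a2, a3, a4⟩
  have p1 : 0 < t := by linarith
  have p2 : 0 < Real.log t := by linarith
  have p3 : 0 < logTwo t := by linarith
  have p4 : 0 < logThree t := by linarith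
  refine ⟨_, (h2.pow (3 * m)).div (h1.pow 4) (by positivity), ?_⟩
  have hw : 0 < domWeight m t := by unfold domWeight; positivity
  have e : ((((3 * m : ℕ) : ℝ) * logThree t ^ (3 * m - 1) * logThreeDeriv t) * logTwo t ^ 4 -
      logThree t ^ (3 * m) * (((4 : ℕ) : ℝ) * logTwo t ^ (4 - 1) * (t⁻¹ / Real.log t))) /
      (logTwo t ^ 4) ^ 2 =
      (3 * m / logThree t - 4) * (domWeight m t * logThreeDeriv t) := by
    have e1 : ((3 * m : ℕ) : ℝ) * logThree t ^ (3 * m - 1) =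
        3 * m / logThree t * logThree t ^ (3 * m) := by
      rcases m with _ | m
      · simp
      · have : 3 * (m + 1) = 3 * (m + 1) - 1 + 1 := by omega
        nth_rewrite 3 [this]
        rw [pow_succ]; push_cast; field_simp
    have e2 : t⁻¹ / Real.log t = logThreeDeriv t * logTwo t := by
      unfold logThreeDeriv; field_simp
    rw [e1, e2]
    unfold domWeight
    push_cast
    field_simp
  simp only [Pi.pow_apply]
  rw [e, abs_mul, abs_of_pos (mul_pos hw h3), mul_assoc]
  refine mul_le_mul_of_nonneg_right ?_ (mul_pos hw h3).le
  have h5 : 3 * (m : ℝ) / logThree t ≤ 3 * m := div_le_self (by positivity) a4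
  have h6 : 0 ≤ 3 * (m : ℝ) / logThree t := by positivity
  rw [abs_le]; constructor <;> linarith

/-- If the conclusion is reversed, `false_of_abs_le_of_deriv_le` applies to `±p` and `v = domWeight
m * |u|`. Of the three extra powers of `log₃`, two pay for `|u| (log₃)' ≤ (log₃)^2 |u'|` when `v` is
differentiated, and the third beats the constants depending on `m`. -/
lemma abs_deriv_le_domWeight_succ (hS : IsLogHardySet S) {p u : ℝ → ℝ} (hp : p ∈ S) (hu : u ∈ S)
    (hne : ∀ᶠ t in atTop, u t ≠ 0) (h : ¬ IsOrderPow u 0) (m : ℕ)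
    (hpu : ∀ᶠ t in atTop, |p t| ≤ domWeight m t * |u t|) :
    ∀ᶠ t in atTop, |deriv p t| ≤ domWeight (m + 1) t * |deriv u t| := by
  have hm : domWeight (m + 1) * (fun t => |deriv u t|) ∈ S :=
    hS.mul_mem _ (hS.domWeight_mem _) _ (hS.abs_mem (hS.deriv_mem u hu))
  rcases hS.lt_or_le hm (hS.abs_mem (hS.deriv_mem p hp)) with hlt | hle
  swap
  · exact hle
  exfalso
  have hau := hS.abs_mem hu
  have hv : domWeight m * (fun t => |u t|) ∈ S := hS.mul_mem _ (hS.domWeight_mem m) _ hau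
  have habs : ∀ᶠ t in atTop, |deriv (fun t => |u t|) t| = |deriv u t| := by
    rcases hS.trichotomy hu with h0 | h0 | h0
    · filter_upwards [h0, hne] with t a1 a2 using absurd a1 a2
    · filter_upwards [Eventually.eventually_nhds_of_atTop h0] with t ht
      rw [EventuallyEq.deriv_eq (f := u) (ht.mono fun s hs => abs_of_pos hs)]
    · filter_upwards [Eventually.eventually_nhds_of_atTop h0] with t ht
      rw [EventuallyEq.deriv_eq (f := -u) (ht.mono fun s hs => abs_of_neg hs), deriv.neg, abs_neg]
  have hlow := hS.abs_mul_le_abs_deriv hu hne h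
  have key : ∀ᶠ t in atTop, 2 * |deriv (domWeight m * fun t => |u t|) t| ≤ |deriv p t| ∧
      (domWeight m * fun t => |u t|) t * logThreeDeriv t ≤ |deriv p t| := by
    filter_upwards [hlt, habs, hlow, eventually_hasDerivAt_domWeight m, hS.differentiable _ hau,
      eventually_logs, eventually_logs_ge (2 * (3 * m + 5))]
      with t a1 a2 a3 ⟨d, a4, a4'⟩ a5 ⟨_, a6, a7⟩ ⟨_, _, a9, a10⟩
    have hm0 : (0 : ℝ) ≤ m := Nat.cast_nonneg m
    have p3 : 0 < logTwo t := by linarith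
    have p4 : 0 < logThree t := by linarith
    have hw : 0 < domWeight m t := by unfold domWeight; positivity
    have hws : domWeight (m + 1) t = domWeight m t * logThree t ^ 3 := by
      unfold domWeight
      rw [show 3 * (m + 1) = 3 * m + 3 by ring, pow_add]; ring
    simp only [Pi.mul_apply] at a1 ⊢
    rw [hws] at a1
    set l := logThree t
    set w := domWeight m t
    set U := |deriv u t|
    have hU : 0 ≤ U := abs_nonneg _
    have b1 : |u t| * logThreeDeriv t ≤ l ^ 2 * U := by
      have e : |u t| * (logThreeDeriv t / l ^ 2) = |u t| * logThreeDeriv t / l ^ 2 := by ring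
      rw [e, div_le_iff₀ (by positivity)] at a3
      linarith
    have hwU : 0 ≤ w * U := by positivity
    constructor
    · rw [(a4.mul a5.hasDerivAt).deriv]
      have b2 : |d * |u t| + w * deriv (fun t => |u t|) t| ≤ (3 * m + 4) * w * (l ^ 2 * U) + w * U := by
        refine (abs_add_le _ _).trans (add_le_add ?_ ?_)
        · rw [abs_mul, abs_abs]
          calc |d| * |u t| ≤ ((3 * m + 4) * w * logThreeDeriv t) * |u t| := by gcongr
            _ = (3 * m + 4) * w * (|u t| * logThreeDeriv t) := by ring
            _ ≤ _ := by gcongr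
        · rw [abs_mul, a2, abs_of_pos hw]
      have b3 : 2 * (((3 * m + 4) * l ^ 2 + 1)) ≤ l ^ 3 := by
        have c1 : 1 ≤ l ^ 2 := one_le_pow₀ (by linarith)
        have c2 : 2 * (3 * m + 5) * l ^ 2 ≤ l * l ^ 2 := by gcongr
        nlinarith
      have b4 := mul_le_mul_of_nonneg_right b3 hwU
      calc 2 * |d * |u t| + w * deriv (fun t => |u t|) t|
          ≤ 2 * ((3 * m + 4) * w * (l ^ 2 * U) + w * U) := by linarith
        _ = 2 * ((3 * m + 4) * l ^ 2 + 1) * (w * U) := by ring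
        _ ≤ l ^ 3 * (w * U) := b4
        _ = w * l ^ 3 * U := by ring
        _ ≤ _ := a1.le
    · have c1 : l ^ 2 ≤ l ^ 3 := pow_le_pow_right₀ (by linarith) (by norm_num)
      calc w * |u t| * logThreeDeriv t = w * (|u t| * logThreeDeriv t) := by ring
        _ ≤ w * (l ^ 2 * U) := by gcongr
        _ = l ^ 2 * (w * U) := by ring
        _ ≤ l ^ 3 * (w * U) := by gcongr
        _ = w * l ^ 3 * U := by ring
        _ ≤ _ := a1.le
  have hk1 := key.mono fun t ht => ht.1
  have hk2 := key.mono fun t ht => ht.2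
  rcases hS.trichotomy hp with h0 | h0 | h0
  · obtain ⟨t, a1, a2, a3, a4, a5⟩ := (h0.deriv_atTop.and (hk2.and (hne.and (eventually_logs.and
      (eventually_logs_ge 1))))).exists
    have p3 : 0 < logTwo t := by linarith [a5.2.2.1]
    have p4 : 0 < logThree t := by linarith [a5.2.2.2]
    have hw : 0 < domWeight m t := by unfold domWeight; positivity
    have : 0 < domWeight m t * |u t| * logThreeDeriv t :=
      mul_pos (mul_pos hw (abs_pos.2 a3)) a4.2.2
    have e0 : deriv (0 : ℝ → ℝ) t = 0 := deriv_const t 0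
    rw [a1, e0, abs_zero] at a2
    simp only [Pi.mul_apply] at a2
    linarith
  · refine hS.false_of_abs_le_of_deriv_le hp hv h0 ?_ hk1 hk2
    filter_upwards [hpu] with t ht using (le_abs_self _).trans ht
  · refine hS.false_of_abs_le_of_deriv_le (hS.neg_mem p hp) hv (h0.mono fun t ht => ?_) ?_
      (hk1.mono fun t ht => ?_) (hk2.mono fun t ht => ?_)
    · simpa using ht
    · filter_upwards [hpu] with t ht using (neg_le_abs _).trans ht
    · rwa [deriv.neg, abs_neg]
    · rwa [deriv.neg, abs_neg]

lemma iterate_deriv_le_domWeight (hS : IsLogHardySet S) {p : ℝ → ℝ} (hp : p ∈ S) (hf : f ∈ S)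
    (hB : ConditionB f) (hpf : ∀ᶠ t in atTop, |p t| * logTwo t ^ 4 ≤ |f t|) (m : ℕ) :
    ∀ᶠ t in atTop, |deriv^[m] p t| ≤ domWeight m t * |deriv^[m] f t| := by
  induction m with
  | zero =>
    filter_upwards [hpf, eventually_logs_ge 1] with t h1 h2
    have p3 : 0 < logTwo t := by linarith [h2.2.2.1]
    simp only [domWeight, Function.iterate_zero, id, mul_zero, pow_zero]
    rw [div_mul_eq_mul_div, one_mul, le_div_iff₀ (by positivity)]
    exact h1
  | succ m ih =>
    rw [Function.iterate_succ_apply', Function.iterate_succ_apply']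
    exact hS.abs_deriv_le_domWeight_succ (hS.iterate_deriv_mem hp m) (hS.iterate_deriv_mem hf m)
      (hS.iterate_deriv_ne_zero hf hB m) (hS.not_isOrderPow_iterate_deriv hf hB m) m ih

/-- Domination passes to derivatives, at the cost of one factor `log₂ t`. -/
lemma iterate_deriv_mul_logTwo_le (hS : IsLogHardySet S) {p : ℝ → ℝ} (hp : p ∈ S) (hf : f ∈ S)
    (hB : ConditionB f) (hpf : ∀ᶠ t in atTop, |p t| * logTwo t ^ 4 ≤ |f t|) (m : ℕ) :
    ∀ᶠ t in atTop, |deriv^[m] p t| * logTwo t ^ 3 ≤ |deriv^[m] f t| := by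
  have hlog : ∀ᶠ y : ℝ in atTop, Real.log y ^ (3 * m) ≤ y := by
    have := (Real.isLittleO_pow_log_id_atTop (n := 3 * m)).bound one_pos
    filter_upwards [this, eventually_ge_atTop 0] with y hy h0
    simp only [Real.norm_eq_abs, id, one_mul] at hy
    rw [abs_of_nonneg h0] at hy
    exact (le_abs_self _).trans hy
  filter_upwards [hS.iterate_deriv_le_domWeight hp hf hB hpf m, tendsto_logTwo.eventually hlog,
    eventually_logs_ge 1] with t h1 h2 h3
  have p3 : 0 < logTwo t := by linarith [h3.2.2.1]
  have h4 : domWeight m t * logTwo t ^ 3 ≤ 1 := by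
    have e : domWeight m t * logTwo t ^ 3 = logThree t ^ (3 * m) / logTwo t := by
      unfold domWeight; field_simp
    rw [e, div_le_one p3]; exact h2
  calc |deriv^[m] p t| * logTwo t ^ 3 ≤ (domWeight m t * |deriv^[m] f t|) * logTwo t ^ 3 := by
        gcongr
    _ = (domWeight m t * logTwo t ^ 3) * |deriv^[m] f t| := by ring
    _ ≤ 1 * |deriv^[m] f t| := by gcongr
    _ = _ := one_mul _

end IsLogHardySet

/-! ### Exponential sums of smooth phases. -/

lemma norm_sum_expChar_le_of_deriv_pos (G : ℕ → ℝ → ℝ) {a b δ B : ℝ} (hδ : 0 < δ)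
    (hG : ∀ k < 2, ∀ t ∈ Set.Icc a b, HasDerivAt (G k) (G (k + 1) t) t)
    (h1 : ∀ t ∈ Set.Icc a b, δ ≤ G 1 t ∧ G 1 t ≤ 1 / 2)
    (h2 : (∀ t ∈ Set.Icc a b, 0 ≤ G 2 t) ∨ ∀ t ∈ Set.Icc a b, G 2 t ≤ 0)
    (hB : ∀ t ∈ Set.Icc a b, |G 2 t| ≤ B) (n₀ M : ℕ) (ha : a ≤ n₀) (hb : (n₀ : ℝ) + M ≤ b + 1) :
    ‖∑ n ∈ Finset.range M, expChar (G 0 (n₀ + n))‖ ≤ 2 / δ + 1 := by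
  rcases M with _ | M
  · simp; positivity
  push_cast at hb
  -- The last sample point may be as far as `b`, and the difference starting there would leave the
  -- interval; that term is bounded by `1`.
  rw [Finset.sum_range_succ]
  refine (norm_add_le _ _).trans (add_le_add ?_ (by simp))
  have hd1 : ∀ n < M, δ ≤ G 0 (n₀ + (n + 1 : ℕ)) - G 0 (n₀ + n) ∧
      G 0 (n₀ + (n + 1 : ℕ)) - G 0 (n₀ + n) ≤ 1 / 2 := by
    intro n hn
    have hn' : (n : ℝ) + 1 ≤ M := by exact_mod_cast hn
    have hn0 : (0 : ℝ) ≤ n := Nat.cast_nonneg n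
    exact fwdDiff_iterate_mem_Icc 1 G a b δ (1 / 2) (fun k hk => hG k (by omega)) h1 n₀ n
      (by linarith) (by push_cast; linarith)
  have hd2 : ∀ C D : ℝ, (∀ t ∈ Set.Icc a b, C ≤ G 2 t ∧ G 2 t ≤ D) → ∀ n, n + 1 < M →
      C ≤ (G 0 (n₀ + (n + 2 : ℕ)) - G 0 (n₀ + (n + 1 : ℕ))) -
        (G 0 (n₀ + (n + 1 : ℕ)) - G 0 (n₀ + n)) ∧
      (G 0 (n₀ + (n + 2 : ℕ)) - G 0 (n₀ + (n + 1 : ℕ))) -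
        (G 0 (n₀ + (n + 1 : ℕ)) - G 0 (n₀ + n)) ≤ D := by
    intro C D hCD n hn
    have hn' : (n : ℝ) + 2 ≤ M := by exact_mod_cast hn
    have hn0 : (0 : ℝ) ≤ n := Nat.cast_nonneg n
    exact fwdDiff_iterate_mem_Icc 2 G a b C D hG hCD n₀ n (by linarith) (by push_cast; linarith)
  rcases h2 with h2 | h2
  · refine norm_sum_expChar_le_of_monotone (fun n => G 0 (n₀ + n)) M hδ (fun n hn => (hd1 n hn).1)
      (fun n hn => (hd1 n hn).2) fun n hn => ?_
    have := (hd2 0 B (fun t ht => ⟨h2 t ht, (le_abs_self _).trans (hB t ht)⟩) n hn).1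
    linarith
  · refine norm_sum_expChar_le_of_antitone (fun n => G 0 (n₀ + n)) M hδ (fun n hn => (hd1 n hn).1)
      (fun n hn => (hd1 n hn).2) fun n hn => ?_
    have := (hd2 (-B) 0 (fun t ht => ⟨(abs_le.1 (hB t ht)).1, h2 t ht⟩) n hn).2
    linarith

lemma norm_sum_expChar_le_of_abs_deriv (G : ℕ → ℝ → ℝ) {a b δ B : ℝ} (hδ : 0 < δ)
    (hG : ∀ k < 2, ∀ t ∈ Set.Icc a b, HasDerivAt (G k) (G (k + 1) t) t)
    (h1 : ∀ t ∈ Set.Icc a b, δ ≤ |G 1 t| ∧ |G 1 t| ≤ 1 / 2)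
    (hs : ∀ k ∈ Set.Icc 1 2, (∀ t ∈ Set.Icc a b, 0 < G k t) ∨ ∀ t ∈ Set.Icc a b, G k t < 0)
    (hB : ∀ t ∈ Set.Icc a b, |G 2 t| ≤ B) (n₀ M : ℕ) (ha : a ≤ n₀) (hb : (n₀ : ℝ) + M ≤ b + 1) :
    ‖∑ n ∈ Finset.range M, expChar (G 0 (n₀ + n))‖ ≤ 2 / δ + 1 := by
  have h2 := hs 2 (by simp)
  rcases hs 1 (by simp) with h | h
  · refine norm_sum_expChar_le_of_deriv_pos G hδ hG (fun t ht => ?_)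
      (h2.imp (fun h t ht => (h t ht).le) (fun h t ht => (h t ht).le)) hB n₀ M ha hb
    have := h1 t ht
    rwa [abs_of_pos (h t ht)] at this
  · rw [← norm_sum_expChar_neg]
    refine norm_sum_expChar_le_of_deriv_pos (fun k t => -G k t) (B := B) hδ
      (fun k hk t ht => (hG k hk t ht).neg) (fun t ht => ?_)
      (h2.symm.imp (fun h t ht => ?_) (fun h t ht => ?_)) (fun t ht => ?_) n₀ M ha hb
    · have := h1 t ht
      rwa [abs_of_neg (h t ht)] at this
    · linarith [h t ht]
    · linarith [h t ht]
    · rw [abs_neg]; exact hB t ht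

lemma eventually_norm_sum_expChar_le_of_abs_deriv (m A : ℕ) : ∀ᶠ N : ℝ in atTop,
    ∀ (G : ℕ → ℝ → ℝ) (a lam : ℝ), N ^ (-(7 / 4) : ℝ) ≤ lam → lam ≤ N ^ (-(1 / 4) : ℝ) →
    0 ≤ a →
    (∀ k < m + 2, ∀ t ∈ Set.Icc a N, HasDerivAt (G k) (G (k + 1) t) t) →
    (∀ t ∈ Set.Icc a N, lam ≤ |G (m + 2) t| ∧ |G (m + 2) t| ≤ Real.log N ^ A * lam) →
    ((∀ t ∈ Set.Icc a N, 0 < G (m + 2) t) ∨ ∀ t ∈ Set.Icc a N, G (m + 2) t < 0) →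
    ∀ n₀ M : ℕ, a ≤ n₀ → (n₀ : ℝ) + M ≤ N + 1 → 1 ≤ n₀ →
    ‖∑ n ∈ Finset.range M, expChar (G 0 (n₀ + n))‖ ≤ N / Real.log N := by
  filter_upwards [eventually_norm_sum_expChar_le m A] with N hN G a lam hl hu ha0 hG hb hs n₀ M ha
    hM hn₀
  have hn₀' : (1 : ℝ) ≤ n₀ := by exact_mod_cast hn₀
  have key : ∀ G : ℕ → ℝ → ℝ,
      (∀ k < m + 2, ∀ t ∈ Set.Icc a N, HasDerivAt (G k) (G (k + 1) t) t) →
      (∀ t ∈ Set.Icc a N, lam ≤ G (m + 2) t ∧ G (m + 2) t ≤ Real.log N ^ A * lam) →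
      ‖∑ n ∈ Finset.range M, expChar (G 0 (n₀ + n))‖ ≤ N / Real.log N := by
    intro G hG hb
    refine hN M (by linarith) lam hl hu (fun n => G 0 (n₀ + n)) fun n hn => ?_
    have hn' : (n : ℝ) + (m + 2) + 1 ≤ M := by exact_mod_cast hn
    have hn0 : (0 : ℝ) ≤ n := Nat.cast_nonneg n
    exact fwdDiff_iterate_mem_Icc (m + 2) G a N _ _ hG hb n₀ n (by linarith)
      (by push_cast; linarith)
  rcases hs with h | h
  · refine key G hG fun t ht => ?_
    have := hb t ht
    rwa [abs_of_pos (h t ht)] at this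
  · rw [← norm_sum_expChar_neg]
    refine key (fun k t => -G k t) (fun k hk t ht => (hG k hk t ht).neg) fun t ht => ?_
    have := hb t ht
    rwa [abs_of_neg (h t ht)] at this

lemma eventually_log_pow_le_rpow (A : ℕ) {c : ℝ} (hc : 0 < c) :
    ∀ᶠ N : ℝ in atTop, 2 * Real.log N ^ A ≤ N ^ c := by
  have h := (isLittleO_log_rpow_rpow_atTop (A : ℝ) hc).bound (show (0 : ℝ) < 1 / 2 by norm_num)
  filter_upwards [h, eventually_gt_atTop 1] with N h1 h2
  have hN0 : 0 < N := by linarith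
  have hl : 0 < Real.log N := Real.log_pos h2
  rw [Real.rpow_natCast, Real.norm_of_nonneg (by positivity), Real.norm_of_nonneg (by positivity)]
    at h1
  linarith

/-- Exponential sum bound for a phase whose derivatives of order `m` have the size `F / N ^ m` up
to powers of `log N`. -/
theorem eventually_norm_sum_expChar_le_of_phase (A J : ℕ) : ∀ᶠ N : ℝ in atTop,
    ∀ (G : ℕ → ℝ → ℝ) (a F : ℝ), 0 ≤ a → 0 < F → F ≤ N ^ J →
    (∀ k < J + 2, ∀ t ∈ Set.Icc a N, HasDerivAt (G k) (G (k + 1) t) t) →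
    (∀ m ∈ Set.Icc 1 (J + 2), ∀ t ∈ Set.Icc a N, F ≤ |G m t| * N ^ m * Real.log N ^ A ∧
      |G m t| * N ^ m ≤ F * Real.log N ^ A) →
    (∀ m ∈ Set.Icc 1 (J + 2),
      (∀ t ∈ Set.Icc a N, 0 < G m t) ∨ ∀ t ∈ Set.Icc a N, G m t < 0) →
    (F ≤ N ^ (1 / 2 : ℝ) → ∀ t ∈ Set.Icc a N, Real.log N ^ 2 ≤ 8 * N * |G 1 t|) →
    ∀ n₀ M : ℕ, a ≤ n₀ → (n₀ : ℝ) + M ≤ N + 1 → 1 ≤ n₀ →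
    ‖∑ n ∈ Finset.range M, expChar (G 0 (n₀ + n))‖ ≤ 2 * (N / Real.log N) := by
  have hall : ∀ᶠ N : ℝ in atTop, ∀ m : Fin (J + 1), ∀ (G : ℕ → ℝ → ℝ) (a lam : ℝ),
      N ^ (-(7 / 4) : ℝ) ≤ lam → lam ≤ N ^ (-(1 / 4) : ℝ) → 0 ≤ a →
      (∀ k < (m : ℕ) + 2, ∀ t ∈ Set.Icc a N, HasDerivAt (G k) (G (k + 1) t) t) →
      (∀ t ∈ Set.Icc a N, lam ≤ |G (m + 2) t| ∧ |G (m + 2) t| ≤ Real.log N ^ (2 * A) * lam) →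
      ((∀ t ∈ Set.Icc a N, 0 < G (m + 2) t) ∨ ∀ t ∈ Set.Icc a N, G (m + 2) t < 0) →
      ∀ n₀ M : ℕ, a ≤ n₀ → (n₀ : ℝ) + M ≤ N + 1 → 1 ≤ n₀ →
      ‖∑ n ∈ Finset.range M, expChar (G 0 (n₀ + n))‖ ≤ N / Real.log N :=
    eventually_all.2 fun m => eventually_norm_sum_expChar_le_of_abs_deriv m (2 * A)
  filter_upwards [hall, eventually_log_pow_le_rpow A (c := 1 / 4) (by norm_num),
    eventually_log_pow_le_rpow 1 (c := 1) (by norm_num),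
    Real.tendsto_log_atTop.eventually_ge_atTop 32, eventually_ge_atTop 1]
    with N hN hlogA hlog1 hlog hN1 G a F ha0 hF hFJ hG hb hs hfirst n₀ M ha hM hn₀
  have hN0 : 0 < N := one_pos.trans_le hN1
  have hl0 : 0 < Real.log N := lt_of_lt_of_le (by norm_num) hlog
  have hlA : 0 < Real.log N ^ A := by positivity
  -- For small `F` the first derivative is at most `1 / 2` and Kuzmin–Landau gives `16 N / (log N)^2
  -- + 1`.
  by_cases hsmall : F ≤ N ^ (1 / 2 : ℝ)
  · have hδ : 0 < Real.log N ^ 2 / (8 * N) := by positivity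
    refine (norm_sum_expChar_le_of_abs_deriv G (a := a) (b := N) (B := F * Real.log N ^ A / N ^ 2)
      hδ (fun k hk => hG k (by omega)) (fun t ht => ⟨?_, ?_⟩)
      (fun k hk => hs k ⟨hk.1, hk.2.trans (by omega)⟩) (fun t ht => ?_) n₀ M ha hM).trans ?_
    · rw [div_le_iff₀ (by positivity)]
      linarith [hfirst hsmall t ht]
    · have h1 := (hb 1 ⟨le_rfl, by omega⟩ t ht).2
      rw [pow_one] at h1
      have h2 : F * Real.log N ^ A ≤ N ^ (1 / 2 : ℝ) * (N ^ (1 / 4 : ℝ) / 2) := by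
        gcongr; linarith
      have h3 : N ^ (1 / 2 : ℝ) * N ^ (1 / 4 : ℝ) ≤ N := by
        rw [← Real.rpow_add hN0]
        nth_rewrite 2 [← Real.rpow_one N]
        exact Real.rpow_le_rpow_of_exponent_le hN1 (by norm_num)
      have h4 : |G 1 t| * N ≤ 1 / 2 * N := by linarith
      exact le_of_mul_le_mul_right h4 hN0
    · rw [le_div_iff₀ (by positivity)]
      exact (hb 2 ⟨by norm_num, by omega⟩ t ht).2
    · have e : 2 / (Real.log N ^ 2 / (8 * N)) = 16 / Real.log N * (N / Real.log N) := by
        field_simp; norm_num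
      have h1 : 16 / Real.log N ≤ 1 := by rw [div_le_one hl0]; linarith
      have h2 : 1 ≤ N / Real.log N := by
        rw [one_le_div hl0]
        rw [pow_one, Real.rpow_one] at hlog1; linarith
      rw [e]
      nlinarith
  · push Not at hsmall
    have hex : ∃ m : ℕ, F ≤ N ^ ((m : ℝ) - 1 / 2) := by
      refine ⟨J + 1, hFJ.trans ?_⟩
      rw [← Real.rpow_natCast]
      exact Real.rpow_le_rpow_of_exponent_le hN1 (by push_cast; linarith)
    classical
    -- Minimality gives `N ^ (m - 3/2) < F ≤ N ^ (m - 1/2)`. Then `F / N ^ m / (log N) ^ A` lies in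
    -- the admissible range from `N ^ (-7/4)` to `N ^ (-1/4)`, with `N ^ (1/4)` absorbing the
    -- logarithms.
    set m := Nat.find hex with hm
    have hmF : F ≤ N ^ ((m : ℝ) - 1 / 2) := Nat.find_spec hex
    have hmJ : m ≤ J + 1 := Nat.find_min' hex (hFJ.trans (by
      rw [← Real.rpow_natCast]
      exact Real.rpow_le_rpow_of_exponent_le hN1 (by push_cast; linarith)))
    have hm2 : 2 ≤ m := by
      by_contra hlt
      have hm1 : (m : ℝ) ≤ 1 := by exact_mod_cast (by omega : m ≤ 1)
      have : N ^ ((m : ℝ) - 1 / 2) ≤ N ^ (1 / 2 : ℝ) :=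
        Real.rpow_le_rpow_of_exponent_le hN1 (by linarith)
      linarith
    have hmin : N ^ ((m : ℝ) - 3 / 2) < F := by
      have := Nat.find_min hex (m := m - 1) (by omega)
      rw [Nat.cast_sub (by omega)] at this
      push Not at this
      refine lt_of_eq_of_lt ?_ this
      congr 1; push_cast; ring
    obtain ⟨q, hq⟩ : ∃ q, m = q + 2 := ⟨m - 2, by omega⟩
    have hNm : 0 < N ^ m := by positivity
    have hmain := hN ⟨q, by omega⟩ G a (F / N ^ m / Real.log N ^ A) ?_ ?_ ha0
      (fun k hk => hG k (by simp only at hk; omega)) ?_ ?_ n₀ M ha hM hn₀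
    · have h2 : 0 ≤ N / Real.log N := by positivity
      linarith
    · rw [le_div_iff₀ hlA, le_div_iff₀ hNm]
      calc N ^ (-(7 / 4) : ℝ) * Real.log N ^ A * N ^ m
          ≤ N ^ (-(7 / 4) : ℝ) * N ^ (1 / 4 : ℝ) * N ^ m := by gcongr; linarith
        _ = N ^ ((m : ℝ) - 3 / 2) := by
          rw [← Real.rpow_natCast N m, ← Real.rpow_add hN0, ← Real.rpow_add hN0]
          congr 1; ring
        _ ≤ F := hmin.le
    · rw [div_le_iff₀ hlA, div_le_iff₀ hNm]
      have h1 : (1 : ℝ) ≤ Real.log N ^ A := one_le_pow₀ (by linarith)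
      calc F ≤ N ^ ((m : ℝ) - 1 / 2) := hmF
        _ ≤ N ^ ((m : ℝ) - 1 / 4) := Real.rpow_le_rpow_of_exponent_le hN1 (by linarith)
        _ = N ^ (-(1 / 4) : ℝ) * 1 * N ^ m := by
          rw [mul_one, ← Real.rpow_natCast N m, ← Real.rpow_add hN0]
          congr 1; ring
        _ ≤ _ := by gcongr
    · intro t ht
      simp only
      rw [← hq]
      have h1 := hb m ⟨by omega, by omega⟩ t ht
      constructor
      · rw [div_le_iff₀ hlA, div_le_iff₀ hNm]
        linarith [h1.1]
      · have e : Real.log N ^ (2 * A) * (F / N ^ m / Real.log N ^ A) =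
            F * Real.log N ^ A / N ^ m := by
          rw [two_mul, pow_add]; field_simp
        rw [e, le_div_iff₀ hNm]
        exact h1.2
    · simp only
      rw [← hq]
      exact hs m ⟨by omega, by omega⟩

/-! ### The dominant term and pointwise bounds for the phase. -/

/-- The gain `L ^ 3` beats the coefficients, of size at most `4 * L ^ 2`, with one factor `L` left
over; that factor absorbs the number `k` of terms. -/
lemma abs_sum_sub_le_half {k : ℕ} (c : Fin k → ℝ) (τ : Fin k → ℤ) (i₀ : Fin k) {T L : ℝ}
    (hL : 0 < L) (hτ : ∀ i, |(τ i : ℝ)| ≤ T ^ 2) (hT : T ^ 2 ≤ 4 * L ^ 2) (hk : 8 * (k : ℝ) ≤ L)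
    (hd : ∀ i, i ≠ i₀ → τ i ≠ 0 → |c i| * L ^ 3 ≤ |c i₀|) :
    |∑ i, c i * (τ i : ℝ) - c i₀ * τ i₀| ≤ |c i₀| / 2 := by
  have hterm : ∀ i ∈ Finset.univ.erase i₀, |c i * (τ i : ℝ)| ≤ 4 * |c i₀| / L := by
    intro i hi
    have hne := Finset.ne_of_mem_erase hi
    by_cases h0 : τ i = 0
    · simp [h0]; positivity
    · rw [le_div_iff₀ hL, abs_mul]
      calc |c i| * |(τ i : ℝ)| * L ≤ |c i| * (4 * L ^ 2) * L := by
            gcongr; exact (hτ i).trans hT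
        _ = 4 * (|c i| * L ^ 3) := by ring
        _ ≤ 4 * |c i₀| := by linarith [hd i hne h0]
  rw [← Finset.add_sum_erase _ _ (Finset.mem_univ i₀), add_sub_cancel_left]
  refine (Finset.abs_sum_le_sum_abs _ _).trans ((Finset.sum_le_sum hterm).trans ?_)
  rw [Finset.sum_const, nsmul_eq_mul]
  have h1 : (((Finset.univ.erase i₀).card : ℕ) : ℝ) ≤ k := by
    have := Finset.card_le_univ (Finset.univ.erase i₀)
    rw [Fintype.card_fin] at this
    exact_mod_cast this
  have h2 : 0 ≤ 4 * |c i₀| / L := by positivity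
  refine (mul_le_mul_of_nonneg_right h1 h2).trans ?_
  rw [mul_div_assoc', div_le_iff₀ hL]
  nlinarith [abs_nonneg (c i₀)]

lemma abs_mul_int_bounds {c y T : ℝ} {n : ℤ} (hn : n ≠ 0) (hT : |(n : ℝ)| ≤ T)
    (h : |y - c * n| ≤ |c| / 2) : |c| ≤ 2 * |y| ∧ |y| ≤ 2 * T * |c| := by
  have h1 : (1 : ℝ) ≤ |(n : ℝ)| := by exact_mod_cast Int.one_le_abs hn
  have h2 : |c * n| = |c| * |(n : ℝ)| := abs_mul _ _
  have h3 : |c * n| - |y| ≤ |y - c * n| := by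
    rw [abs_sub_comm y]; exact abs_sub_abs_le_abs_sub _ _
  have h4 : |y| - |c * n| ≤ |y - c * n| := abs_sub_abs_le_abs_sub _ _
  have h5 := abs_nonneg c
  constructor <;> nlinarith

lemma pos_or_neg_of_abs_sub_le {α : Type*} {I : Set α} {u c y : α → ℝ} {n : ℤ} (hn : n ≠ 0)
    (hc : (∀ t ∈ I, 0 < c t) ∨ ∀ t ∈ I, c t < 0) (hu : ∀ t ∈ I, ∃ b : ℝ, 0 < b ∧ u t = b * y t)
    (h : ∀ t ∈ I, |y t - c t * n| ≤ |c t| / 2) :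
    (∀ t ∈ I, 0 < u t) ∨ ∀ t ∈ I, u t < 0 := by
  have hpos : ∀ t ∈ I, 0 < c t * n → 0 < u t := by
    intro t ht h0
    obtain ⟨b, hb, he⟩ := hu t ht
    have h1 : (1 : ℝ) ≤ |(n : ℝ)| := by exact_mod_cast Int.one_le_abs hn
    have h2 := abs_mul (c t) n
    rw [abs_of_pos h0] at h2
    have h3 := (abs_le.1 (h t ht)).1
    rw [he]
    refine mul_pos hb ?_
    nlinarith [abs_nonneg (c t)]
  have hneg : ∀ t ∈ I, c t * n < 0 → u t < 0 := by
    intro t ht h0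
    obtain ⟨b, hb, he⟩ := hu t ht
    have h1 : (1 : ℝ) ≤ |(n : ℝ)| := by exact_mod_cast Int.one_le_abs hn
    have h2 := abs_mul (c t) n
    rw [abs_of_neg h0] at h2
    have h3 := (abs_le.1 (h t ht)).2
    rw [he]
    refine mul_neg_of_pos_of_neg hb ?_
    nlinarith [abs_nonneg (c t)]
  rcases lt_or_gt_of_ne hn with h0 | h0
  · have h0 : (n : ℝ) < 0 := by exact_mod_cast h0
    rcases hc with hc | hc
    · exact Or.inr fun t ht => hneg t ht (mul_neg_of_pos_of_neg (hc t ht) h0)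
    · exact Or.inl fun t ht => hpos t ht (mul_pos_of_neg_of_neg (hc t ht) h0)
  · have h0 : (0 : ℝ) < n := by exact_mod_cast h0
    rcases hc with hc | hc
    · exact Or.inl fun t ht => hpos t ht (mul_pos (hc t ht) h0)
    · exact Or.inr fun t ht => hneg t ht (mul_neg_of_neg_of_pos (hc t ht) h0)

lemma two_mul_pow_le {l : ℝ} (hl : 2 ≤ l) (m : ℕ) : (2 * l) ^ m ≤ l ^ (2 * m) := by
  rw [pow_mul]
  exact pow_le_pow_left₀ (by linarith) (by nlinarith) m

/-- Here `fT = f i₀ (s N)`, `fx = f i₀ (s t)`, `l = log N`, `lx = log (s t)`, `c = |s ^ m (f i₀)^(m)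
(s t)|`, and `g` is the modulus of the `m`-th derivative of the phase at `t`. The monotonicity of `f
/ t ^ j` with `N ≤ t l` gives `fT ≤ fx l ^ j`, so moving from `t` to `N` costs only logarithms. -/
lemma phase_bounds_at {fT fx N t lx l c r g : ℝ} {m j A : ℕ} (hl : 2 ≤ l) (ht : 0 < t)
    (htN : t ≤ N) (hNt : N ≤ t * l) (hlx : 0 ≤ lx) (hlx' : lx ≤ 2 * l) (hfx : 0 < fx)
    (hfxT : fx ≤ fT) (hanti : fT * t ^ j ≤ fx * N ^ j) (hlow : fx ≤ c * (t ^ m * lx ^ (2 * m)))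
    (hup : c * t ^ m ≤ fx * lx ^ m) (hr : 0 < r) (hg0 : 0 ≤ g) (hg1 : c ≤ 2 * (r * g))
    (hg2 : r * g ≤ 2 * l * c) (hA : 4 * m + j + 2 ≤ A) :
    fT / r ≤ g * N ^ m * l ^ A ∧ g * N ^ m ≤ fT / r * l ^ A := by
  have hN : 0 < N := ht.trans_le htN
  have hl0 : 0 < l := by linarith
  have hl1 : 1 ≤ l := by linarith
  have hfT : 0 < fT := hfx.trans_le hfxT
  have hrg : 0 ≤ r * g := by positivity
  constructor
  · rw [div_le_iff₀ hr]
    have h1 : fT ≤ fx * l ^ j := by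
      have h2 : fT * N ^ j ≤ (fx * l ^ j) * N ^ j := by
        calc fT * N ^ j ≤ fT * (t * l) ^ j := by gcongr
          _ = fT * t ^ j * l ^ j := by ring
          _ ≤ fx * N ^ j * l ^ j := by gcongr
          _ = _ := by ring
      exact le_of_mul_le_mul_right h2 (by positivity)
    calc fT ≤ fx * l ^ j := h1
      _ ≤ c * (t ^ m * lx ^ (2 * m)) * l ^ j := by gcongr
      _ ≤ (2 * (r * g)) * (t ^ m * lx ^ (2 * m)) * l ^ j := by gcongr
      _ ≤ (l * (r * g)) * (N ^ m * (2 * l) ^ (2 * m)) * l ^ j := by gcongr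
      _ ≤ (l * (r * g)) * (N ^ m * l ^ (2 * (2 * m))) * l ^ j := by
          gcongr; exact two_mul_pow_le hl _
      _ = (r * g) * N ^ m * l ^ (4 * m + j + 1) := by ring
      _ ≤ (r * g) * N ^ m * l ^ A := by gcongr; omega
      _ = _ := by ring
  · rw [div_mul_eq_mul_div, le_div_iff₀ hr]
    calc g * N ^ m * r = (r * g) * N ^ m := by ring
      _ ≤ (2 * l * c) * N ^ m := by gcongr
      _ ≤ (2 * l * c) * (t * l) ^ m := by
          have : 0 ≤ 2 * l * c := hrg.trans hg2
          gcongr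
      _ = 2 * l * l ^ m * (c * t ^ m) := by ring
      _ ≤ 2 * l * l ^ m * (fx * lx ^ m) := by gcongr
      _ ≤ l * l * l ^ m * (fT * (2 * l) ^ m) := by gcongr
      _ ≤ l * l * l ^ m * (fT * l ^ (2 * m)) := by gcongr; exact two_mul_pow_le hl _
      _ = fT * l ^ (3 * m + 2) := by ring
      _ ≤ fT * l ^ A := by gcongr; omega

/-- Notation as in `phase_bounds_at`, with `m = 1`. Of the five logarithms in `hF`, two are lost to
`lx ^ 2` and one to `N ≤ t l` when `j = 2`; two remain. -/
lemma first_derivative_bound_at {fT fx N t lx l c r g : ℝ} {j : ℕ} (hl : 2 ≤ l) (ht : 0 < t)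
    (htN : t ≤ N) (hNt : N ≤ t * l) (hlx : 0 ≤ lx) (hlx' : lx ≤ 2 * l) (hfT : 0 < fT)
    (hanti : fT * t ^ j ≤ fx * N ^ j) (hlow : fx ≤ c * (t * lx ^ 2))
    (hr : 0 < r) (hg0 : 0 ≤ g) (hg1 : c ≤ 2 * (r * g)) (hj1 : 1 ≤ j) (hj : j ≤ 2)
    (hF : l ^ 5 ≤ fT / r) : l ^ 2 ≤ 8 * N * g := by
  have hN : 0 < N := ht.trans_le htN
  have hl0 : 0 < l := by linarith
  have hrg : 0 ≤ r * g := by positivity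
  rw [le_div_iff₀ hr] at hF
  have h1 : fx ≤ 8 * l ^ 2 * (r * g) * t := by
    calc fx ≤ c * (t * lx ^ 2) := hlow
      _ ≤ (2 * (r * g)) * (t * (2 * l) ^ 2) := by gcongr
      _ = _ := by ring
  have h2 : fT ≤ 8 * l ^ 3 * (r * g) * N := by
    rcases (by omega : j = 1 ∨ j = 2) with rfl | rfl
    · have h3 : fT * t ≤ (8 * l ^ 2 * (r * g) * N) * t := by
        calc fT * t = fT * t ^ 1 := by ring
          _ ≤ fx * N ^ 1 := hanti
          _ ≤ (8 * l ^ 2 * (r * g) * t) * N ^ 1 := by gcongr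
          _ = _ := by ring
      have h4 := le_of_mul_le_mul_right h3 ht
      have h5 : 8 * l ^ 2 * (r * g) * N ≤ 8 * l ^ 3 * (r * g) * N := by
        gcongr
        · linarith
        · norm_num
      linarith
    · have h3 : (fT * t) * t ≤ (8 * l ^ 2 * (r * g) * N ^ 2) * t := by
        calc fT * t * t = fT * t ^ 2 := by ring
          _ ≤ fx * N ^ 2 := hanti
          _ ≤ (8 * l ^ 2 * (r * g) * t) * N ^ 2 := by gcongr
          _ = _ := by ring
      have h4 := le_of_mul_le_mul_right h3 ht
      have h5 : fT * N ≤ (8 * l ^ 3 * (r * g) * N) * N := by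
        calc fT * N ≤ fT * (t * l) := by gcongr
          _ = fT * t * l := by ring
          _ ≤ 8 * l ^ 2 * (r * g) * N ^ 2 * l := by gcongr
          _ = _ := by ring
      exact le_of_mul_le_mul_right h5 hN
  have h3 : l ^ 2 * (l ^ 3 * r) ≤ (8 * N * g) * (l ^ 3 * r) := by
    calc l ^ 2 * (l ^ 3 * r) = l ^ 5 * r := by ring
      _ ≤ fT := hF
      _ ≤ _ := h2
      _ = _ := by ring
  exact le_of_mul_le_mul_right h3 (by positivity)

/-- Elements of a Hardy field are eventually monotone; the directions are forced by `f → ∞` and `f /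
t ^ j → 0`. -/
lemma IsLogHardySet.exists_growth {S : Set (ℝ → ℝ)} (hS : IsLogHardySet S) {f : ℝ → ℝ}
    (hf : f ∈ S) (hB : ConditionB f) {j : ℕ} (h1 : Prec (fun t => t ^ (j - 1)) f)
    (h2 : Prec f (fun t => t ^ j)) :
    ∀ᶠ X in atTop, MonotoneOn f (Set.Ici X) ∧ AntitoneOn (fun t => f t / t ^ j) (Set.Ici X) ∧
      ∀ t, X ≤ t → t ^ (j - 1) ≤ f t ∧ f t ≤ t ^ j := by
  have hlim := hB.tendsto_atTop
  have hmono : ∃ X, MonotoneOn f (Set.Ici X) := by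
    rcases hS.monotoneOn_or_antitoneOn hf with h | ⟨X, hX⟩
    · exact h
    · exfalso
      obtain ⟨t, h3, h4⟩ := ((hlim.eventually_gt_atTop (f X)).and (eventually_ge_atTop X)).exists
      exact absurd (hX Set.self_mem_Ici h4 h4) (not_le.2 h3)
  have hanti : ∃ X, AntitoneOn (fun t => f t / t ^ j) (Set.Ici X) := by
    have hmem : (fun t => f t / t ^ j) ∈ S :=
      hS.congr _ (hS.mul_mem _ hf _ (hS.inv_mem _ (hS.pow_mem hS.id_mem j))) _
        (Eventually.of_forall fun t => by simp [div_eq_mul_inv])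
    rcases hS.monotoneOn_or_antitoneOn hmem with ⟨X, hX⟩ | h
    · exfalso
      obtain ⟨Y, hY1, hY2, hY3⟩ := ((hlim.eventually_gt_atTop 0).and ((eventually_gt_atTop 0).and
        (eventually_ge_atTop X))).exists
      have hc : 0 < f Y / Y ^ j := by positivity
      obtain ⟨t, h3, h4, h5, h6⟩ := ((h2.eventually_gt_atTop (1 / (f Y / Y ^ j))).and
        ((hlim.eventually_gt_atTop 0).and ((eventually_ge_atTop Y).and
        (eventually_gt_atTop 0)))).exists
      have h7 := hX (show Y ∈ Set.Ici X from hY3) (show t ∈ Set.Ici X from hY3.trans h5) h5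
      have h8 := one_div_le_one_div_of_le hc h7
      have e : 1 / (f t / t ^ j) = t ^ j / f t := by field_simp
      simp only at h8
      rw [e] at h8
      linarith
    · exact h
  obtain ⟨X₁, hX₁⟩ := hmono
  obtain ⟨X₂, hX₂⟩ := hanti
  have hb : ∀ᶠ t in atTop, t ^ (j - 1) ≤ f t ∧ f t ≤ t ^ j := by
    filter_upwards [h1.eventually_ge_atTop 1, h2.eventually_ge_atTop 1,
      hlim.eventually_gt_atTop 0, eventually_gt_atTop 0] with t h3 h4 h5 h6
    rw [one_le_div (by positivity)] at h3
    rw [one_le_div h5] at h4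
    exact ⟨h3, h4⟩
  filter_upwards [eventually_ge_atTop X₁, eventually_ge_atTop X₂,
    eventually_forall_ge_atTop.2 hb] with X h3 h4 h5
  exact ⟨hX₁.mono (Set.Ici_subset_Ici.2 h3), hX₂.mono (Set.Ici_subset_Ici.2 h4), h5⟩

lemma norm_sum_Icc_expChar_le (x : ℕ → ℝ) (N n₀ : ℕ) (h1 : 1 ≤ n₀) (h2 : n₀ ≤ N + 1) :
    ‖∑ n ∈ Finset.Icc 1 N, expChar (x n)‖ ≤
      (n₀ - 1 : ℝ) + ‖∑ n ∈ Finset.range (N + 1 - n₀), expChar (x (n₀ + n))‖ := by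
  have e : Finset.Icc 1 N = Finset.Ico 1 (N + 1) := rfl
  rw [e, ← Finset.sum_Ico_consecutive _ h1 h2, Finset.sum_Ico_eq_sum_range _ n₀]
  refine (norm_add_le _ _).trans (add_le_add_left ((norm_sum_expChar_le_card _ _).trans ?_) _)
  rw [Nat.card_Ico, Nat.cast_sub h1]
  simp

lemma eventually_log_conditions : ∀ᶠ N : ℝ in atTop, 2 ≤ Real.log N ∧ Real.log N ^ 2 ≤ N ∧
    logTwo N ^ 2 ≤ Real.log N ∧ 2 ≤ logTwo N ∧ 1 < N := by
  have h : ∀ᶠ y : ℝ in atTop, Real.log y ^ 2 ≤ y := by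
    have := (Real.isLittleO_pow_log_id_atTop (n := 2)).bound one_pos
    filter_upwards [this, eventually_ge_atTop 0] with y hy h0
    simp only [Real.norm_eq_abs, id, one_mul] at hy
    rw [abs_of_nonneg h0] at hy
    exact (le_abs_self _).trans hy
  filter_upwards [h, Real.tendsto_log_atTop.eventually h, eventually_logs_ge 2]
    with N h1 h2 h3
  exact ⟨h3.2.1, h1, h2, h3.2.2.1, by linarith [h3.1]⟩

lemma log_le_two_mul_log {N x : ℝ} (hx : 0 < x) (hx2 : x ≤ N ^ 2) :
    Real.log x ≤ 2 * Real.log N := by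
  have := Real.log_le_log hx hx2
  rwa [Real.log_pow] at this

/-- Converts the bound on `τ`, stated at `N`, into one at the sample point `x = s t`: here `N ≤ x ^
2`, so the iterated logarithms differ by at most `log 2`. -/
lemma logTwo_sq_le {N x : ℝ} (hN : 1 < N) (h1 : 2 ≤ Real.log N) (h2 : Real.log N ^ 2 ≤ N)
    (h3 : 2 ≤ logTwo N) (hx : N / Real.log N ≤ x) : logTwo N ^ 2 ≤ 4 * logTwo x ^ 2 := by
  have hl0 : 0 < Real.log N := by linarith
  have hN0 : 0 < N := by linarith
  have hx0 : 0 < x := lt_of_lt_of_le (by positivity) hx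
  have h4 : N ≤ x ^ 2 := by
    calc N = N * Real.log N ^ 2 / Real.log N ^ 2 := by field_simp
      _ ≤ N * N / Real.log N ^ 2 := by gcongr
      _ = (N / Real.log N) ^ 2 := by ring
      _ ≤ x ^ 2 := by gcongr
  have h5 := Real.log_le_log hN0 h4
  rw [Real.log_pow] at h5
  push_cast at h5
  have h6 : Real.log (Real.log N / 2) ≤ Real.log (Real.log x) :=
    Real.log_le_log (by positivity) (by linarith)
  rw [Real.log_div (by positivity) (by norm_num)] at h6
  have h7 : Real.log 2 ≤ 1 := by
    have := Real.log_two_lt_d9; linarith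
  have h8 : logTwo N ≤ 2 * logTwo x := by
    unfold logTwo at *; linarith
  have := pow_le_pow_left₀ (by linarith : 0 ≤ logTwo N) h8 2
  linarith [mul_pow 2 (logTwo x) 2]

lemma ConditionC.exists_perm {k : ℕ} {f : Fin k → ℝ → ℝ} (hC : ConditionC f)
    (hB : ∀ i, ConditionB (f i)) : ∃ σ : Equiv.Perm (Fin k), ∀ p q : Fin k, q < p →
      ∀ᶠ t in atTop, |f (σ q) t| * logTwo t ^ 4 ≤ |f (σ p) t| := by
  obtain ⟨σ, hσ⟩ := hC
  refine ⟨σ, ?_⟩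
  have hpos : ∀ i, ∀ᶠ t in atTop, 0 < f i t := fun i =>
    (hB i).tendsto_atTop.eventually_gt_atTop 0
  have hstep : ∀ i j : Fin k, (i : ℕ) + 1 = j →
      ∀ᶠ t in atTop, |f (σ i) t| * logTwo t ^ 4 ≤ |f (σ j) t| := by
    intro i j hij
    filter_upwards [(hσ i j hij).eventually_ge_atTop 1, hpos (σ i), hpos (σ j),
      eventually_logs_ge 1] with t h1 h2 h3 h4
    have h5 : 0 < logTwo t := by linarith [h4.2.2.1]
    rw [one_le_div (by positivity), le_div_iff₀ h2] at h1
    rw [abs_of_pos h2, abs_of_pos h3]; linarith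
  have key : ∀ n : ℕ, ∀ (hn : n < k) (q : Fin k), (q : ℕ) < n →
      ∀ᶠ t in atTop, |f (σ q) t| * logTwo t ^ 4 ≤ |f (σ ⟨n, hn⟩) t| := by
    intro n
    induction n with
    | zero => intro _ q hq; omega
    | succ n ih =>
      intro hn q hq
      have h1 := hstep ⟨n, by omega⟩ ⟨n + 1, hn⟩ rfl
      rcases Nat.lt_succ_iff_lt_or_eq.1 hq with h | h
      · filter_upwards [h1, ih (by omega) q h, eventually_logs_ge 1] with t h2 h3 h4
        have h5 : 1 ≤ logTwo t ^ 4 := one_le_pow₀ h4.2.2.1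
        nlinarith [abs_nonneg (f (σ ⟨n, by omega⟩) t)]
      · have e : q = ⟨n, by omega⟩ := Fin.ext h
        rw [e]; exact h1
  exact fun p q hqp => key p p.2 q hqp

/-! ### Uniform estimates and the conclusion. -/

/-- Properties of the functions at all points beyond `X`, up to the derivative of order `M`. -/
structure GoodBeyond {k : ℕ} (f : Fin k → ℝ → ℝ) (i₀ : Fin k) (D : Set (Fin k)) (j M : ℕ)
    (X : ℝ) : Prop where
  one_lt : 1 < X
  differentiable : ∀ x, X ≤ x → ∀ i, ∀ m : Fin (M + 1), DifferentiableAt ℝ (deriv^[m] (f i)) x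
  bounds : ∀ x, X ≤ x → ∀ m : Fin (M + 1),
    f i₀ x ≤ |deriv^[m] (f i₀) x| * (x * Real.log x ^ 2) ^ (m : ℕ) ∧
      |deriv^[m] (f i₀) x| * x ^ (m : ℕ) ≤ f i₀ x * Real.log x ^ (m : ℕ)
  dominated : ∀ x, X ≤ x → ∀ m : Fin (M + 1), ∀ i, i ∈ D →
    |deriv^[m] (f i) x| * logTwo x ^ 3 ≤ |deriv^[m] (f i₀) x|
  sign : ∀ m : Fin (M + 1),
    (∀ x, X ≤ x → 0 < deriv^[m] (f i₀) x) ∨ ∀ x, X ≤ x → deriv^[m] (f i₀) x < 0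
  mono : MonotoneOn (f i₀) (Set.Ici X)
  anti : AntitoneOn (fun t => f i₀ t / t ^ j) (Set.Ici X)
  growth : ∀ t, X ≤ t → t ^ (j - 1) ≤ f i₀ t ∧ f i₀ t ≤ t ^ j
  logTwo_ge : ∀ x, X ≤ x → 8 * (k : ℝ) + 1 ≤ logTwo x

lemma IsLogHardySet.eventually_goodBeyond {S : Set (ℝ → ℝ)} (hS : IsLogHardySet S) {k : ℕ}
    (f : Fin k → ℝ → ℝ) (hf : ∀ i, f i ∈ S) (i₀ : Fin k) (hB : ConditionB (f i₀))
    (D : Set (Fin k)) (hD : ∀ i ∈ D, ∀ᶠ t in atTop, |f i t| * logTwo t ^ 4 ≤ |f i₀ t|)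
    {j : ℕ} (h1 : Prec (fun t => t ^ (j - 1)) (f i₀)) (h2 : Prec (f i₀) (fun t => t ^ j)) (M : ℕ) :
    ∀ᶠ X in atTop, GoodBeyond f i₀ D j M X := by
  have e1 : ∀ᶠ x in atTop, ∀ i, ∀ m : Fin (M + 1), DifferentiableAt ℝ (deriv^[m] (f i)) x :=
    eventually_all.2 fun i => eventually_all.2 fun m =>
      hS.differentiable _ (hS.iterate_deriv_mem (hf i) m)
  have e2 := eventually_all.2 fun m : Fin (M + 1) =>
    hS.eventually_iterate_deriv_bounds (hf i₀) hB m
  have e3 : ∀ᶠ x in atTop, ∀ m : Fin (M + 1), ∀ i, i ∈ D →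
      |deriv^[m] (f i) x| * logTwo x ^ 3 ≤ |deriv^[m] (f i₀) x| :=
    eventually_all.2 fun m => eventually_all.2 fun i => by
      by_cases hi : i ∈ D
      · filter_upwards [hS.iterate_deriv_mul_logTwo_le (hf i) (hf i₀) hB (hD i hi) m]
          with x hx _ using hx
      · exact Eventually.of_forall fun x h => absurd h hi
  have e4 : ∀ᶠ X : ℝ in atTop, ∀ m : Fin (M + 1),
      (∀ x, X ≤ x → 0 < deriv^[m] (f i₀) x) ∨ ∀ x, X ≤ x → deriv^[m] (f i₀) x < 0 := by
    refine eventually_all.2 fun m => ?_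
    rcases hS.trichotomy (hS.iterate_deriv_mem (hf i₀) m) with h | h | h
    · obtain ⟨t, a1, a2⟩ := (h.and (hS.iterate_deriv_ne_zero (hf i₀) hB m)).exists
      exact absurd a1 a2
    · exact (eventually_forall_ge_atTop.2 h).mono fun X hX => Or.inl hX
    · exact (eventually_forall_ge_atTop.2 h).mono fun X hX => Or.inr hX
  filter_upwards [eventually_gt_atTop 1, eventually_forall_ge_atTop.2 e1,
    eventually_forall_ge_atTop.2 e2, eventually_forall_ge_atTop.2 e3, e4,
    hS.exists_growth (hf i₀) hB h1 h2,
    eventually_forall_ge_atTop.2 (tendsto_logTwo.eventually_ge_atTop (8 * (k : ℝ) + 1))]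
    with X a1 a2 a3 a4 a5 a6 a7
  exact ⟨a1, a2, a3, a4, a5, a6.1, a6.2.1, a6.2.2, a7⟩

/-- The phase `t ↦ ⟨f(st), τ⟩ / r` and its derivatives. -/
noncomputable def phaseDeriv {k : ℕ} (f : Fin k → ℝ → ℝ) (τ : Fin k → ℤ) (r s : ℝ) (m : ℕ)
    (t : ℝ) : ℝ :=
  (1 / r) * ∑ i, (s ^ m * deriv^[m] (f i) (s * t)) * (τ i : ℝ)

lemma hasDerivAt_phaseDeriv {k : ℕ} (f : Fin k → ℝ → ℝ) (τ : Fin k → ℤ) (r s : ℝ) (m : ℕ) (t : ℝ)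
    (h : ∀ i, DifferentiableAt ℝ (deriv^[m] (f i)) (s * t)) :
    HasDerivAt (phaseDeriv f τ r s m) (phaseDeriv f τ r s (m + 1) t) t := by
  unfold phaseDeriv
  refine HasDerivAt.const_mul _ (HasDerivAt.fun_sum fun i _ => HasDerivAt.mul_const ?_ _)
  have h1 : HasDerivAt (fun t => deriv^[m] (f i) (s * t)) (deriv (deriv^[m] (f i)) (s * t) * s) t :=
    (h i).hasDerivAt.comp t (by simpa using (hasDerivAt_id t).const_mul s)
  refine (h1.const_mul (s ^ m)).congr_deriv ?_
  rw [Function.iterate_succ_apply']; ring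

namespace GoodBeyond

variable {k : ℕ} {f : Fin k → ℝ → ℝ} {i₀ : Fin k} {D : Set (Fin k)} {j M : ℕ} {X N r s : ℝ}
  {τ : Fin k → ℤ}

/-- The relation between the phase and its dominant term. -/
lemma abs_sum_sub_le (h : GoodBeyond f i₀ D j M X) (hN : 1 < N) (hl1 : 2 ≤ Real.log N)
    (hl2 : Real.log N ^ 2 ≤ N) (hl4 : 2 ≤ logTwo N)
    (hτ : ∀ i, |(τ i : ℝ)| ≤ logTwo N ^ 2) (hD : ∀ i, i ≠ i₀ → τ i ≠ 0 → i ∈ D)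
    (hs : 0 < s) (m : ℕ) (hm : m ≤ M) {t : ℝ} (hX : X ≤ s * t) (hx : N / Real.log N ≤ s * t) :
    |∑ i, (s ^ m * deriv^[m] (f i) (s * t)) * (τ i : ℝ) -
      (s ^ m * deriv^[m] (f i₀) (s * t)) * τ i₀| ≤ |s ^ m * deriv^[m] (f i₀) (s * t)| / 2 := by
  have hL := h.logTwo_ge _ hX
  have hk0 : (0 : ℝ) ≤ k := Nat.cast_nonneg k
  refine abs_sum_sub_le_half (fun i => s ^ m * deriv^[m] (f i) (s * t)) τ i₀
    (T := logTwo N) (L := logTwo (s * t)) (by linarith) hτ (logTwo_sq_le hN hl1 hl2 hl4 hx)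
    (by linarith) fun i hi h0 => ?_
  have h1 := h.dominated _ hX ⟨m, by omega⟩ i (hD i hi h0)
  have h2 : 0 < s ^ m := by positivity
  rw [abs_mul, abs_mul, abs_of_pos h2, mul_assoc]
  exact mul_le_mul_of_nonneg_left h1 h2.le

end GoodBeyond

theorem IsLogHardySet.eventually_norm_sum_le {S : Set (ℝ → ℝ)} (hS : IsLogHardySet S) {k : ℕ}
    (f : Fin k → ℝ → ℝ) (hf : ∀ i, f i ∈ S) (i₀ : Fin k) (hB : ConditionB (f i₀))
    (D : Set (Fin k)) (hD : ∀ i ∈ D, ∀ᶠ t in atTop, |f i t| * logTwo t ^ 4 ≤ |f i₀ t|) :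
    ∀ᶠ N : ℕ in atTop,
      ∀ r ∈ Set.Icc (1 : ℝ) (min (N : ℝ) (minAbs f N / Real.log N ^ 5)),
      ∀ s ∈ Set.Icc (1 : ℝ) (min (N : ℝ) (minAbs f N / Real.log N ^ 5)),
      ∀ τ : Fin k → ℤ, (∀ i, |(τ i : ℝ)| ≤ logTwo N ^ 2) → τ i₀ ≠ 0 →
        (∀ i, i ≠ i₀ → τ i ≠ 0 → i ∈ D) →
        ‖∑ n ∈ Finset.Icc 1 N, expChar ((1 / r) * ∑ i, f i (s * n) * (τ i : ℝ))‖
          ≤ 3 * N / Real.log N := by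
  obtain ⟨j, hj, hp1, hp2⟩ := id hB
  -- Since `s t ≤ N ^ 2`, one has `F ≤ N ^ (2 * j)`, so the phase theorem is used with `J = 2 * j`
  -- and needs `2 * j + 2` derivatives; `A` collects the logarithms lost at the highest order.
  obtain ⟨X, hX⟩ := (hS.eventually_goodBeyond f hf i₀ hB D hD hp1 hp2 (2 * j + 2)).exists
  set A := 4 * (2 * j + 2) + j + 2 with hA
  have hlim : Tendsto (fun N : ℝ => N / Real.log N) atTop atTop := by
    have := Real.isLittleO_log_id_atTop.tendsto_div_nhds_zero
    have h2 : Tendsto (fun N : ℝ => (Real.log N / N)⁻¹) atTop atTop := by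
      refine Tendsto.inv_tendsto_nhdsGT_zero ?_
      refine tendsto_nhdsWithin_iff.2 ⟨this, ?_⟩
      filter_upwards [eventually_gt_atTop 1] with N hN
      exact div_pos (Real.log_pos hN) (by linarith)
    simpa using h2
  have hcast := tendsto_natCast_atTop_atTop (R := ℝ)
  filter_upwards [hcast.eventually (eventually_norm_sum_expChar_le_of_phase A (2 * j)),
    hcast.eventually eventually_log_conditions, hcast.eventually (hlim.eventually_ge_atTop X)]
    with N hphase hlogs hNX r hr s hs τ hτ hτ0 hτD
  obtain ⟨hl1, hl2, hl3, hl4, hN1⟩ := hlogs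
  set l := Real.log (N : ℝ) with hl
  have hl0 : 0 < l := by linarith
  have hN0 : (0 : ℝ) < N := by linarith
  have hr0 : 0 < r := by linarith [hr.1]
  have hs0 : 0 < s := by linarith [hs.1]
  have hrN : r ≤ N := hr.2.trans (min_le_left _ _)
  have hsN : s ≤ N := hs.2.trans (min_le_left _ _)
  have ha0 : 0 < (N : ℝ) / l := by positivity
  have hX0 : 0 < X := by linarith [hX.one_lt]
  have hXN : X ≤ N := hNX.trans (div_le_self hN0.le (by linarith))
  have hXT : X ≤ s * N := hXN.trans (le_mul_of_one_le_left hN0.le hs.1)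
  have hT0 : 0 < s * N := by positivity
  set F := f i₀ (s * N) / r with hF
  have hfT := hX.growth _ hXT
  have hfT0 : 0 < f i₀ (s * N) := lt_of_lt_of_le (by positivity) hfT.1
  have hF0 : 0 < F := by positivity
  have hfN := hX.growth _ hXN
  -- The upper bound on `r` gives this at `N`; as `s ≥ 1` and `f i₀` is increasing, it persists at
  -- `s N`.
  have hF5 : l ^ 5 ≤ F := by
    rw [hF, le_div_iff₀ hr0]
    have h1 : r ≤ minAbs f N / l ^ 5 := hr.2.trans (min_le_right _ _)
    rw [le_div_iff₀ (by positivity)] at h1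
    have h2 : minAbs f N ≤ |f i₀ N| := ciInf_le (Set.finite_range _).bddBelow i₀
    have h3 : 0 < f i₀ N := lt_of_lt_of_le (by positivity) hfN.1
    rw [abs_of_pos h3] at h2
    have h4 : f i₀ N ≤ f i₀ (s * N) := hX.mono (show (N : ℝ) ∈ Set.Ici X from hXN)
      (show s * (N : ℝ) ∈ Set.Ici X from hXT) (le_mul_of_one_le_left hN0.le hs.1)
    linarith
  have hFJ : F ≤ (N : ℝ) ^ (2 * j) := by
    rw [hF, div_le_iff₀ hr0]
    calc f i₀ (s * N) ≤ (s * N) ^ j := hfT.2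
      _ ≤ (N * N : ℝ) ^ j := by gcongr
      _ = (N : ℝ) ^ (2 * j) * 1 := by rw [pow_mul]; ring
      _ ≤ (N : ℝ) ^ (2 * j) * r := by gcongr; exact hr.1
  have hpt : ∀ t ∈ Set.Icc ((N : ℝ) / l) N, X ≤ s * t ∧ (N : ℝ) / l ≤ s * t ∧ 0 < t ∧
      (N : ℝ) ≤ t * l ∧ 0 < Real.log (s * t) ∧ Real.log (s * t) ≤ 2 * l := by
    intro t ht
    have ht0 : 0 < t := ha0.trans_le ht.1
    have h1 : t ≤ s * t := le_mul_of_one_le_left ht0.le hs.1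
    have h2 : X ≤ s * t := (hNX.trans ht.1).trans h1
    refine ⟨h2, ht.1.trans h1, ht0, (div_le_iff₀ hl0).1 ht.1,
      Real.log_pos (hX.one_lt.trans_le h2), log_le_two_mul_log (by positivity) ?_⟩
    rw [sq]
    exact mul_le_mul hsN ht.2 ht0.le hN0.le
  have hmain : ∀ m ≤ 2 * j + 2, ∀ t ∈ Set.Icc ((N : ℝ) / l) N,
      |∑ i, (s ^ m * deriv^[m] (f i) (s * t)) * (τ i : ℝ) -
        (s ^ m * deriv^[m] (f i₀) (s * t)) * τ i₀| ≤ |s ^ m * deriv^[m] (f i₀) (s * t)| / 2 :=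
    fun m hm t ht => hX.abs_sum_sub_le hN1 hl1 hl2 hl4 hτ hτD hs0 m hm (hpt t ht).1
      (hpt t ht).2.1
  have hrG : ∀ m t, r * |phaseDeriv f τ r s m t| =
      |∑ i, (s ^ m * deriv^[m] (f i) (s * t)) * (τ i : ℝ)| := by
    intro m t
    unfold phaseDeriv
    rw [abs_mul, abs_of_pos (by positivity : 0 < 1 / r)]
    field_simp
  have hfacts : ∀ m ≤ 2 * j + 2, ∀ t ∈ Set.Icc ((N : ℝ) / l) N,
      0 < f i₀ (s * t) ∧ f i₀ (s * t) ≤ f i₀ (s * N) ∧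
      f i₀ (s * N) * t ^ j ≤ f i₀ (s * t) * (N : ℝ) ^ j ∧
      f i₀ (s * t) ≤ |s ^ m * deriv^[m] (f i₀) (s * t)| *
        (t ^ m * Real.log (s * t) ^ (2 * m)) ∧
      |s ^ m * deriv^[m] (f i₀) (s * t)| * t ^ m ≤ f i₀ (s * t) * Real.log (s * t) ^ m ∧
      |s ^ m * deriv^[m] (f i₀) (s * t)| ≤ 2 * (r * |phaseDeriv f τ r s m t|) ∧
      r * |phaseDeriv f τ r s m t| ≤ 2 * l * |s ^ m * deriv^[m] (f i₀) (s * t)| := by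
    intro m hm t ht
    obtain ⟨b1, b2, b3, b4, b5, b6⟩ := hpt t ht
    have hst : s * t ≤ s * N := mul_le_mul_of_nonneg_left ht.2 hs0.le
    have hx0 : 0 < s * t := by positivity
    have hg := hX.growth _ b1
    have hfx : 0 < f i₀ (s * t) := lt_of_lt_of_le (by positivity) hg.1
    have hbd := hX.bounds _ b1 ⟨m, by omega⟩
    simp only at hbd
    have hsm : 0 < s ^ m := by positivity
    have hτl := abs_mul_int_bounds hτ0 ((hτ i₀).trans hl3) (hmain m hm t ht)
    rw [← hrG] at hτl
    refine ⟨hfx, hX.mono b1 hXT hst, ?_, ?_, ?_, hτl.1, hτl.2⟩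
    · have h1 := hX.anti b1 hXT hst
      simp only at h1
      rw [div_le_div_iff₀ (by positivity) (by positivity), mul_pow, mul_pow] at h1
      have h2 : (f i₀ (s * N) * t ^ j) * s ^ j ≤ (f i₀ (s * t) * (N : ℝ) ^ j) * s ^ j := by
        linarith
      exact le_of_mul_le_mul_right h2 (by positivity)
    · refine hbd.1.trans (le_of_eq ?_)
      rw [abs_mul, abs_of_pos hsm, mul_pow, mul_pow, ← pow_mul]; ring
    · refine le_trans (le_of_eq ?_) hbd.2
      rw [abs_mul, abs_of_pos hsm, mul_pow]; ring
  have hn₀ : (N : ℝ) / l ≤ ⌈(N : ℝ) / l⌉₊ := Nat.le_ceil _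
  have hn₀1 : 1 ≤ ⌈(N : ℝ) / l⌉₊ := Nat.one_le_ceil_iff.2 ha0
  have hn₀N : ⌈(N : ℝ) / l⌉₊ ≤ N := Nat.ceil_le.2 (div_le_self hN0.le (by linarith))
  have hsum := hphase (phaseDeriv f τ r s) (N / l) F ha0.le hF0 hFJ
    (fun m hm t ht => hasDerivAt_phaseDeriv f τ r s m t fun i =>
      hX.differentiable _ (hpt t ht).1 i ⟨m, by omega⟩)
    (fun m hm t ht => by
      obtain ⟨b1, b2, b3, b4, b5, b6⟩ := hpt t ht
      obtain ⟨c1, c2, c3, c4, c5, c6, c7⟩ := hfacts m hm.2 t ht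
      have := hm.2
      exact phase_bounds_at hl1 b3 ht.2 b4 b5.le b6 c1 c2 c3 c4 c5 hr0 (abs_nonneg _) c6 c7
        (by omega))
    (fun m hm => by
      refine pos_or_neg_of_abs_sub_le (u := phaseDeriv f τ r s m)
        (c := fun t => s ^ m * deriv^[m] (f i₀) (s * t)) hτ0 ?_ (fun t ht => ⟨1 / r, by positivity, rfl⟩)
        (hmain m hm.2)
      have hsm : 0 < s ^ m := by positivity
      exact (hX.sign ⟨m, Nat.lt_succ_of_le hm.2⟩).imp
        (fun h t ht => mul_pos hsm (h _ (hpt t ht).1))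
        (fun h t ht => mul_neg_of_pos_of_neg hsm (h _ (hpt t ht).1)))
    (fun hsmall t ht => by
      obtain ⟨b1, b2, b3, b4, b5, b6⟩ := hpt t ht
      obtain ⟨c1, c2, c3, c4, c5, c6, c7⟩ := hfacts 1 (by omega) t ht
      -- For `j ≥ 3` one has `f i₀ (s N) ≥ N ^ 2`, and `r ≤ N` gives `F ≥ N`, too large for this
      -- case.
      have hj2 : j ≤ 2 := by
        by_contra hcon
        have h1 : (N : ℝ) ^ 2 ≤ f i₀ (s * N) := by
          calc (N : ℝ) ^ 2 ≤ (N : ℝ) ^ (j - 1) := pow_le_pow_right₀ hN1.le (by omega)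
            _ ≤ (s * N) ^ (j - 1) := by gcongr; exact le_mul_of_one_le_left hN0.le hs.1
            _ ≤ _ := hfT.1
        have h2 : (N : ℝ) ≤ F := by
          rw [hF, le_div_iff₀ hr0]
          nlinarith
        have h3 : (N : ℝ) ^ (1 / 2 : ℝ) < (N : ℝ) ^ (1 : ℝ) :=
          Real.rpow_lt_rpow_of_exponent_lt hN1 (by norm_num)
        rw [Real.rpow_one] at h3
        linarith
      rw [pow_one t, mul_one] at c4
      exact first_derivative_bound_at hl1 b3 ht.2 b4 b5.le b6 hfT0 c3 c4 hr0 (abs_nonneg _) c6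
        hj hj2 hF5)
    ⌈(N : ℝ) / l⌉₊ (N + 1 - ⌈(N : ℝ) / l⌉₊) hn₀
    (by rw [Nat.cast_sub (by omega)]; push_cast; linarith) hn₀1
  have hsplit := norm_sum_Icc_expChar_le (fun n => (1 / r) * ∑ i, f i (s * n) * (τ i : ℝ)) N
    ⌈(N : ℝ) / l⌉₊ hn₀1 (by omega)
  have hceil : (⌈(N : ℝ) / l⌉₊ : ℝ) < N / l + 1 := Nat.ceil_lt_add_one ha0.le
  have e : 3 * (N : ℝ) / l = N / l + 2 * (N / l) := by ring
  simp only [phaseDeriv, pow_zero, one_mul, Function.iterate_zero, id] at hsum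
  push_cast at hsplit
  rw [e]
  linarith

theorem mainTheorem4 (H : Subring (Filter.Germ (Filter.atTop : Filter ℝ) ℝ)) (hH : IsHardyField H)
    (k : ℕ) (hk : 1 ≤ k) (f : Fin k → ℝ → ℝ)
    (hf : ∀ i, (f i : Filter.Germ (Filter.atTop : Filter ℝ) ℝ) ∈ H)
    (hB : ∀ i, ConditionB (f i))
    (hlog : ∀ i, Prec logTwo (fun t => Real.log (f i t)))
    (hC : ConditionC f) :
    ∃ C : ℝ, 0 < C ∧ ∀ N : ℕ, 2 ≤ N →
      ∀ r ∈ Set.Icc (1 : ℝ) (min (N : ℝ) (minAbs f N / Real.log N ^ 5)),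
      ∀ s ∈ Set.Icc (1 : ℝ) (min (N : ℝ) (minAbs f N / Real.log N ^ 5)),
      s ≤ r →
      ∀ τ : Fin k → ℤ, (∀ i, |(τ i : ℝ)| ≤ logTwo N ^ 2) → τ ≠ 0 →
        ‖∑ n ∈ Finset.Icc 1 N, expChar ((1 / r) * ∑ i, f i (s * n) * (τ i : ℝ))‖
          ≤ C * N / Real.log N := by
  obtain ⟨S, hS, hsub, m1, m2, m3, m4⟩ := hH.isHardySet.exists_extension_logs
  have hS' : IsLogHardySet S := ⟨hS, m1, m2, m3, m4⟩
  obtain ⟨σ, hσ⟩ := hC.exists_perm hB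
  have hev := eventually_all.2 fun p : Fin k => hS'.eventually_norm_sum_le f
    (fun i => hsub (hf i)) (σ p) (hB (σ p)) {i | ∃ q < p, i = σ q} (by
      rintro i ⟨q, hq, rfl⟩
      exact hσ p q hq)
  obtain ⟨N₀, hN₀⟩ := eventually_atTop.1 hev
  -- The summand `|log N₀|` makes the trivial bound `N` sufficient when `N < N₀`.
  refine ⟨3 + |Real.log N₀|, by positivity, fun N hN r hr s hs _ τ hτ hτ0 => ?_⟩
  have hN1 : (1 : ℝ) < N := by exact_mod_cast hN
  have hl0 : 0 < Real.log N := Real.log_pos hN1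
  rcases le_or_gt N₀ N with h | h
  -- `p` is the last position in the order of growth with a nonzero coefficient; all other nonzero
  -- coefficients belong to functions dominated by `f (σ p)`.
  · obtain ⟨p, hp, hmax⟩ : ∃ p : Fin k, τ (σ p) ≠ 0 ∧ ∀ q, τ (σ q) ≠ 0 → q ≤ p := by
      have hne : (Finset.univ.filter fun p : Fin k => τ (σ p) ≠ 0).Nonempty := by
        obtain ⟨i, hi⟩ := Function.ne_iff.1 hτ0
        exact ⟨σ.symm i, by simpa using hi⟩
      refine ⟨_, (Finset.mem_filter.1 (Finset.max'_mem _ hne)).2, fun q hq => ?_⟩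
      exact Finset.le_max' _ _ (by simpa using hq)
    refine (hN₀ N h p r hr s hs τ hτ hp fun i hi hi0 => ?_).trans ?_
    · refine ⟨σ.symm i, lt_of_le_of_ne (hmax _ (by simpa using hi0)) ?_, by simp⟩
      rintro rfl
      simp at hi
    · gcongr
      linarith [abs_nonneg (Real.log N₀)]
  · refine (norm_sum_expChar_le_card _ _).trans ?_
    rw [Nat.card_Icc, Nat.add_sub_cancel, le_div_iff₀ hl0, mul_comm]
    have : Real.log N ≤ Real.log N₀ := Real.log_le_log (by linarith) (by exact_mod_cast h.le)
    gcongr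
    linarith [le_abs_self (Real.log N₀)]
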